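/- Let $p$ be a prime. Binomial coefficients $\binom nm$ are taken to be $0$ unless $0\le m\le n$. **The algebra $\mathcal B$.** For $p=2$, $\mathcal B$ is the $\mathbb Z$-graded $\mathbb F_2$-algebra generated by $Q^s$, $s\in\mathbb Z$, of degree $s$, subject to $$Q^{2s+r+1}Q^s=\sum_{i\ge 0}\tbinom{r-i-1}{i}Q^{2s+i+1}Q^{r+s-i}\qquad(r\ge 0).$$ For $p>2$, $\mathcal B$ is the $\mathbb Z$-graded $\mathbb F_p$-algebra generated by $Q^s_\epsilon$, $s\in\mathbb Z$, $\epsilon\in\{0,1\}$, of degree $2s(p-1)-\epsilon$, subject to the following relations for $r\ge0$ (where $Q^s=Q^s_0$ and all sums run over $i\ge0$): $$\begin{aligned} Q^{ps+r+1}Q^s&=\sum(-1)^{i+1}\tbinom{(p-1)(r-i)-1}{i}Q^{ps+i+1}Q^{r+s-i},\\ Q^{ps+r}Q_1^s&=\sum(-1)^{i}\tbinom{(p-1)(r-i)}{i}Q_1^{ps+i}Q^{r+s-i}+\sum(-1)^{i+1}\tbinom{(p-1)(r-i)-1}{i}Q^{ps+i}Q_1^{r+s-i},\\ Q_1^{ps+r+1}Q^s&=\sum(-1)^{i+1}\tbinom{(p-1)(r-i)-1}{i}Q_1^{ps+i+1}Q^{r+s-i},\\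 Q_1^{ps+r}Q_1^s&=\sum(-1)^{i+1}\tbinom{(p-1)(r-i)-1}{i}Q_1^{ps+i}Q_1^{r+s-i}. \end{aligned}$$ **$F$-modules.** An $F$-module is a $\mathbb Z$-graded $\mathcal B$-module $M$ that is unstable: for $m\in M$ homogeneous, $Q^rm=0$ if $r<|m|$ (for $p=2$), resp. $Q^r_\epsilon m=0$ if $2r-\epsilon<|m|$ (for $p>2$). Morphisms of $\mathcal B$-modules and of $F$-modules preserve degrees; $\operatorname{Ext}_{\mathcal B}$ and $\operatorname{Ext}_F$ are taken in these two abelian categories, and the exact inclusion of $F$-modules into $\mathcal B$-modules induces maps $\operatorname{Ext}^n_F\to\operatorname{Ext}^n_{\mathcal B}$. Write $e_a$ for $\mathbb F_p$ in degree $a$ with all operations zero, and $H^n(F)(e_a)$ for the graded vector space $\operatorname{Ext}^n_F(e_*,e_a)$. **The classes $\lambda_I$.** A generator $Q$ of degree $d$ has a dual class $\hat Q\in\operatorname{Ext}^1(e_a,e_{a+d})$, the class of the extension $0\to e_{a+d}\to E\to e_a\to0$ in which $Q$ maps the basis vector of degree $a$ to that of degree $a+d$, all other operations being zero. It exists over $\mathcal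 B$ for all $a$, and over $F$ exactly when $Q$ is not required to vanish in degree $a$. For $x\in\operatorname{Ext}^n(e_a,e_b)$ and $y\in\operatorname{Ext}^m(e_b,e_c)$ put $xy=(-1)^{n(b-c+m)}\,y\circ x$. Let * $\lambda_r=\hat Q^{-r-1}\in\operatorname{Ext}^1(e_a,e_{a-r-1})$ for $p=2$; * $\lambda_r^\epsilon=\hat Q{}^{-r}_{1-\epsilon}\in\operatorname{Ext}^1(e_a,e_{a-2r(p-1)+\epsilon-1})$ for $p>2$. For $I=(r_1,\dots,r_n)$, resp. $I=(r_1,\epsilon_1,\dots,r_n,\epsilon_n)$, let $\lambda_I=\lambda_{r_1}\cdots\lambda_{r_n}$, resp. $\lambda_I=\lambda_{r_1}^{\epsilon_1}\cdots\lambda_{r_n}^{\epsilon_n}$ (the identity if $n=0$); it is homogeneous, lying in $\operatorname{Ext}^n(e_a,e_{a-|I|})$ with $|I|=\sum_i(r_i+1)$, resp. $|I|=\sum_i(2r_i(p-1)-\epsilon_i+1)$. Call $I$ *coadmissible* if $2r_i\ge r_{i+1}$, resp. $pr_i-\epsilon_i\ge r_{i+1}$, for all $1\le i<n$. **Theorem.**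 Let $a\in\mathbb Z$ and $n\ge0$ (the inequalities below are void for $n=0$). 1. The map $\operatorname{Ext}^n_F(e_a,e_b)\to\operatorname{Ext}^n_{\mathcal B}(e_a,e_b)$ is injective for all $b$, and its image has as basis those $\lambda_I$ of degree $b=a-|I|$ for which $I$ is a coadmissible sequence of length $n$ with * $r_1<-a$, if $p=2$; * $2r_1-\epsilon_1<-a$, if $p>2$. For these $I$, the class $\lambda_I$ over $F$ maps to the class $\lambda_I$ over $\mathcal B$. 2. The graded vector space $H^n(F)(e_a)$ has as basis those $\lambda_I\in\operatorname{Ext}^n_F(e_{a+|I|},e_a)$ for which $I$ is a coadmissible sequence of length $n$ with * $2r_1+r_2+\cdots+r_n+n<-a$, if $p=2$; * $2(pr_1-\epsilon_1)+\sum_{i=2}^n(2r_i(p-1)-\epsilon_i)+n<-a$, if $p>2$. 3. ("Big lambda algebra".) Over $\mathcal B$, the $\lambda$'s satisfy the relations of the graded opposite of $\mathcal B$: each of the relations $\sum c\,Q^s_\delta Q^{s'}_{\delta'}=0$ above gives $\sum c\,(-1)^{\delta\delta'}\lambda^{\delta'}_{s'}\lambda^{\delta}_{s}=0$ (for $p=2$: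 each $\sum c\,Q^sQ^{s'}=0$ gives $\sum c\,\lambda_{s'}\lambda_s=0$). For all $a$, $b$, $n$ the coadmissible $\lambda_I$ of length $n$ and of degree $|I|=a-b$ form a basis of the span of all products of $n$ of the $\lambda$'s in $\operatorname{Ext}^n_{\mathcal B}(e_a,e_b)$. -/

import Mathlib

open CategoryTheory CategoryTheory.Limits CategoryTheory.Abelian

noncomputable section

namespace DyerLashof

/-! ### Graded modules over a graded algebra presented by operations and quadratic relations -/

/-- A presentation of a `ℤ`-graded `k`-algebra: generating operations `Op`, the degree `deg` of each
of them, and a set `rel` of quadratic relations.  The formal sum `ρ ∈ rel` stands for the relation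
`∑ ρ (g, h) • (g h) = 0`, where `g h` is the product (first apply `h`, then `g`). -/
structure QuadraticPresentation (k : Type) [Field k] where
  Op : Type
  deg : Op → ℤ
  rel : Set (Op × Op →₀ k)

variable {k : Type} [Field k] (A : QuadraticPresentation k)

/-- The quiver with vertices the integers and with one edge `a ⟶ a + deg g` for every operation `g`
and every integer `a`. -/
structure Degree {k : Type} [Field k] (A : QuadraticPresentation k) where
  val : ℤ

instance : Quiver (Degree A) where
  Hom a b := {g : A.Op // a.val + A.deg g = b.val}

/-- Graded `k`-modules with operations `g : M_a → M_{a + deg g}`, subject to no relations: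
representations of the quiver `Degree A`. -/
abbrev Rep := Paths (Degree A) ⥤ ModuleCat.{0} k

variable {A}

/-- The object of the path category given by an integer. -/
def vert (A : QuadraticPresentation k) (a : ℤ) : Paths (Degree A) :=
  (Paths.of (Degree A)).obj ⟨a⟩

/-- The operation `g : M_a → M_b` on `M`, where `b = a + deg g`; it is `0` for all other `b`. -/
def act (M : Rep A) (g : A.Op) (a b : ℤ) : M.obj (vert A a) ⟶ M.obj (vert A b) :=
  open Classical in
  if h : a + A.deg g = b then
    M.map ((Paths.of (Degree A)).map (X := ⟨a⟩) (Y := ⟨b⟩) ⟨g, h⟩) else 0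

lemma act_of_eq (M : Rep A) (g : A.Op) {a b : ℤ} (h : a + A.deg g = b) :
    act M g a b = M.map ((Paths.of (Degree A)).map (X := ⟨a⟩) (Y := ⟨b⟩) ⟨g, h⟩) :=
  dif_pos h

lemma act_naturality {M N : Rep A} (f : M ⟶ N) (g : A.Op) (a b : ℤ) :
    act M g a b ≫ f.app (vert A b) = f.app (vert A a) ≫ act N g a b := by
  unfold act
  split_ifs
  · exact f.naturality _
  · simp

/-- The composite operation `∑ ρ (g, h) • (g h) : M_a → M_b`. -/
def relMap (M : Rep A) (ρ : A.Op × A.Op →₀ k) (a b : ℤ) :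
    M.obj (vert A a) ⟶ M.obj (vert A b) :=
  ρ.sum fun gh c ↦ c • (act M gh.2 a (a + A.deg gh.2) ≫ act M gh.1 (a + A.deg gh.2) b)

lemma relMap_eq_zero (M : Rep A) (ρ : A.Op × A.Op →₀ k) (a b : ℤ)
    (h : ∀ (g₁ g₂ : A.Op) (c : ℤ), act M g₁ a c ≫ act M g₂ c b = 0) : relMap M ρ a b = 0 :=
  Finset.sum_eq_zero fun gh _ ↦ by
    change _ • (act M gh.2 a _ ≫ act M gh.1 _ b) = 0
    rw [h, smul_zero]

lemma relMap_naturality {M N : Rep A} (f : M ⟶ N) (ρ : A.Op × A.Op →₀ k) (a b : ℤ) :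
    relMap M ρ a b ≫ f.app (vert A b) = f.app (vert A a) ≫ relMap N ρ a b := by
  simp only [relMap, Finsupp.sum, Preadditive.sum_comp, Preadditive.comp_sum, Linear.smul_comp,
    Linear.comp_smul, Category.assoc]
  refine Finset.sum_congr rfl fun gh _ ↦ ?_
  rw [act_naturality, ← Category.assoc, act_naturality, Category.assoc]

variable (A) in
/-- The graded modules over the algebra presented by `A` such that moreover `g x = 0` for
all operations `g` and all `x` of degree `a` with `Z g a`. -/
def isModule (Z : A.Op → ℤ → Prop) : ObjectProperty (Rep A) := fun M ↦
  (∀ ρ ∈ A.rel, ∀ a b : ℤ, relMap M ρ a b = 0) ∧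
    ∀ (g : A.Op) (a b : ℤ), Z g a → act M g a b = 0

variable (A) in
/-- The category of the modules of `isModule A Z`; its morphisms are the degree-preserving linear
maps that commute with all operations. -/
abbrev GrMod (Z : A.Op → ℤ → Prop) := (isModule A Z).FullSubcategory

/-- No instability condition. -/
def stable {k : Type} [Field k] (A : QuadraticPresentation k) : A.Op → ℤ → Prop :=
  fun _ _ ↦ False

section abelian

variable (Z : A.Op → ℤ → Prop)

instance : (isModule A Z).IsClosedUnderSubobjects where
  prop_of_mono {M N} f _ hN := by
    refine ⟨fun ρ hρ a b ↦ ?_, fun g a b h ↦ ?_⟩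
    · rw [← cancel_mono (f.app (vert A b)), relMap_naturality, hN.1 ρ hρ, zero_comp, comp_zero]
    · rw [← cancel_mono (f.app (vert A b)), act_naturality, hN.2 g a b h, zero_comp, comp_zero]

instance : (isModule A Z).IsClosedUnderQuotients where
  prop_of_epi {M N} f _ hM := by
    refine ⟨fun ρ hρ a b ↦ ?_, fun g a b h ↦ ?_⟩
    · rw [← cancel_epi (f.app (vert A a)), ← relMap_naturality, hM.1 ρ hρ, zero_comp, comp_zero]
    · rw [← cancel_epi (f.app (vert A a)), ← act_naturality, hM.2 g a b h, zero_comp, comp_zero]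

instance : (isModule A Z).IsClosedUnderFiniteProducts where
  isClosedUnderLimitsOfShape J _ :=
    { limitsOfShape_le := by
        rintro M ⟨p⟩
        have key (b : ℤ) {X : ModuleCat.{0} k} (u v : X ⟶ M.obj (vert A b))
            (h : ∀ j, u ≫ (p.π.app j).app (vert A b) = v ≫ (p.π.app j).app (vert A b)) : u = v :=
          (isLimitOfPreserves ((evaluation _ _).obj (vert A b)) p.isLimit).hom_ext h
        refine ⟨fun ρ hρ a b ↦ key b _ _ fun j ↦ ?_, fun g a b h ↦ key b _ _ fun j ↦ ?_⟩
        · rw [relMap_naturality (M := M) (N := p.diag.obj j) (p.π.app j),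
            (p.prop_diag_obj j).1 ρ hρ, zero_comp, comp_zero]
        · rw [act_naturality (M := M) (N := p.diag.obj j) (p.π.app j),
            (p.prop_diag_obj j).2 g a b h, zero_comp, comp_zero] }

lemma isModule_of_isZero {M : Rep A} (h : IsZero M) : isModule A Z M := by
  have hz (b : ℤ) : IsZero (M.obj (vert A b)) := (Functor.isZero_iff M).1 h _
  exact ⟨fun _ _ _ b ↦ (hz b).eq_of_tgt _ _, fun _ _ b _ ↦ (hz b).eq_of_tgt _ _⟩

instance : (isModule A Z).ContainsZero where
  exists_zero := ⟨_, isZero_zero (Rep A), isModule_of_isZero Z (isZero_zero _)⟩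

instance : Abelian (GrMod A Z) := inferInstance

instance : HasExt.{1} (GrMod A Z) := HasExt.standard _

instance : PreservesFiniteLimits (isModule A Z).ι :=
  (Functor.preservesFiniteLimits_tfae (isModule A Z).ι).out 2 3 |>.1
    (isModule A Z).preservesKernels_ι

instance : PreservesFiniteColimits (isModule A Z).ι :=
  (Functor.preservesFiniteColimits_tfae (isModule A Z).ι).out 2 3 |>.1
    (isModule A Z).preservesCokernels_ι

variable {Z} {Z' : A.Op → ℤ → Prop}

lemma isModule_anti (h : ∀ g a, Z' g a → Z g a) : isModule A Z ≤ isModule A Z' :=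
  fun _ hM ↦ ⟨hM.1, fun g a b hg ↦ hM.2 g a b (h g a hg)⟩

variable (Z) in
/-- The inclusion of the modules satisfying the condition `Z` into all modules. -/
def toStable : GrMod A Z ⥤ GrMod A (stable A) :=
  ObjectProperty.ιOfLE (isModule_anti fun _ _ h ↦ h.elim)

instance : (toStable Z).Additive where
  map_add := rfl

instance : (toStable Z).Linear k where
  map_smul _ _ := rfl

instance : PreservesFiniteLimits (toStable Z) :=
  have : PreservesFiniteLimits (toStable Z ⋙ (isModule A (stable A)).ι) :=
    inferInstanceAs (PreservesFiniteLimits (isModule A Z).ι)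
  preservesFiniteLimits_of_reflects_of_preserves (toStable Z) (isModule A (stable A)).ι

instance : PreservesFiniteColimits (toStable Z) :=
  have : PreservesFiniteColimits (toStable Z ⋙ (isModule A (stable A)).ι) :=
    inferInstanceAs (PreservesFiniteColimits (isModule A Z).ι)
  preservesFiniteColimits_of_reflects_of_preserves (toStable Z) (isModule A (stable A)).ι

end abelian

/-! ### The modules `e_a` and the classes of degree one -/

/-- A morphism between representations of the quiver `Degree A`, given on the vertices and
compatible with the edges. -/
def liftHom {φ ψ : Degree A ⥤q ModuleCat.{0} k} (f : ∀ c, φ.obj c ⟶ ψ.obj c)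
    (hf : ∀ {c d : Degree A} (e : c ⟶ d), φ.map e ≫ f d = f c ≫ ψ.map e) :
    Paths.lift φ ⟶ Paths.lift ψ where
  app := f
  naturality c d p := by
    have key {c d : Degree A} (p : Quiver.Path c d) :
        (Paths.lift φ).map p ≫ f d = f c ≫ (Paths.lift ψ).map p := by
      induction p with
      | nil => exact (Category.id_comp _).trans (Category.comp_id _).symm
      | cons p e ih =>
        change ((Paths.lift φ).map p ≫ φ.map e) ≫ f _ = f c ≫ ((Paths.lift ψ).map p ≫ ψ.map e)
        refine (Category.assoc _ _ _).trans ?_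
        refine (congrArg (fun z ↦ (Paths.lift φ).map p ≫ z) (hf e)).trans ?_
        refine (Category.assoc _ _ _).symm.trans ?_
        exact (congrArg (fun z ↦ z ≫ ψ.map e) ih).trans (Category.assoc _ _ _)
    exact key p

lemma act_lift (φ : Degree A ⥤q ModuleCat.{0} k) (g : A.Op) {a b : ℤ} (h : a + A.deg g = b) :
    act (Paths.lift φ) g a b = φ.map (X := ⟨a⟩) (Y := ⟨b⟩) ⟨g, h⟩ := by
  rw [act_of_eq _ _ h]
  exact Paths.lift_toPath _ _

lemma act_of_ne (M : Rep A) (g : A.Op) {a b : ℤ} (h : a + A.deg g ≠ b) : act M g a b = 0 :=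
  dif_neg h

/-- The graded vector space with a copy of `k` in degree `a` and with zero operations. -/
def simpleRep (A : QuadraticPresentation k) (a : ℤ) : Degree A ⥤q ModuleCat.{0} k where
  obj c := ModuleCat.of k (PLift (c.val = a) → k)
  map _ := 0

/-- For `b = a + deg g`, the graded vector space with basis `x` in degree `a` and `y` in degree `b`,
where `g x = y` and all the other operations on basis vectors are zero. -/
def extensionRep (g : A.Op) {a b : ℤ} (h : a + A.deg g = b) : Degree A ⥤q ModuleCat.{0} k where
  obj c := ModuleCat.of k ((PLift (c.val = a) → k) × (PLift (c.val = b) → k))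
  map {c d} e :=
    open Classical in
    ModuleCat.ofHom
      { toFun v := (0, fun q ↦ if hg : e.1 = g then
          v.1 ⟨by have h1 := e.2; have h2 := q.down; rw [hg] at h1; omega⟩ else 0)
        map_add' v w := by
          ext q
          · simp
          · by_cases hg : e.1 = g <;> simp [hg]
        map_smul' r v := by
          ext q
          · simp
          · by_cases hg : e.1 = g <;> simp [hg] }

variable (Z : A.Op → ℤ → Prop)

lemma isModule_simple (a : ℤ) : isModule A Z (Paths.lift (simpleRep A a)) := by
  have key (g : A.Op) (c d : ℤ) : act (Paths.lift (simpleRep A a)) g c d = 0 := by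
    by_cases h : c + A.deg g = d
    · rw [act_lift _ _ h]; rfl
    · exact act_of_ne _ _ h
  exact ⟨fun ρ _ c d ↦ relMap_eq_zero _ _ _ _ fun _ _ _ ↦ by rw [key, zero_comp], fun g c d _ ↦ key g c d⟩

lemma isModule_extension (g : A.Op) {a b : ℤ} (h : a + A.deg g = b) (hZ : ¬ Z g a) :
    isModule A Z (Paths.lift (extensionRep g h)) := by
  have key (g₁ g₂ : A.Op) (c d e : ℤ) : act (Paths.lift (extensionRep g h)) g₁ c d ≫
      act (Paths.lift (extensionRep g h)) g₂ d e = 0 := by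
    by_cases h₁ : c + A.deg g₁ = d
    · by_cases h₂ : d + A.deg g₂ = e
      · rw [act_lift _ _ h₁, act_lift _ _ h₂]
        ext v
        refine Prod.ext rfl (funext fun q ↦ ?_)
        by_cases hg : g₂ = g
        · exact dif_pos hg
        · exact dif_neg hg
      · rw [act_of_ne _ _ h₂, comp_zero]
    · rw [act_of_ne _ _ h₁, zero_comp]
  refine ⟨fun ρ _ c d ↦ relMap_eq_zero _ _ _ _ fun _ _ _ ↦ key _ _ _ _ _, fun g' c d hg ↦ ?_⟩
  by_cases h₁ : c + A.deg g' = d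
  · rw [act_lift _ _ h₁]
    ext v
    refine Prod.ext rfl (funext fun q ↦ ?_)
    have : g' ≠ g := by
      rintro rfl
      have : d = b := q.down
      obtain rfl : c = a := by omega
      exact hZ hg
    exact dif_neg this
  · exact act_of_ne _ _ h₁

/-- The module `e_a`: a copy of `k` in degree `a`, all operations being zero. -/
def e (a : ℤ) : GrMod A Z := ⟨Paths.lift (simpleRep A a), isModule_simple Z a⟩

/-- The extension `0 ⟶ e_b ⟶ E ⟶ e_a ⟶ 0`, where `E` has basis `x` in degree `a` and
`y = g x` in degree `b = a + deg g`. -/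
def extension (g : A.Op) {a b : ℤ} (h : a + A.deg g = b) (hZ : ¬ Z g a) :
    ShortComplex (GrMod A Z) where
  X₁ := e Z b
  X₂ := ⟨Paths.lift (extensionRep g h), isModule_extension Z g h hZ⟩
  X₃ := e Z a
  f := ObjectProperty.homMk (liftHom (φ := simpleRep A b) (ψ := extensionRep g h)
    (fun c ↦ ModuleCat.ofHom (LinearMap.inr k (PLift (c.val = a) → k) (PLift (c.val = b) → k)))
    fun g' ↦ by
      ext v
      refine Prod.ext rfl (funext fun q ↦ ?_)
      trans (0 : k)
      · exact congrFun (congrArg Prod.snd (map_zero (LinearMap.inr k _ (PLift (_ = b) → k)))) q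
      · symm
        by_cases hg : g'.1 = g
        · exact dif_pos hg
        · exact dif_neg hg)
  g := ObjectProperty.homMk (liftHom (φ := extensionRep g h) (ψ := simpleRep A a)
    (fun c ↦ ModuleCat.ofHom (LinearMap.fst k (PLift (c.val = a) → k) (PLift (c.val = b) → k)))
    fun _ ↦ by
      ext v
      rfl)
  zero := by
    ext c v
    rfl

lemma extension_shortExact (g : A.Op) {a b : ℤ} (h : a + A.deg g = b) (hZ : ¬ Z g a) :
    (extension Z g h hZ).ShortExact := by
  refine CategoryTheory.ShortExact.reflects_shortExact_of_faithful (isModule A Z).ι ?_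
  have hs (c : Paths (Degree A)) :
      (((extension Z g h hZ).map (isModule A Z).ι).map ((evaluation _ _).obj c)).ShortExact := by
    refine ShortComplex.ShortExact.mk' ?_ ?_ ?_
    · rw [ShortComplex.moduleCat_exact_iff]
      rintro ⟨u, v⟩ hu
      refine ⟨v, Prod.ext ?_ rfl⟩
      exact hu.symm
    · exact (ModuleCat.mono_iff_injective _).2 fun u v huv ↦ congrArg Prod.snd huv
    · exact (ModuleCat.epi_iff_surjective _).2 fun u ↦ ⟨(u, 0), rfl⟩
  refine ShortComplex.ShortExact.mk' ?_ ?_ ?_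
  · rw [ShortComplex.exact_iff_isZero_homology, Functor.isZero_iff]
    intro c
    refine IsZero.of_iso ((ShortComplex.exact_iff_isZero_homology _).1 (hs c).exact)
      (ShortComplex.mapHomologyIso _ ((evaluation _ _).obj c)).symm
  · exact @NatTrans.mono_of_mono_app _ _ _ _ _ _ _ (fun c ↦ (hs c).mono_f)
  · exact @NatTrans.epi_of_epi_app _ _ _ _ _ _ _ (fun c ↦ (hs c).epi_g)

/-- The class in `Ext¹(e_a, e_b)`, for `b = a + deg g`, that is dual to the generator `g`: the class
of the extension of `e_a` by `e_b` in which `g` is the only operation that is not zero.  It does not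
exist if `g` is required to vanish on elements of degree `a`; the value is then `0`, as it is for
`b ≠ a + deg g`. -/
def dualClass (g : A.Op) (a b : ℤ) : Ext (e Z a) (e Z b) 1 :=
  open Classical in
  if h : a + A.deg g = b ∧ ¬ Z g a then (extension_shortExact Z g h.1 h.2).extClass else 0

/-! ### Products -/

variable {Z}

/-- The product `x y = (-1) ^ (n (b - c + m)) • (y ∘ x)` of `x ∈ Extⁿ(e_a, e_b)` and
`y ∈ Extᵐ(e_b, e_c)`, where `y ∘ x` is the composition of extensions. -/
def mul {n m l : ℕ} {a b c : ℤ} (x : Ext (e Z a) (e Z b) n) (y : Ext (e Z b) (e Z c) m)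
    (h : n + m = l) : Ext (e Z a) (e Z c) l :=
  ((n : ℤ) * (b - c + m)).negOnePow • x.comp y h

variable (Z)

/-- The product `ĝ₁ ĝ₂ ⋯ ĝₙ ∈ Extⁿ(e_a, e_b)` of the classes dual to `g₁, …, gₙ`, where
`b = a + ∑ deg gᵢ` (and `0` for all other `b`).  The empty product is the identity of `e_a`. -/
def dualProd : (n : ℕ) → (Fin n → A.Op) → (a b : ℤ) → Ext (e Z a) (e Z b) n
  | 0, _, a, b =>
    open Classical in
    if h : a = b then Ext.mk₀ (eqToHom (congrArg (e Z) h)) else 0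
  | n + 1, g, a, b =>
    mul (dualClass Z (g 0) a (a + A.deg (g 0)))
      (dualProd n (Fin.tail g) (a + A.deg (g 0)) b) (Nat.add_comm 1 n)

/-- The map `Extⁿ(e_a, e_b) → Extⁿ(e_a, e_b)` from the `Ext` of the modules satisfying the
condition `Z` to the `Ext` of all modules. -/
def extToStable (n : ℕ) (a b : ℤ) :
    Ext (e Z a) (e Z b) n →ₗ[k] Ext (e (stable A) a) (e (stable A) b) n :=
  (toStable Z).mapExtLinearMap k (e Z a) (e Z b) n

/-- The family `v` is a basis of the subspace `N`. -/
def IsBasisOf {ι M : Type*} [AddCommGroup M] [Module k M] (v : ι → M) (N : Submodule k M) : Prop :=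
  LinearIndependent k v ∧ Submodule.span k (Set.range v) = N

/-! ### The algebras of Dyer-Lashof operations -/

/-- The binomial coefficient, with the convention that it vanishes unless `0 ≤ m ≤ n`. -/
def binom (n m : ℤ) : ℕ := if 0 ≤ m ∧ m ≤ n then n.toNat.choose m.toNat else 0

section two

/-- The big Steenrod algebra `𝓑` for the prime `2`: the operation `s : ℤ` is `Q^s`, of degree `s`,
and the relations are
`Q^{2s+r+1} Q^s = ∑ binom (r-i-1) i • Q^{2s+i+1} Q^{r+s-i}` for `r ≥ 0`, where `i` runs over
`0 ≤ i < r/2`, the other summands being zero. -/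
def big₂ : QuadraticPresentation (ZMod 2) where
  Op := ℤ
  deg s := s
  rel := {ρ | ∃ (s : ℤ) (r : ℕ), ρ =
    Finsupp.single (2 * s + r + 1, s) 1 -
      ∑ i ∈ Finset.range (r + 1),
        Finsupp.single (2 * s + i + 1, r + s - i) (binom (r - i - 1) i : ZMod 2)}

/-- Instability for `p = 2`: `Q^r x = 0` for `r < |x|`. -/
def unstable₂ : big₂.Op → ℤ → Prop := fun (r : ℤ) a ↦ r < a

/-- The operation `Q^{-r-1}`, whose dual class is `λ_r`. -/
def star₂ (r : ℤ) : big₂.Op := (-r - 1 : ℤ)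

/-- The class `λ_I = λ_{r₁} ⋯ λ_{rₙ} ∈ Extⁿ(e_a, e_b)` for `I = (r₁, …, rₙ)` and `p = 2`. -/
def lambda₂ (Z : big₂.Op → ℤ → Prop) {n : ℕ} (I : Fin n → ℤ) (a b : ℤ) :
    Ext (e Z a) (e Z b) n :=
  dualProd Z n (fun i ↦ star₂ (I i)) a b

/-- `I = (r₁, …, rₙ)` is coadmissible if `2 rᵢ ≥ rᵢ₊₁` for each `i`. -/
def Coadmissible₂ {n : ℕ} (I : Fin n → ℤ) : Prop :=
  ∀ (i : ℕ) (h : i + 1 < n), I ⟨i + 1, h⟩ ≤ 2 * I ⟨i, by omega⟩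

/-- The integer `∑ᵢ (rᵢ + 1)`, so that `λ_I ∈ Extⁿ(e_a, e_{a - shift₂ I})`. -/
def shift₂ {n : ℕ} (I : Fin n → ℤ) : ℤ := ∑ i, (I i + 1)

end two

section odd

variable (p : ℕ) [Fact p.Prime]

/-- The big Steenrod algebra `𝓑` for an odd prime `p`: the operation `(ε, s)` is `Q^s_ε`, of degree
`2s(p-1) - ε`, and the relations are, for `r ≥ 0`,
* `Q^{ps+r+1} Q^s = ∑ (-1)^{i+1} binom ((p-1)(r-i)-1) i • Q^{ps+i+1} Q^{r+s-i}`;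
* `Q^{ps+r} Q_1^s = ∑ (-1)^i binom ((p-1)(r-i)) i • Q_1^{ps+i} Q^{r+s-i}
    + ∑ (-1)^{i+1} binom ((p-1)(r-i)-1) i • Q^{ps+i} Q_1^{r+s-i}`;
* `Q_1^{ps+r+1} Q^s = ∑ (-1)^{i+1} binom ((p-1)(r-i)-1) i • Q_1^{ps+i+1} Q^{r+s-i}`;
* `Q_1^{ps+r} Q_1^s = ∑ (-1)^{i+1} binom ((p-1)(r-i)-1) i • Q_1^{ps+i} Q_1^{r+s-i}`.

Here `i` runs over the finitely many `i ≥ 0` for which the binomial coefficient is not zero; these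
satisfy `i ≤ r`. -/
def bigOdd : QuadraticPresentation (ZMod p) where
  Op := Fin 2 × ℤ
  deg g := 2 * g.2 * (p - 1) - (g.1 : ℕ)
  rel :=
    {ρ | ∃ (s : ℤ) (r : ℕ), ρ =
      Finsupp.single ((0, p * s + r + 1), (0, s)) 1 -
        ∑ i ∈ Finset.range (r + 1), Finsupp.single ((0, p * s + i + 1), (0, r + s - i))
          ((-1) ^ (i + 1) * (binom ((p - 1) * (r - i) - 1) i : ZMod p))} ∪
    {ρ | ∃ (s : ℤ) (r : ℕ), ρ =
      Finsupp.single ((0, p * s + r), (1, s)) 1 -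
        (∑ i ∈ Finset.range (r + 1), Finsupp.single ((1, p * s + i), (0, r + s - i))
          ((-1) ^ i * (binom ((p - 1) * (r - i)) i : ZMod p)) +
        ∑ i ∈ Finset.range (r + 1), Finsupp.single ((0, p * s + i), (1, r + s - i))
          ((-1) ^ (i + 1) * (binom ((p - 1) * (r - i) - 1) i : ZMod p)))} ∪
    {ρ | ∃ (s : ℤ) (r : ℕ), ρ =
      Finsupp.single ((1, p * s + r + 1), (0, s)) 1 -
        ∑ i ∈ Finset.range (r + 1), Finsupp.single ((1, p * s + i + 1), (0, r + s - i))
          ((-1) ^ (i + 1) * (binom ((p - 1) * (r - i) - 1) i : ZMod p))} ∪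
    {ρ | ∃ (s : ℤ) (r : ℕ), ρ =
      Finsupp.single ((1, p * s + r), (1, s)) 1 -
        ∑ i ∈ Finset.range (r + 1), Finsupp.single ((1, p * s + i), (1, r + s - i))
          ((-1) ^ (i + 1) * (binom ((p - 1) * (r - i) - 1) i : ZMod p))}

/-- Instability for odd `p`: `Q^r_ε x = 0` for `2r - ε < |x|`. -/
def unstableOdd : (bigOdd p).Op → ℤ → Prop :=
  fun (g : Fin 2 × ℤ) a ↦ 2 * g.2 - (g.1 : ℕ) < a

/-- The operation `Q^{-r}_{1-ε}`, whose dual class is `λ_r^ε`, for `g = (ε, r)`. -/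
def starOdd (g : Fin 2 × ℤ) : (bigOdd p).Op := ((1 - g.1, -g.2) : Fin 2 × ℤ)

/-- The class `λ_I = λ_{r₁}^{ε₁} ⋯ λ_{rₙ}^{εₙ} ∈ Extⁿ(e_a, e_b)` for odd `p`, where the sequence
`I = (r₁, ε₁, …, rₙ, εₙ)` is given by the pairs `(εᵢ, rᵢ)`. -/
def lambdaOdd (Z : (bigOdd p).Op → ℤ → Prop) {n : ℕ} (I : Fin n → Fin 2 × ℤ) (a b : ℤ) :
    Ext (e Z a) (e Z b) n :=
  dualProd Z n (fun i ↦ starOdd p (I i)) a b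

/-- `I = (r₁, ε₁, …, rₙ, εₙ)` is coadmissible if `p rᵢ - εᵢ ≥ rᵢ₊₁` for each `i`. -/
def CoadmissibleOdd {n : ℕ} (I : Fin n → Fin 2 × ℤ) : Prop :=
  ∀ (i : ℕ) (h : i + 1 < n),
    (I ⟨i + 1, h⟩).2 ≤ p * (I ⟨i, by omega⟩).2 - ((I ⟨i, by omega⟩).1 : ℕ)

/-- The integer `∑ᵢ (2 rᵢ (p - 1) - εᵢ + 1)`, so that `λ_I ∈ Extⁿ(e_a, e_{a - shiftOdd p I})`. -/
def shiftOdd {n : ℕ} (I : Fin n → Fin 2 × ℤ) : ℤ :=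
  ∑ i, (2 * (I i).2 * (p - 1) - ((I i).1 : ℕ) + 1)

end odd

/-- The classes dual to the operations `star g` satisfy the relations of the graded opposite of the
algebra presented by `A`: if `∑ c (g h) = 0` is a relation of `A`, then
`∑ c (-1) ^ (|g| |h|) ĥ* ĝ* = 0`, where `ĝ*` is the class dual to `star g`. -/
def OppositeRelations (A : QuadraticPresentation k) (star : A.Op → A.Op) : Prop :=
  ∀ ρ ∈ A.rel, ∀ a b : ℤ,
    ρ.sum (fun gh c ↦ c • ((A.deg gh.1 * A.deg gh.2).negOnePow •
      dualProd (stable A) 2 ![star gh.2, star gh.1] a b)) = 0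

end DyerLashof

end

open DyerLashof

/-! The theorem is a form of Koszulness of the big Steenrod algebra, proved so as to include the
instability condition. The argument is run for abstract quadratic presentations whose operations are
ordered by an integer value `v`. The condition `unst t` makes `g` vanish in degree `a` if `v g + t <
a`; `t = 0` gives the `F`-modules.

Upper bound. Suppose that the admissible words form a basis of the algebra. The cyclic module on a
generator of degree `a` on which operations of value at least `K` vanish then has a basis of
admissible words: those that instability allows and whose first letter has value less than `K`. The
words that begin with the largest possible letter `g` span a cyclic module again. The resulting
short exact sequence (`cycSeq`) maps to the extension that defines the class dual to `g`
(`cycSeqHom`). Descending induction on `K`, starting where `Ext` vanishes for degree reasons, shows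
that the products of dual classes over coadmissible words span `Ext` between the simple unstable
modules (`span_dualProd`). Each product over the big algebra is already defined over `unst t` for
large `t`, so the coadmissible products also span the products over the big algebra.

Lower bound. The Koszul complex consists of the formal sums of words that are combinations of
relations at every two consecutive places. By dimension shifting, its elements pair with products of
dual classes, and a combination of products that is zero in `Ext` pairs to zero (`pairing`). If each
coadmissible word is the term of largest weight of some element of the Koszul complex, then the
coadmissible products are independent over the big algebra. Combined with the upper bound this gives
the bases, and also the injectivity of the map from the unstable to the stable `Ext`.

Self-duality. The involution `star` exchanges admissible and inadmissible composites, and up to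
signs the relations are orthogonal to their images under `star`. The same triangular elements of the
Koszul complex therefore give functionals on words that kill all relations, and these prove that the
admissible words are independent, as the upper bound requires. The relations between the dual
classes follow from the same orthogonality.

Construction of the triangular elements. The Adem coefficients are those of `(1 - X) ^ ((p - 1) * j
- 1)`. As `(1 - X) ^ p = 1 - X ^ p` in characteristic `p`, the relations are generated by one
element (`p = 2`) or four elements (`p` odd) under the operators `z_i + z_{i+1}` and `(z_{i+1} ^ p *
z_i) ^ m`, `m` an integer, where `z_j` raises the index of the letter at place `j`. The polynomials
`frobSym` preserve the relations at all places. Their products, applied to a word all of whose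
consecutive composites are zero, yield elements of the Koszul complex with any coadmissible leading
word; for odd `p` the letters `Q_1` are introduced beforehand by exterior multiplication with the
forms `formSeq`. -/

noncomputable section

namespace DyerLashof

variable {k : Type} [Field k] {A : QuadraticPresentation k}

/-! ### Words in the operations, and their rewriting -/

/-- The degree of a word.  Words are written in the order of application: the head of the list is
the operation that is applied first. -/
def wdeg (w : List A.Op) : ℤ := (w.map A.deg).sum

@[simp] lemma wdeg_nil : wdeg ([] : List A.Op) = 0 := rfl

@[simp] lemma wdeg_cons (g : A.Op) (w : List A.Op) : wdeg (g :: w) = A.deg g + wdeg w := by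
  simp [wdeg]

@[simp] lemma wdeg_append (w w' : List A.Op) : wdeg (w ++ w') = wdeg w + wdeg w' := by
  simp [wdeg]

/-- The formal sum of words `x ρ y`. -/
def ins (x y : List A.Op) (ρ : A.Op × A.Op →₀ k) : List A.Op →₀ k :=
  ρ.mapDomain fun q ↦ x ++ q.2 :: q.1 :: y

variable (A) in
/-- The two-sided ideal of relations. -/
def relSpan : Submodule k (List A.Op →₀ k) :=
  Submodule.span k {u | ∃ x y, ∃ ρ ∈ A.rel, u = ins x y ρ}

lemma ins_mem (x y : List A.Op) {ρ : A.Op × A.Op →₀ k} (hρ : ρ ∈ A.rel) :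
    ins x y ρ ∈ relSpan A := Submodule.subset_span ⟨x, y, ρ, hρ, rfl⟩

/-- An enumeration of the operations by the integers, along which the degree increases. -/
structure OpOrder (A : QuadraticPresentation k) where
  v : A.Op ≃ ℤ
  deg_lt : ∀ {g h}, v g < v h → A.deg g < A.deg h
  deg_zero : A.deg (v.symm 0) = 0

namespace OpOrder

variable (O : OpOrder A)

/-- The composite "first `h`, then `g`" is inadmissible. -/
def Inadm (h g : A.Op) : Prop := O.v h + A.deg h < O.v g

/-- `g' h'` may occur in the expansion of the inadmissible composite `g h`. -/
structure Step (h g h' g' : A.Op) : Prop where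
  deg_eq : A.deg h' + A.deg g' = A.deg h + A.deg g
  lt_left : O.v g' < O.v g
  lt_right : O.v h < O.v h'
  inadm : O.v h + A.deg h < O.v g'
  excess : O.v g' ≤ O.v h + A.deg h'

/-- `ρ` expresses the inadmissible composite `g h` by smaller composites. -/
structure IsLead (ρ : A.Op × A.Op →₀ k) (g h : A.Op) : Prop where
  inadm : O.Inadm h g
  coeff : ρ (g, h) = 1
  step : ∀ q, ρ q ≠ 0 → q ≠ (g, h) → O.Step h g q.2 q.1

/-- A word is admissible if no two consecutive letters form an inadmissible composite. -/
def Adm (w : List A.Op) : Prop := w.IsChain fun h g ↦ ¬ O.Inadm h g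

/-- A property of words that is preserved by the rewriting of inadmissible composites. -/
def Preserved (P : List A.Op → Prop) : Prop :=
  ∀ x y h g h' g', O.Inadm h g → O.Step h g h' g' → P (x ++ h :: g :: y) → P (x ++ h' :: g' :: y)

lemma deg_mono {g h : A.Op} (H : O.v g ≤ O.v h) : A.deg g ≤ A.deg h := by
  rcases H.lt_or_eq with H | H
  · exact (O.deg_lt H).le
  · rw [O.v.injective H]

/-- The degree is a strictly increasing integer function of the value and is zero at value zero, so
it grows at least as fast as the value. -/
lemma le_deg {g : A.Op} (h : 0 ≤ O.v g) : O.v g ≤ A.deg g := by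
  have key : ∀ n : ℕ, (n : ℤ) ≤ A.deg (O.v.symm n) := by
    intro n
    induction n with
    | zero => simp [O.deg_zero]
    | succ n ih =>
      have := @O.deg_lt (O.v.symm n) (O.v.symm (n + 1 : ℕ)) (by simp)
      push_cast at this ⊢
      omega
  have := key (O.v g).toNat
  rw [Int.toNat_of_nonneg h] at this
  simpa using this

lemma deg_le {g : A.Op} (h : O.v g ≤ 0) : A.deg g ≤ O.v g := by
  have key : ∀ n : ℕ, A.deg (O.v.symm (-n)) ≤ -(n : ℤ) := by
    intro n
    induction n with
    | zero => simp [O.deg_zero]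
    | succ n ih =>
      have := @O.deg_lt (O.v.symm (-(n + 1 : ℕ))) (O.v.symm (-n)) (by simp)
      push_cast at this ⊢
      omega
  have := key (-O.v g).toNat
  rw [Int.toNat_of_nonneg (by omega)] at this
  simpa using this

lemma exists_inadm {w : List A.Op} (h : ¬ O.Adm w) :
    ∃ x h g y, w = x ++ h :: g :: y ∧ O.Inadm h g := by
  induction w with
  | nil => exact (h List.isChain_nil).elim
  | cons a w ih =>
    by_cases hw : O.Adm w
    · cases w with
      | nil => exact (h (List.isChain_singleton _)).elim
      | cons b w =>
        refine ⟨[], a, b, w, rfl, ?_⟩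
        by_contra hab
        exact h (List.isChain_cons_cons.2 ⟨hab, hw⟩)
    · obtain ⟨x, h', g, y, rfl, hh⟩ := ih hw
      exact ⟨a :: x, h', g, y, rfl, hh⟩

/-- The potential that decreases under rewriting. -/
def pot : List A.Op → ℤ
  | [] => 0
  | _ :: w => pot w + wdeg w

lemma pot_append (x w : List A.Op) : pot (x ++ w) = pot x + pot w + x.length * wdeg w := by
  induction x with
  | nil => simp [pot]
  | cons a x ih => simp [pot, ih]; ring

/-- The potential is the sum of the degrees weighted by their places, counted from zero. A step
keeps the total degree of the two letters but moves degree from the second to the first. -/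
lemma pot_step {h g h' g' : A.Op} (H : O.Step h g h' g') (x y : List A.Op) :
    pot (x ++ h' :: g' :: y) < pot (x ++ h :: g :: y) := by
  have h1 := H.deg_eq
  have h2 := O.deg_lt H.lt_left
  simp only [pot_append, pot, wdeg_cons]
  have : A.deg h' + (A.deg g' + wdeg y) = A.deg h + (A.deg g + wdeg y) := by omega
  rw [this]
  omega

/-- The least value of the letter that forms an inadmissible composite after the letter of value
`c`. -/
def nu (c : ℤ) : ℤ := c + A.deg (O.v.symm c) + 1

/-- Lower bounds for the letters of a word that are preserved by rewriting. -/
def LB : ℤ → List A.Op → Prop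
  | _, [] => True
  | c, h :: w => c ≤ O.v h ∧ LB (O.nu c) w

lemma nu_le {c : ℤ} {h : A.Op} (H : c ≤ O.v h) : O.nu c ≤ O.v h + A.deg h + 1 := by
  have := O.deg_mono (g := O.v.symm c) (h := h) (by simpa using H)
  unfold nu
  omega

/-- The first letter increases, and the new second letter still exceeds the value plus degree of the
old first letter. The bound for the second place depends only on that. -/
lemma LB_step {h g h' g' : A.Op} (H : O.Step h g h' g') (x y : List A.Op) (c : ℤ)
    (hc : O.LB c (x ++ h :: g :: y)) : O.LB c (x ++ h' :: g' :: y) := by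
  induction x generalizing c with
  | nil =>
    obtain ⟨h1, h2, h3⟩ := hc
    exact ⟨h1.trans H.lt_right.le, (O.nu_le h1).trans H.inadm, h3⟩
  | cons a x ih => exact ⟨hc.1, ih _ hc.2⟩

lemma exists_LB (w : List A.Op) : ∃ c, O.LB c w := by
  have key : ∀ (w : List A.Op) (m : ℤ), m < 0 → (∀ g ∈ w, m ≤ O.v g) → ∀ c ≤ m, O.LB c w := by
    intro w m hm
    induction w with
    | nil => exact fun _ _ _ ↦ trivial
    | cons a w ih =>
      intro hw c hc
      -- For negative `c` the degree of the letter of value `c` is at most `c`, so `nu c ≤ 2 * c + 1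
      -- ≤ c`. The successive bounds thus never rise above `m`.
      refine ⟨hc.trans (hw a (by simp)), ih (fun g hg ↦ hw g (by simp [hg])) _ ?_⟩
      have := O.deg_le (g := O.v.symm c) (by simp; omega)
      simp only [Equiv.apply_symm_apply] at this
      unfold nu
      omega
  have hb : ∃ m < 0, ∀ g ∈ w, m ≤ O.v g := by
    induction w with
    | nil => exact ⟨-1, by norm_num, by simp⟩
    | cons a w ih =>
      obtain ⟨m, hm, h⟩ := ih
      refine ⟨min m (O.v a), by omega, ?_⟩
      intro g hg
      rcases List.mem_cons.1 hg with rfl | hg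
      · omega
      · have := h g hg
        omega
  obtain ⟨m, hm, h⟩ := hb
  exact ⟨m, key w m hm h m le_rfl⟩

/-- Values may be arbitrarily negative, so a decreasing potential alone does not stop the rewriting.
The bounds `LB` together with a fixed length do: they bound each degree from below, hence also the
potential. -/
lemma exists_lower_bound (c : ℤ) (n : ℕ) :
    ∃ b : ℤ, ∀ w : List A.Op, w.length = n → O.LB c w → b ≤ wdeg w ∧ b ≤ pot w := by
  induction n generalizing c with
  | zero =>
    refine ⟨0, fun w hw _ ↦ ?_⟩
    rw [List.length_eq_zero_iff.1 hw]
    simp [pot]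
  | succ n ih =>
    obtain ⟨b, hb⟩ := ih (O.nu c)
    refine ⟨min (b + b) (A.deg (O.v.symm c) + b), fun w hw hc ↦ ?_⟩
    cases w with
    | nil => simp at hw
    | cons a w =>
      have h1 := hb w (by simpa using hw) hc.2
      have h2 := O.deg_mono (g := O.v.symm c) (h := a) (by simpa using hc.1)
      simp only [wdeg_cons, pot]
      omega

end OpOrder

lemma ins_eq (x y : List A.Op) (ρ : A.Op × A.Op →₀ k) :
    ins x y ρ = ρ.sum fun q c ↦ Finsupp.single (x ++ q.2 :: q.1 :: y) c := rfl

open Classical in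
lemma OpOrder.IsLead.single_sub {O : OpOrder A} {ρ : A.Op × A.Op →₀ k} {g h : A.Op}
    (H : O.IsLead ρ g h) (x y : List A.Op) :
    Finsupp.single (x ++ h :: g :: y) 1 - ins x y ρ =
      -∑ q ∈ ρ.support.erase (g, h), ρ q • Finsupp.single (x ++ q.2 :: q.1 :: y) 1 := by
  have hm : (g, h) ∈ ρ.support := by simp [H.coeff]
  rw [ins_eq, Finsupp.sum, ← Finset.add_sum_erase _ _ hm, H.coeff, sub_add_cancel_left]
  simp

/-- The rewriting of inadmissible words. -/
structure AdemSystem (A : QuadraticPresentation k) extends OpOrder A where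
  rel_lead : ∀ ρ ∈ A.rel, ∃ g h, toOpOrder.IsLead ρ g h
  exists_rel : ∀ g h, toOpOrder.Inadm h g → ∃ ρ ∈ A.rel, toOpOrder.IsLead ρ g h

open Classical in
-- Induction on the distance of the potential from its lower bound. Length, `LB` and `P` survive
-- each rewriting, and every word on the right-hand side has a smaller potential.
lemma AdemSystem.exists_reduction (O : AdemSystem A) {P : List A.Op → Prop}
    (hP : O.Preserved P) (w : List A.Op) (hw : P w) :
    ∃ u ∈ Finsupp.supported k k {w | O.Adm w ∧ P w}, Finsupp.single w 1 - u ∈ relSpan A := by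
  obtain ⟨c, hc⟩ := O.exists_LB w
  obtain ⟨b, hb⟩ := O.exists_lower_bound c w.length
  have key : ∀ (N : ℕ) (w' : List A.Op), w'.length = w.length → O.LB c w' → P w' →
      OpOrder.pot w' - b < N → ∃ u ∈ Finsupp.supported k k {w | O.Adm w ∧ P w},
        Finsupp.single w' 1 - u ∈ relSpan A := by
    intro N
    induction N with
    | zero =>
      intro w' hl hc' _ hN
      have := (hb w' hl hc').2
      omega
    | succ N ih =>
      intro w' hl hc' hP' hN
      by_cases hA : O.Adm w'
      · exact ⟨Finsupp.single w' 1, Finsupp.single_mem_supported _ _ ⟨hA, hP'⟩, by simp⟩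
      · obtain ⟨x, h, g, y, rfl, hh⟩ := O.exists_inadm hA
        obtain ⟨ρ, hρ, hL⟩ := O.exists_rel g h hh
        have step : ∀ q ∈ ρ.support.erase (g, h), O.Step h g q.2 q.1 := fun q hq ↦
          hL.step q (by simpa using Finset.mem_of_mem_erase hq) (Finset.ne_of_mem_erase hq)
        choose! u hu hu' using fun q hq ↦ ih (x ++ q.2 :: q.1 :: y) (by simpa using hl)
          (O.LB_step (step q hq) x y c hc') (hP x y h g _ _ hh (step q hq) hP')
          (by have := O.pot_step (step q hq) x y; push_cast at hN; omega)
        refine ⟨-∑ q ∈ ρ.support.erase (g, h), ρ q • u q,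
          neg_mem (Submodule.sum_mem _ fun q hq ↦ Submodule.smul_mem _ _ (hu q hq)), ?_⟩
        have e : Finsupp.single (x ++ h :: g :: y) (1 : k) =
            ins x y ρ - ∑ q ∈ ρ.support.erase (g, h),
              ρ q • Finsupp.single (x ++ q.2 :: q.1 :: y) 1 := by
          rw [sub_eq_add_neg, ← hL.single_sub x y]
          abel
        rw [e, sub_sub, sub_eq_add_neg]
        refine add_mem (ins_mem x y hρ) (neg_mem ?_)
        rw [← sub_eq_add_neg, ← Finset.sum_sub_distrib]
        refine Submodule.sum_mem _ fun q hq ↦ ?_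
        rw [← smul_sub]
        exact Submodule.smul_mem _ _ (hu' q hq)
  have hb' := (hb w rfl hc).2
  exact key (OpOrder.pot w - b + 1).toNat w rfl hc hw (by omega)

/-! ### Normal forms -/

/-- The admissible words are linearly independent modulo the relations. -/
structure PBWSystem (A : QuadraticPresentation k) extends AdemSystem A where
  indep : ∀ u ∈ relSpan A, u ∈ Finsupp.supported k k {w | toAdemSystem.Adm w} → u = 0

namespace PBWSystem

variable (O : PBWSystem A)

lemma isCompl : IsCompl (Finsupp.supported k k {w | O.Adm w}) (relSpan A) := by
  refine IsCompl.of_le (fun u hu ↦ O.indep u hu.2 hu.1) fun u _ ↦ ?_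
  induction u using Finsupp.induction_linear with
  | zero => exact zero_mem _
  | add u v hu hv => exact add_mem (hu trivial) (hv trivial)
  | single w c =>
    obtain ⟨u, hu, hu'⟩ := O.exists_reduction (P := fun _ ↦ True) (fun _ _ _ _ _ _ _ _ _ ↦ trivial)
      w trivial
    have : Finsupp.single w c = c • u + c • (Finsupp.single w 1 - u) := by
      rw [← smul_add, add_sub_cancel, Finsupp.smul_single, smul_eq_mul, mul_one]
    rw [this]
    refine Submodule.add_mem_sup (Submodule.smul_mem _ _ ?_) (Submodule.smul_mem _ _ hu')
    exact Finsupp.supported_mono (fun w hw ↦ hw.1) hu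

/-- The expression of a word in terms of admissible words. -/
def nf : (List A.Op →₀ k) →ₗ[k] (List A.Op →₀ k) := Submodule.projection _ _ O.isCompl

lemma nf_mem (u : List A.Op →₀ k) : O.nf u ∈ Finsupp.supported k k {w | O.Adm w} :=
  Submodule.projection_apply_mem O.isCompl u

lemma nf_of_mem {u : List A.Op →₀ k} (h : u ∈ Finsupp.supported k k {w | O.Adm w}) :
    O.nf u = u := Submodule.projection_apply_left O.isCompl ⟨u, h⟩

lemma nf_single {w : List A.Op} (h : O.Adm w) (c : k) :
    O.nf (Finsupp.single w c) = Finsupp.single w c :=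
  O.nf_of_mem (Finsupp.single_mem_supported _ _ h)

lemma nf_of_mem_relSpan {u : List A.Op →₀ k} (h : u ∈ relSpan A) : O.nf u = 0 :=
  (Submodule.projection_apply_eq_zero_iff O.isCompl).2 h

lemma sub_nf_mem (u : List A.Op →₀ k) : u - O.nf u ∈ relSpan A :=
  Submodule.sub_projection_mem O.isCompl u

/-- The normal form is unique, so it agrees with the result of any rewriting and inherits every
property preserved by rewriting. The bases of the cyclic modules rest on this. -/
lemma nf_preserved {P : List A.Op → Prop} (hP : O.Preserved P) {w : List A.Op} (hw : P w) (c : k) :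
    O.nf (Finsupp.single w c) ∈ Finsupp.supported k k {w | P w} := by
  obtain ⟨u, hu, hu'⟩ := O.exists_reduction hP w hw
  have h1 : O.nf (Finsupp.single w 1) = u := by
    rw [← O.nf_of_mem (Finsupp.supported_mono (fun w hw ↦ hw.1) hu), ← sub_eq_zero, ← map_sub]
    exact O.nf_of_mem_relSpan hu'
  have h2 : Finsupp.single w c = c • Finsupp.single w (1 : k) := by simp
  rw [h2, map_smul, h1]
  exact Submodule.smul_mem _ _ (Finsupp.supported_mono (fun w hw ↦ hw.2) hu)

lemma nf_preserved_of_mem {P : List A.Op → Prop} (hP : O.Preserved P) {u : List A.Op →₀ k}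
    (hu : u ∈ Finsupp.supported k k {w | P w}) : O.nf u ∈ Finsupp.supported k k {w | P w} := by
  rw [← Finsupp.sum_single u, Finsupp.sum, map_sum]
  exact Submodule.sum_mem _ fun w hw ↦ O.nf_preserved hP (hu hw) _

/-- Append a letter. -/
def app (g : A.Op) : (List A.Op →₀ k) →ₗ[k] (List A.Op →₀ k) :=
  Finsupp.lmapDomain k k fun w ↦ w ++ [g]

/-- Prepend a letter. -/
def pre (g : A.Op) : (List A.Op →₀ k) →ₗ[k] (List A.Op →₀ k) :=
  Finsupp.lmapDomain k k fun w ↦ g :: w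

@[simp] lemma app_single (g : A.Op) (w : List A.Op) (c : k) :
    app g (Finsupp.single w c) = Finsupp.single (w ++ [g]) c := by
  simp [app]

@[simp] lemma pre_single (g : A.Op) (w : List A.Op) (c : k) :
    pre g (Finsupp.single w c) = Finsupp.single (g :: w) c := by
  simp [pre]

lemma app_mem (g : A.Op) {u : List A.Op →₀ k} (hu : u ∈ relSpan A) : app g u ∈ relSpan A := by
  refine Submodule.span_induction (p := fun u _ ↦ app g u ∈ relSpan A) ?_ ?_ ?_ ?_ hu
  · rintro _ ⟨x, y, ρ, hρ, rfl⟩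
    have : app g (ins x y ρ) = ins x (y ++ [g]) ρ := by
      simp only [app, ins, Finsupp.lmapDomain_apply, ← Finsupp.mapDomain_comp]
      congr 1
      ext q : 1
      simp
    rw [this]
    exact ins_mem _ _ hρ
  · simp
  · intro u v _ _ hu hv
    rw [map_add]
    exact add_mem hu hv
  · intro c u _ hu
    rw [map_smul]
    exact Submodule.smul_mem _ _ hu

lemma pre_mem (g : A.Op) {u : List A.Op →₀ k} (hu : u ∈ relSpan A) : pre g u ∈ relSpan A := by
  refine Submodule.span_induction (p := fun u _ ↦ pre g u ∈ relSpan A) ?_ ?_ ?_ ?_ hu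
  · rintro _ ⟨x, y, ρ, hρ, rfl⟩
    have : pre g (ins x y ρ) = ins (g :: x) y ρ := by
      simp only [pre, ins, Finsupp.lmapDomain_apply, ← Finsupp.mapDomain_comp]
      congr 1
    rw [this]
    exact ins_mem _ _ hρ
  · simp
  · intro u v _ _ hu hv
    rw [map_add]
    exact add_mem hu hv
  · intro c u _ hu
    rw [map_smul]
    exact Submodule.smul_mem _ _ hu

lemma nf_app_nf (g : A.Op) (u : List A.Op →₀ k) : O.nf (app g (O.nf u)) = O.nf (app g u) := by
  rw [eq_comm, ← sub_eq_zero, ← map_sub, ← map_sub]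
  exact O.nf_of_mem_relSpan (app_mem g (O.sub_nf_mem u))

lemma nf_pre_nf (g : A.Op) (u : List A.Op →₀ k) : O.nf (pre g (O.nf u)) = O.nf (pre g u) := by
  rw [eq_comm, ← sub_eq_zero, ← map_sub, ← map_sub]
  exact O.nf_of_mem_relSpan (pre_mem g (O.sub_nf_mem u))

end PBWSystem

end DyerLashof

end

noncomputable section

namespace DyerLashof

variable {k : Type} [Field k] {A : QuadraticPresentation k}

/-! ### Constructions of modules and of morphisms -/

/-- A morphism of representations is a family of maps that commute with the operations. -/
def repHom {M N : Rep A} (f : ∀ c : ℤ, M.obj (vert A c) ⟶ N.obj (vert A c))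
    (hf : ∀ (g : A.Op) (a b : ℤ), a + A.deg g = b → act M g a b ≫ f b = f a ≫ act N g a b) :
    M ⟶ N where
  app c := f c.val
  naturality c d p := by
    have key {c d : Degree A} (p : Quiver.Path c d) :
        M.map (X := c) (Y := d) p ≫ f d.val = f c.val ≫ N.map (X := c) (Y := d) p := by
      induction p with
      | nil =>
        refine (congrArg (fun z ↦ z ≫ f _) (M.map_id (c : Paths (Degree A)))).trans ?_
        refine Eq.trans ?_ (congrArg (fun z ↦ f _ ≫ z) (N.map_id (c : Paths (Degree A)))).symm
        exact (Category.id_comp _).trans (Category.comp_id _).symm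
      | @cons c' d p e ih =>
        have e1 : ∀ L : Rep A, L.map (X := c) (Y := d) (p.cons e) =
            L.map (X := c) (Y := c') p ≫ L.map ((Paths.of (Degree A)).map e) := fun L ↦
          L.map_comp (X := c) (Y := c') (Z := d) p ((Paths.of (Degree A)).map e)
        have e2 := hf e.1 c'.val d.val e.2
        rw [act_of_eq _ _ e.2, act_of_eq _ _ e.2] at e2
        rw [e1, e1]
        refine (Category.assoc _ _ _).trans ?_
        refine (congrArg (fun z ↦ M.map (X := c) (Y := c') p ≫ z) e2).trans ?_
        refine (Category.assoc _ _ _).symm.trans ?_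
        exact (congrArg (fun z ↦ z ≫ N.map ((Paths.of (Degree A)).map e)) ih).trans
          (Category.assoc _ _ _)
    exact key p

lemma repHom_ext {M N : Rep A} {f g : M ⟶ N} (h : ∀ c : ℤ, f.app (vert A c) = g.app (vert A c)) :
    f = g := by
  ext c : 2
  exact h c.val

section modules

variable {Z : A.Op → ℤ → Prop}

lemma grHom_ext {M N : GrMod A Z} {f g : M ⟶ N}
    (h : ∀ (c : ℤ) (x : M.obj.obj (vert A c)),
      f.hom.app (vert A c) x = g.hom.app (vert A c) x) : f = g := by
  refine ObjectProperty.hom_ext _ (repHom_ext fun c ↦ ?_)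
  ext x
  exact h c x

lemma grMod_mono {M N : GrMod A Z} (f : M ⟶ N)
    (h : ∀ c, Function.Injective (f.hom.app (vert A c))) : Mono f := by
  have : ∀ c, Mono (f.hom.app c) := fun c ↦ (ModuleCat.mono_iff_injective _).2 (h c.val)
  have : Mono ((isModule A Z).ι.map f) := NatTrans.mono_of_mono_app f.hom
  exact (isModule A Z).ι.mono_of_mono_map this

lemma grMod_epi {M N : GrMod A Z} (f : M ⟶ N)
    (h : ∀ c, Function.Surjective (f.hom.app (vert A c))) : Epi f := by
  have : ∀ c, Epi (f.hom.app c) := fun c ↦ (ModuleCat.epi_iff_surjective _).2 (h c.val)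
  have : Epi ((isModule A Z).ι.map f) := NatTrans.epi_of_epi_app f.hom
  exact (isModule A Z).ι.epi_of_epi_map this

lemma app_surjective {M N : GrMod A Z} (f : M ⟶ N) [Epi f] (c : ℤ) :
    Function.Surjective (f.hom.app (vert A c)) := by
  have : Epi ((isModule A Z).ι.map f) := inferInstance
  have : Epi f.hom := this
  exact (ModuleCat.epi_iff_surjective _).1 inferInstance

lemma app_injective {M N : GrMod A Z} (f : M ⟶ N) [Mono f] (c : ℤ) :
    Function.Injective (f.hom.app (vert A c)) := by
  have : Mono ((isModule A Z).ι.map f) := inferInstance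
  have : Mono f.hom := this
  exact (ModuleCat.mono_iff_injective _).1 inferInstance

/-- The inclusion into representations is exact and faithful, so it reflects short exactness, and
homology of representations is computed at each vertex. -/
lemma shortExact_of_pointwise (S : ShortComplex (GrMod A Z))
    (h₁ : ∀ c, Function.Injective (S.f.hom.app (vert A c)))
    (h₂ : ∀ c (y : S.X₂.obj.obj (vert A c)), S.g.hom.app (vert A c) y = 0 →
      ∃ x, S.f.hom.app (vert A c) x = y)
    (h₃ : ∀ c, Function.Surjective (S.g.hom.app (vert A c))) : S.ShortExact := by
  refine CategoryTheory.ShortExact.reflects_shortExact_of_faithful (isModule A Z).ι ?_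
  have hs (c : Paths (Degree A)) :
      ((S.map (isModule A Z).ι).map ((evaluation _ _).obj c)).ShortExact := by
    refine ShortComplex.ShortExact.mk' ?_ ?_ ?_
    · rw [ShortComplex.moduleCat_exact_iff]
      exact fun y hy ↦ h₂ c.val y hy
    · exact (ModuleCat.mono_iff_injective _).2 (h₁ c.val)
    · exact (ModuleCat.epi_iff_surjective _).2 (h₃ c.val)
  refine ShortComplex.ShortExact.mk' ?_ ?_ ?_
  · rw [ShortComplex.exact_iff_isZero_homology, Functor.isZero_iff]
    intro c
    refine IsZero.of_iso ((ShortComplex.exact_iff_isZero_homology _).1 (hs c).exact)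
      (ShortComplex.mapHomologyIso _ ((evaluation _ _).obj c)).symm
  · exact @NatTrans.mono_of_mono_app _ _ _ _ _ _ _ (fun c ↦ (hs c).mono_f)
  · exact @NatTrans.epi_of_epi_app _ _ _ _ _ _ _ (fun c ↦ (hs c).epi_g)

lemma exact_pointwise {S : ShortComplex (GrMod A Z)} (hS : S.ShortExact) (c : ℤ)
    (y : S.X₂.obj.obj (vert A c)) (hy : S.g.hom.app (vert A c) y = 0) :
    ∃ x, S.f.hom.app (vert A c) x = y := by
  have h := (hS.map_of_exact (isModule A Z).ι).map_of_exact ((evaluation _ _).obj (vert A c))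
  exact (ShortComplex.moduleCat_exact_iff _).1 h.exact y hy

end modules

/-- The representation given by graded pieces and operations. -/
def mkRep (X : ℤ → Type) [∀ c, AddCommGroup (X c)] [∀ c, Module k (X c)]
    (op : ∀ (g : A.Op) (a b : ℤ), a + A.deg g = b → X a →ₗ[k] X b) : Rep A :=
  Paths.lift
    { obj := fun c ↦ ModuleCat.of k (X c.val)
      map := fun {c d} e ↦ ModuleCat.ofHom (op e.1 c.val d.val e.2) }

lemma act_mkRep (X : ℤ → Type) [∀ c, AddCommGroup (X c)] [∀ c, Module k (X c)]
    (op : ∀ (g : A.Op) (a b : ℤ), a + A.deg g = b → X a →ₗ[k] X b) (g : A.Op) {a b : ℤ}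
    (h : a + A.deg g = b) : act (mkRep X op) g a b = ModuleCat.ofHom (op g a b h) :=
  act_lift _ _ h

/-! ### The operations on the product of all graded pieces -/

/-- The product of all the graded pieces. -/
abbrev Tot (M : Rep A) : Type := ∀ c : ℤ, M.obj (vert A c)

/-- The action of an operation on `Tot M`. -/
def totOp (M : Rep A) (g : A.Op) : Tot M →ₗ[k] Tot M where
  toFun m b := act M g (b - A.deg g) b (m (b - A.deg g))
  map_add' m m' := by ext b; simp
  map_smul' c m := by ext b; simp

/-- On the product of all pieces every operation is an endomorphism, so words compose without
transport between degrees. -/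
lemma totOp_apply (M : Rep A) {g : A.Op} {a b : ℤ} (h : a + A.deg g = b) (m : Tot M) :
    totOp M g m b = act M g a b (m a) := by
  obtain rfl : a = b - A.deg g := by omega
  rfl

/-- The map `Tot M → Tot N` induced by a morphism. -/
def totMap {M N : Rep A} (f : M ⟶ N) : Tot M →ₗ[k] Tot N where
  toFun m c := f.app (vert A c) (m c)
  map_add' m m' := by ext c; simp
  map_smul' r m := by ext c; simp

@[simp] lemma totMap_apply {M N : Rep A} (f : M ⟶ N) (m : Tot M) (c : ℤ) :
    totMap f m c = f.app (vert A c) (m c) := rfl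

lemma act_naturality_apply {M N : Rep A} (f : M ⟶ N) (g : A.Op) (a b : ℤ)
    (x : M.obj (vert A a)) :
    f.app (vert A b) (act M g a b x) = act N g a b (f.app (vert A a) x) :=
  congrArg (fun φ ↦ φ.hom x) (act_naturality f g a b)

lemma totMap_totOp {M N : Rep A} (f : M ⟶ N) (g : A.Op) (m : Tot M) :
    totMap f (totOp M g m) = totOp N g (totMap f m) := by
  ext b
  exact act_naturality_apply f g _ b _

/-- Homogeneity of `ρ` is needed here: the component of degree `b` then depends only on the
component of degree `b - D`, where the relation of the module applies. -/
lemma totRel {M : Rep A} {Z : A.Op → ℤ → Prop} (hM : isModule A Z M) {ρ : A.Op × A.Op →₀ k}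
    (hρ : ρ ∈ A.rel) {D : ℤ} (hD : ∀ q ∈ ρ.support, A.deg q.2 + A.deg q.1 = D) (m : Tot M) :
    ρ.sum (fun q c ↦ c • totOp M q.1 (totOp M q.2 m)) = 0 := by
  funext b
  have h := congrArg (fun φ ↦ φ.hom (m (b - D))) (hM.1 ρ hρ (b - D) b)
  simp only [relMap, Finsupp.sum] at h
  rw [Finsupp.sum, Finset.sum_apply]
  rw [ModuleCat.hom_sum, LinearMap.sum_apply] at h
  refine Eq.trans (Finset.sum_congr rfl fun q hq ↦ ?_) h
  have h1 := hD q hq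
  rw [Pi.smul_apply, totOp_apply M (a := b - D + A.deg q.2) (by omega),
    totOp_apply M (a := b - D) rfl]
  rfl

lemma relMap_apply (M : Rep A) (ρ : A.Op × A.Op →₀ k) (a b : ℤ) (x : M.obj (vert A a)) :
    relMap M ρ a b x =
      ∑ q ∈ ρ.support, ρ q • act M q.1 (a + A.deg q.2) b (act M q.2 a (a + A.deg q.2) x) := by
  have h : (relMap M ρ a b).hom = ∑ q ∈ ρ.support,
      (ρ q • (act M q.2 a (a + A.deg q.2) ≫ act M q.1 (a + A.deg q.2) b)).hom :=
    ModuleCat.hom_sum _ _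
  refine (congrArg (fun f : M.obj (vert A a) →ₗ[k] M.obj (vert A b) ↦ f x) h).trans ?_
  rw [LinearMap.sum_apply]
  rfl

/-- The action of a word on `Tot M`. -/
def totWord (M : Rep A) : List A.Op → (Tot M →ₗ[k] Tot M)
  | [] => LinearMap.id
  | g :: w => totWord M w ∘ₗ totOp M g

lemma totWord_append (M : Rep A) (w w' : List A.Op) (m : Tot M) :
    totWord M (w ++ w') m = totWord M w' (totWord M w m) := by
  induction w generalizing m with
  | nil => rfl
  | cons g w ih => exact ih _

/-- The action of formal sums of words on `Tot M`. -/
def totLin (M : Rep A) : (List A.Op →₀ k) →ₗ[k] (Tot M →ₗ[k] Tot M) :=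
  Finsupp.linearCombination k (totWord M)

@[simp] lemma totLin_single (M : Rep A) (w : List A.Op) (c : k) :
    totLin M (Finsupp.single w c) = c • totWord M w := by
  simp [totLin]

lemma totLin_app (M : Rep A) (g : A.Op) (u : List A.Op →₀ k) (m : Tot M) :
    totLin M (PBWSystem.app g u) m = totOp M g (totLin M u m) := by
  induction u using Finsupp.induction_linear with
  | zero => simp
  | add u v hu hv => simp [hu, hv]
  | single w c => simp [totWord_append, totWord]

lemma AdemSystem.rel_deg (O : AdemSystem A) {ρ : A.Op × A.Op →₀ k} (hρ : ρ ∈ A.rel) :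
    ∃ D, ∀ q ∈ ρ.support, A.deg q.2 + A.deg q.1 = D := by
  obtain ⟨g, h, H⟩ := O.rel_lead ρ hρ
  refine ⟨A.deg h + A.deg g, fun q hq ↦ ?_⟩
  by_cases e : q = (g, h)
  · rw [e]
  · exact (H.step q (by simpa using hq) e).deg_eq

lemma AdemSystem.totLin_relSpan (O : AdemSystem A) {M : Rep A} {Z : A.Op → ℤ → Prop}
    (hM : isModule A Z M) {u : List A.Op →₀ k} (hu : u ∈ relSpan A) : totLin M u = 0 := by
  refine Submodule.span_induction (p := fun u _ ↦ totLin M u = 0) ?_ ?_ ?_ ?_ hu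
  · rintro _ ⟨x, y, ρ, hρ, rfl⟩
    obtain ⟨D, hD⟩ := O.rel_deg hρ
    ext1 m
    have := congrArg (totWord M y) (totRel hM hρ hD (totWord M x m))
    rw [map_zero, Finsupp.sum, map_sum] at this
    rw [ins_eq, Finsupp.sum, map_sum, LinearMap.sum_apply]
    refine Eq.trans (Finset.sum_congr rfl fun q _ ↦ ?_) this
    simp [totWord_append, totWord]
  · simp
  · intro u v _ _ hu hv
    rw [map_add, hu, hv, add_zero]
  · intro c u _ hu
    rw [map_smul, hu, smul_zero]

end DyerLashof

end

noncomputable section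

namespace DyerLashof

variable {k : Type} [Field k] {A : QuadraticPresentation k}

/-! ### Cyclic modules -/

/-- The vanishing conditions `Z` are compatible with the rewriting of inadmissible composites. -/
structure OpOrder.Compat (O : OpOrder A) (Z : A.Op → ℤ → Prop) : Prop where
  of_inadm : ∀ {h g : A.Op} {a : ℤ}, O.Inadm h g → Z g (a + A.deg h) → Z h a
  of_step : ∀ {h g h' g' : A.Op} {a : ℤ}, O.Step h g h' g' → Z h a → Z g' (a + A.deg h')

/-- The word may act nontrivially on elements of degree `a`. -/
def Allowed (Z : A.Op → ℤ → Prop) : ℤ → List A.Op → Prop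
  | _, [] => True
  | a, h :: w => ¬ Z h a ∧ Allowed Z (a + A.deg h) w

lemma allowed_append {Z : A.Op → ℤ → Prop} (a : ℤ) (w w' : List A.Op) :
    Allowed Z a (w ++ w') ↔ Allowed Z a w ∧ Allowed Z (a + wdeg w) w' := by
  induction w generalizing a with
  | nil => simp [Allowed]
  | cons h w ih => simp [Allowed, ih, add_assoc, and_assoc]

namespace OpOrder

variable (O : OpOrder A)

/-- The first letter of the word has value less than `K`. -/
def HeadLt (K : WithTop ℤ) (w : List A.Op) : Prop := ∀ g ∈ w.head?, (O.v g : WithTop ℤ) < K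

/-- The words that survive in the cyclic module with generator of degree `a` on which the operations
of value at least `K` vanish. -/
def Kept (Z : A.Op → ℤ → Prop) (a : ℤ) (K : WithTop ℤ) (w : List A.Op) : Prop :=
  Allowed Z a w ∧ O.HeadLt K w

variable {O} {Z : A.Op → ℤ → Prop}

/-- Read contrapositively: if the rewritten word survives, so did the original one. Compatibility
carries vanishing of an old letter to a new one, and the first letter only increases in value, so a
word excluded by `K` remains excluded. -/
lemma Compat.preserved (hZ : O.Compat Z) (a : ℤ) (K : WithTop ℤ) :
    O.Preserved fun w ↦ ¬ O.Kept Z a K w := by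
  intro x y h g h' g' hi hs
  refine mt fun ⟨h1, h2⟩ ↦ ⟨?_, ?_⟩
  · rw [allowed_append] at h1 ⊢
    refine ⟨h1.1, ?_⟩
    obtain ⟨h3, h4, h5⟩ := h1.2
    refine ⟨fun H ↦ h4 (hZ.of_step hs H), fun H ↦ h4 (hZ.of_step hs (hZ.of_inadm hi H)), ?_⟩
    have := hs.deg_eq
    rwa [show a + wdeg x + A.deg h' + A.deg g' = a + wdeg x + A.deg h + A.deg g by omega] at h5
  · cases x with
    | nil =>
      intro q hq
      obtain rfl : h = q := by simpa using hq
      exact (WithTop.coe_lt_coe.2 hs.lt_right).trans (h2 h' (by simp))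
    | cons q x => exact fun r hr ↦ h2 r (by simpa using hr)

lemma preserved_wdeg (d : ℤ) : O.Preserved fun w ↦ wdeg w = d := by
  intro x y h g h' g' _ hs H
  have := hs.deg_eq
  simp only [wdeg_append, wdeg_cons] at H ⊢
  omega

lemma preserved_head (m : ℤ) : O.Preserved fun w ↦ ∃ g ∈ w.head?, m ≤ O.v g := by
  rintro x y h g h' g' _ hs ⟨q, hq, hm⟩
  cases x with
  | nil =>
    obtain rfl : h = q := by simpa using hq
    exact ⟨h', by simp, hm.trans hs.lt_right.le⟩
  | cons r x => exact ⟨q, by simpa using hq, hm⟩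

lemma Kept.of_append {a : ℤ} {K : WithTop ℤ} {w w' : List A.Op} (h : O.Kept Z a K (w ++ w')) :
    O.Kept Z a K w := by
  refine ⟨((allowed_append _ _ _).1 h.1).1, fun g hg ↦ h.2 g ?_⟩
  cases w with
  | nil => simp at hg
  | cons q w => simpa using hg

end OpOrder

namespace PBWSystem

open OpOrder

variable (O : PBWSystem A) (Z : A.Op → ℤ → Prop) (a : ℤ) (K : WithTop ℤ)

open Classical in
/-- The class of a formal sum of words in the cyclic module. -/
def red : (List A.Op →₀ k) →ₗ[k] (List A.Op →₀ k) :=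
  (Submodule.subtype _ ∘ₗ Finsupp.restrictDom k k {w | O.Kept Z a K w}) ∘ₗ O.nf

open Classical in
lemma red_apply (u : List A.Op →₀ k) : O.red Z a K u = (O.nf u).filter (O.Kept Z a K) := rfl

lemma red_of_mem {u : List A.Op →₀ k}
    (h : u ∈ Finsupp.supported k k {w | O.Adm w ∧ O.Kept Z a K w}) : O.red Z a K u = u := by
  classical
  rw [red_apply, O.nf_of_mem (Finsupp.supported_mono (fun w hw ↦ hw.1) h),
    Finsupp.filter_eq_self_iff]
  exact fun w hw ↦ (h (by simpa using hw)).2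

variable {Z}

lemma red_eq_zero (hZ : O.Compat Z) {u : List A.Op →₀ k}
    (h : u ∈ Finsupp.supported k k {w | ¬ O.Kept Z a K w}) : O.red Z a K u = 0 := by
  classical
  rw [red_apply, Finsupp.filter_eq_zero_iff]
  intro w hw
  by_contra h0
  exact O.nf_preserved_of_mem (hZ.preserved a K) h (by simpa using h0) hw

variable (Z) in
lemma red_of_mem_relSpan {u : List A.Op →₀ k} (h : u ∈ relSpan A) : O.red Z a K u = 0 := by
  classical
  rw [red_apply, O.nf_of_mem_relSpan h, Finsupp.filter_zero]

/-- A word with a discarded initial segment is itself discarded, so the discarded words are stable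
under appending letters and the action descends to the quotient. -/
lemma red_app_red (hZ : O.Compat Z) (g : A.Op) (u : List A.Op →₀ k) :
    O.red Z a K (app g (O.red Z a K u)) = O.red Z a K (app g u) := by
  classical
  have h1 : O.nf u = O.red Z a K u + (O.nf u).filter fun w ↦ ¬ O.Kept Z a K w := by
    rw [red_apply, Finsupp.filter_add_filter_not]
  have h2 : O.red Z a K (app g u) = O.red Z a K (app g (O.nf u)) := by
    rw [red_apply, red_apply, nf_app_nf]
  rw [h2, h1, map_add, map_add, left_eq_add]
  refine O.red_eq_zero a K hZ ?_
  have : Finsupp.supported k k {w | ¬ O.Kept Z a K w} ≤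
      (Finsupp.supported k k {w | ¬ O.Kept Z a K w}).comap (app g) := by
    conv_lhs => rw [Finsupp.supported_eq_span_single]
    rw [Submodule.span_le]
    rintro _ ⟨w, hw, rfl⟩
    rw [SetLike.mem_coe, Submodule.mem_comap, app_single]
    refine Finsupp.single_mem_supported _ _ ?_
    exact fun H ↦ hw (OpOrder.Kept.of_append H)
  have h3 : (O.nf u).filter (fun w ↦ ¬ O.Kept Z a K w) ∈
      Finsupp.supported k k {w | ¬ O.Kept Z a K w} := fun w hw ↦
    (by simpa using hw : O.nf u w ≠ 0 ∧ ¬ O.Kept Z a K w).2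
  exact this h3

variable (Z) in
/-- The part of degree `c` of the cyclic module. -/
def piece (c : ℤ) : Submodule k (List A.Op →₀ k) :=
  Finsupp.supported k k {w | (O.Adm w ∧ O.Kept Z a K w) ∧ a + wdeg w = c}

variable (Z) in
lemma red_mem {c : ℤ} {u : List A.Op →₀ k}
    (hu : u ∈ Finsupp.supported k k {w | a + wdeg w = c}) : O.red Z a K u ∈ O.piece Z a K c := by
  classical
  have h1 := O.nf_preserved_of_mem (P := fun w ↦ wdeg w = c - a) (preserved_wdeg _)
    (u := u) (Finsupp.supported_mono (fun w (hw : _ = c) ↦ (by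
      change wdeg w = c - a
      omega)) hu)
  intro w hw
  rw [red_apply, Finset.mem_coe, Finsupp.mem_support_iff] at hw
  have h2 : O.Kept Z a K w := by
    by_contra H
    exact hw (Finsupp.filter_apply_neg _ _ H)
  rw [Finsupp.filter_apply_pos _ _ h2] at hw
  have h3 : w ∈ (O.nf u).support := by simpa using hw
  have h4 : wdeg w = c - a := h1 h3
  exact ⟨⟨O.nf_mem u h3, h2⟩, by omega⟩

lemma app_supported {c c' : ℤ} (g : A.Op) (h : c + A.deg g = c') {u : List A.Op →₀ k}
    (hu : u ∈ Finsupp.supported k k {w : List A.Op | a + wdeg w = c}) :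
    app g u ∈ Finsupp.supported k k {w : List A.Op | a + wdeg w = c'} := by
  have : Finsupp.supported k k {w : List A.Op | a + wdeg w = c} ≤
      (Finsupp.supported k k {w | a + wdeg w = c'}).comap (app g) := by
    rw [Finsupp.supported_eq_span_single, Submodule.span_le]
    rintro _ ⟨w, hw, rfl⟩
    rw [SetLike.mem_coe, Submodule.mem_comap, app_single]
    refine Finsupp.single_mem_supported _ _ ?_
    have : a + wdeg w = c := hw
    simp only [Set.mem_ofPred_eq, wdeg_append, wdeg_cons, wdeg_nil]
    omega
  exact this hu

lemma piece_le (c : ℤ) :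
    O.piece Z a K c ≤ Finsupp.supported k k {w : List A.Op | a + wdeg w = c} :=
  Finsupp.supported_mono fun _ h ↦ h.2

lemma red_piece {c : ℤ} {u : List A.Op →₀ k} (h : u ∈ O.piece Z a K c) : O.red Z a K u = u :=
  O.red_of_mem Z a K (Finsupp.supported_mono (fun _ h ↦ h.1) h)

variable (Z) in
/-- The operations on the cyclic module. -/
def cycOp (g : A.Op) (c c' : ℤ) (h : c + A.deg g = c') :
    O.piece Z a K c →ₗ[k] O.piece Z a K c' :=
  LinearMap.restrict (O.red Z a K ∘ₗ app g) fun _ hu ↦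
    O.red_mem Z a K (app_supported a g h (O.piece_le a K c hu))

variable (Z) in
/-- The underlying representation of the cyclic module. -/
def cycRep : Rep A := mkRep (fun c ↦ O.piece Z a K c) (O.cycOp Z a K)

lemma act_cycRep (g : A.Op) {c c' : ℤ} (h : c + A.deg g = c') (u : O.piece Z a K c) :
    (act (O.cycRep Z a K) g c c' u : O.piece Z a K c').1 = O.red Z a K (app g u.1) := by
  unfold cycRep
  rw [act_mkRep _ _ _ h]
  rfl

lemma app_app_eq (ρ : A.Op × A.Op →₀ k) (u : List A.Op →₀ k) :
    ρ.sum (fun q c ↦ c • app q.1 (app q.2 u)) = u.sum fun w c ↦ c • ins w [] ρ := by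
  induction u using Finsupp.induction_linear with
  | zero => simp
  | add u v hu hv =>
    rw [Finsupp.sum_add_index' (by simp) (by intros; rw [add_smul]), ← hu, ← hv]
    simp [Finsupp.sum, Finset.sum_add_distrib]
  | single w c =>
    rw [Finsupp.sum_single_index (by simp), ins_eq, Finsupp.smul_sum]
    refine Finset.sum_congr rfl fun q _ ↦ ?_
    simp [mul_comm]

/-- The relations hold because `red` kills the ideal of relations and, by `red_app_red`, the inner
`red` of a twofold action may be omitted. -/
lemma isModule_cycRep (hZ : O.Compat Z) : isModule A Z (O.cycRep Z a K) := by
  refine ⟨fun ρ hρ c c' ↦ ?_, fun g c c' hg ↦ ?_⟩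
  · obtain ⟨D, hD⟩ := O.rel_deg hρ
    by_cases hc : c + D = c'
    · ext u
      obtain ⟨u, hu⟩ := u
      change u ∈ O.piece Z a K c at hu
      have key : O.red Z a K (ρ.sum fun q c ↦ c • app q.1 (app q.2 u)) = 0 := by
        refine O.red_of_mem_relSpan Z a K ?_
        rw [app_app_eq]
        exact Submodule.sum_mem _ fun w _ ↦ Submodule.smul_mem _ _ (ins_mem _ _ hρ)
      rw [Finsupp.sum, map_sum] at key
      refine Subtype.ext ((congrArg Subtype.val
        (relMap_apply (O.cycRep Z a K) ρ c c' ⟨u, hu⟩)).trans ?_)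
      refine (map_sum (O.piece Z a K c').subtype _ _).trans ?_
      refine Eq.trans (Finset.sum_congr rfl fun q hq ↦ ?_) key
      have h1 := hD q hq
      rw [map_smul]
      refine (congrArg (fun z ↦ ρ q • z) ((O.act_cycRep a K q.1 (c := c + A.deg q.2) (by omega)
        (act (O.cycRep Z a K) q.2 c (c + A.deg q.2) ⟨u, hu⟩)).trans ?_))
      exact (congrArg (fun z ↦ O.red Z a K (app q.1 z)) (O.act_cycRep a K q.2 rfl ⟨u, hu⟩)).trans
        (O.red_app_red a K hZ _ _)
    · refine Finset.sum_eq_zero fun q hq ↦ ?_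
      have h1 := hD q hq
      change ρ q • (_ ≫ act _ q.1 _ _) = 0
      rw [act_of_ne _ q.1 (by omega), comp_zero, smul_zero]
  · by_cases h : c + A.deg g = c'
    · ext u
      refine Subtype.ext ((O.act_cycRep a K g h u).trans (O.red_eq_zero a K hZ ?_))
      have : O.piece Z a K c ≤
          (Finsupp.supported k k {w | ¬ O.Kept Z a K w}).comap (app g) := by
        rw [piece, Finsupp.supported_eq_span_single, Submodule.span_le]
        rintro _ ⟨w, hw, rfl⟩
        rw [SetLike.mem_coe, Submodule.mem_comap, app_single]
        refine Finsupp.single_mem_supported _ _ fun H ↦ ?_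
        have := ((allowed_append _ _ _).1 H.1).2.1
        rw [hw.2] at this
        exact this hg
      exact this u.2
    · exact act_of_ne _ _ h

/-- The cyclic module with generator of degree `a` on which the operations of value at least `K`
vanish; for `K = ⊤`, it is the free module. -/
def cyc (hZ : O.Compat Z) : GrMod A Z := ⟨O.cycRep Z a K, O.isModule_cycRep a K hZ⟩

variable (hZ : O.Compat Z)

lemma nil_mem : Finsupp.single [] 1 ∈ O.piece Z a K a :=
  Finsupp.single_mem_supported _ _ ⟨⟨List.isChain_nil, trivial, by simp [HeadLt]⟩, by simp⟩

lemma totOp_single (M : Rep A) (g : A.Op) (a : ℤ) (m : M.obj (vert A a)) :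
    totOp M g (Pi.single a m) = Pi.single (a + A.deg g) (act M g a (a + A.deg g) m) := by
  funext b
  by_cases h : a + A.deg g = b
  · subst h
    rw [totOp_apply M rfl, Pi.single_eq_same, Pi.single_eq_same]
  · rw [Pi.single_eq_of_ne (Ne.symm h)]
    change act M g _ b ((Pi.single a m : Tot M) (b - A.deg g)) = 0
    rw [Pi.single_eq_of_ne (by omega), map_zero]

lemma totWord_single_eq_zero {M : Rep A} (hM : isModule A Z M) {w : List A.Op} (a : ℤ)
    (hw : ¬ Allowed Z a w) (m : M.obj (vert A a)) : totWord M w (Pi.single a m) = 0 := by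
  induction w generalizing a with
  | nil => exact (hw trivial).elim
  | cons g w ih =>
    change totWord M w (totOp M g _) = 0
    rw [totOp_single]
    by_cases hg : Z g a
    · rw [hM.2 g a _ hg]
      change totWord M w (Pi.single _ 0) = 0
      rw [Pi.single_zero, map_zero]
    · exact ih _ (fun h ↦ hw ⟨hg, h⟩) _

/-- For `K = ⊤` the words discarded by `red` are those forbidden by instability, and these act as
zero on an element of degree `a` of any module. This makes maps out of the free module well defined.
-/
lemma totLin_red {M : Rep A} (hM : isModule A Z M) (u : List A.Op →₀ k)
    (m : M.obj (vert A a)) :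
    totLin M (O.red Z a ⊤ u) (Pi.single a m) = totLin M u (Pi.single a m) := by
  classical
  have h1 : totLin M (O.nf u) = totLin M u := by
    rw [eq_comm, ← sub_eq_zero, ← map_sub]
    exact O.totLin_relSpan hM (O.sub_nf_mem u)
  rw [← h1, red_apply]
  conv_rhs => rw [← Finsupp.filter_add_filter_not (O.nf u) (O.Kept Z a ⊤)]
  rw [map_add, LinearMap.add_apply, left_eq_add, totLin, Finsupp.linearCombination_apply,
    Finsupp.sum, LinearMap.sum_apply]
  refine Finset.sum_eq_zero fun w hw ↦ ?_
  rw [LinearMap.smul_apply, totWord_single_eq_zero hM a (fun H ↦ ?_), smul_zero]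
  rw [Finsupp.mem_support_iff] at hw
  refine hw (Finsupp.filter_apply_neg _ _ (not_not.2 ⟨H, fun g _ ↦ WithTop.coe_lt_top _⟩))

/-- The morphism from the free module given by an element of `M`. -/
def freeHom {M : GrMod A Z} (m : M.obj.obj (vert A a)) : O.cyc a ⊤ hZ ⟶ M :=
  ObjectProperty.homMk (repHom
    (fun c ↦ ModuleCat.ofHom
      ((LinearMap.proj (R := k) (φ := fun c ↦ M.obj.obj (vert A c)) c) ∘ₗ
        (LinearMap.applyₗ (Pi.single a m : Tot M.obj) ∘ₗ totLin M.obj) ∘ₗ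
          (O.piece Z a ⊤ c).subtype))
    fun g c c' h ↦ by
      ext u
      refine (congrArg (fun z ↦ totLin M.obj z (Pi.single a m) c')
        (O.act_cycRep a ⊤ g h u)).trans ?_
      rw [O.totLin_red a M.property, totLin_app]
      exact totOp_apply M.obj h _)

lemma freeHom_apply {M : GrMod A Z} (m : M.obj.obj (vert A a)) (c : ℤ) (u : O.piece Z a ⊤ c) :
    (O.freeHom a hZ m).hom.app (vert A c) u = totLin M.obj u.1 (Pi.single a m) c := rfl

/-- The generator of the cyclic module. -/
def gen : (O.cyc a K hZ).obj.obj (vert A a) := (⟨_, O.nil_mem a K⟩ : O.piece Z a K a)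

lemma freeHom_gen {M : GrMod A Z} (m : M.obj.obj (vert A a)) :
    (O.freeHom a hZ m).hom.app (vert A a) (O.gen a ⊤ hZ) = m := by
  refine (O.freeHom_apply a hZ m a ⟨_, O.nil_mem a ⊤⟩).trans ?_
  simp [totWord]

lemma totMap_totLin {M N : Rep A} (f : M ⟶ N) (u : List A.Op →₀ k) (m : Tot M) :
    totMap f (totLin M u m) = totLin N u (totMap f m) := by
  induction u using Finsupp.induction_linear with
  | zero => simp
  | add u v hu hv => simp only [map_add, LinearMap.add_apply, hu, hv]
  | single w c =>
    simp only [totLin_single, LinearMap.smul_apply, map_smul]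
    congr 1
    induction w generalizing m with
    | nil => rfl
    | cons g w ih => exact (ih _).trans (congrArg _ (totMap_totOp f g m))

lemma totMap_single {M N : Rep A} (f : M ⟶ N) (a : ℤ) (m : M.obj (vert A a)) :
    totMap f (Pi.single a m) = Pi.single a (f.app (vert A a) m) := by
  funext c
  by_cases h : c = a
  · subst h
    simp
  · rw [Pi.single_eq_of_ne h, totMap_apply, Pi.single_eq_of_ne h, map_zero]

lemma freeHom_comp {M N : GrMod A Z} (m : M.obj.obj (vert A a)) (f : M ⟶ N) :
    O.freeHom a hZ m ≫ f = O.freeHom a hZ (f.hom.app (vert A a) m) := by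
  refine grHom_ext fun c u ↦ ?_
  refine (congrFun (totMap_totLin f.hom u.1 (Pi.single a m)) c).trans ?_
  rw [totMap_single]
  rfl

/-- Words applied to the generator. -/
lemma totWord_gen {c : ℤ} (w : List A.Op) (hc : a + wdeg w = c) :
    (totWord (O.cyc a K hZ).obj w (Pi.single a (O.gen a K hZ)) c : O.piece Z a K c).1 =
      O.red Z a K (Finsupp.single w 1) := by
  induction w using List.reverseRecOn generalizing c with
  | nil =>
    obtain rfl : a = c := by simpa using hc
    refine Eq.trans ?_ (O.red_piece a K (O.nil_mem (Z := Z) a K)).symm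
    exact congrArg Subtype.val (Pi.single_eq_same (M := fun c ↦ O.piece Z a K c) _ _)
  | append_singleton w g ih =>
    rw [totWord_append]
    change (totOp (O.cyc a K hZ).obj g (totWord (O.cyc a K hZ).obj w
      (Pi.single a (O.gen a K hZ))) c : O.piece Z a K c).1 = _
    rw [totOp_apply (O.cyc a K hZ).obj (a := a + wdeg w) (by simp at hc; omega)]
    refine (O.act_cycRep a K g (by simp at hc; omega) _).trans ?_
    rw [ih rfl, O.red_app_red a K hZ, app_single]

lemma totLin_gen {c : ℤ} (u : O.piece Z a K c) :
    (totLin (O.cyc a K hZ).obj u.1 (Pi.single a (O.gen a K hZ)) c : O.piece Z a K c) = u := by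
  refine Subtype.ext ?_
  obtain ⟨u, hu⟩ := u
  have h : ∀ u ∈ O.piece Z a K c,
      (totLin (O.cyc a K hZ).obj u (Pi.single a (O.gen a K hZ)) c : O.piece Z a K c).1 =
        O.red Z a K u := by
    intro u hu
    have hu' := O.piece_le a K c hu
    rw [Finsupp.supported_eq_span_single] at hu'
    refine Submodule.span_induction (p := fun u _ ↦
      (totLin (O.cyc a K hZ).obj u (Pi.single a (O.gen a K hZ)) c : O.piece Z a K c).1 =
        O.red Z a K u) ?_ ?_ ?_ ?_ hu'
    · rintro _ ⟨w, hw, rfl⟩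
      rw [totLin_single, one_smul]
      exact O.totWord_gen a K hZ w hw
    · rw [map_zero, map_zero]
      rfl
    · intro u v _ _ hu hv
      rw [map_add, map_add, ← hu, ← hv]
      rfl
    · intro r u _ hu
      rw [map_smul, map_smul, ← hu]
      rfl
  rw [h u hu, O.red_piece a K hu]

/-- A morphism from a cyclic module is determined by the image of the generator. -/
lemma cyc_hom_ext {M : GrMod A Z} {f f' : O.cyc a K hZ ⟶ M}
    (h : f.hom.app (vert A a) (O.gen a K hZ) = f'.hom.app (vert A a) (O.gen a K hZ)) : f = f' := by
  refine grHom_ext fun c u ↦ ?_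
  have key : ∀ f : O.cyc a K hZ ⟶ M, f.hom.app (vert A c) u =
      totLin M.obj (u : O.piece Z a K c).1
        (Pi.single a (f.hom.app (vert A a) (O.gen a K hZ))) c := by
    intro f
    rw [← totMap_single, ← totMap_totLin]
    exact congrArg (f.hom.app (vert A c)) (O.totLin_gen a K hZ u).symm
  rw [key f, key f', h]

/-- A morphism from the free module is the choice of an element of degree `a`, and epimorphisms are
surjective in each degree. -/
instance free_projective : Projective (O.cyc a ⊤ hZ) where
  factors {E X} f e _ := by
    obtain ⟨m, hm⟩ := app_surjective e a (f.hom.app (vert A a) (O.gen a ⊤ hZ))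
    refine ⟨O.freeHom a hZ m, O.cyc_hom_ext a ⊤ hZ ?_⟩
    rw [freeHom_comp, freeHom_gen, hm]

end PBWSystem

/-! ### Direct sums -/

/-- The direct sum of representations. -/
def dsum {ι : Type} (M : ι → Rep A) : Rep A where
  obj c := ModuleCat.of k (Π₀ i, (M i).obj c)
  map f := ModuleCat.ofHom (DFinsupp.mapRange.linearMap fun i ↦ ((M i).map f).hom)
  map_id c := by
    ext x i
    simp
  map_comp f g := by
    ext x i
    simp

/-- The projection of a direct sum. -/
def dsumProj {ι : Type} (M : ι → Rep A) (i : ι) : dsum M ⟶ M i where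
  app c := ModuleCat.ofHom (DFinsupp.lapply i)
  naturality c d f := by
    ext x
    rfl

lemma dsum_ext {ι : Type} (M : ι → Rep A) {c : ℤ} {x y : (dsum M).obj (vert A c)}
    (h : ∀ i, (dsumProj M i).app (vert A c) x = (dsumProj M i).app (vert A c) y) : x = y :=
  DFinsupp.ext (β := fun i ↦ (M i).obj (vert A c)) h

lemma isModule_dsum {ι : Type} (M : ι → Rep A) {Z : A.Op → ℤ → Prop}
    (h : ∀ i, isModule A Z (M i)) : isModule A Z (dsum M) := by
  refine ⟨fun ρ hρ a b ↦ ?_, fun g a b hg ↦ ?_⟩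
  · ext x
    refine dsum_ext M fun i ↦ ?_
    refine (congrArg (fun φ ↦ φ.hom x) (relMap_naturality (dsumProj M i) ρ a b)).trans ?_
    rw [(h i).1 ρ hρ, comp_zero]
    exact (map_zero ((dsumProj M i).app (vert A b)).hom).symm
  · ext x
    refine dsum_ext M fun i ↦ ?_
    refine (congrArg (fun φ ↦ φ.hom x) (act_naturality (dsumProj M i) g a b)).trans ?_
    rw [(h i).2 g a b hg, comp_zero]
    exact (map_zero ((dsumProj M i).app (vert A b)).hom).symm

section

variable {ι : Type} {Z : A.Op → ℤ → Prop} (M : ι → GrMod A Z)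

/-- The direct sum of modules. -/
def dsumMod : GrMod A Z := ⟨dsum fun i ↦ (M i).obj, isModule_dsum _ fun i ↦ (M i).property⟩

open Classical in
/-- The inclusion of a summand. -/
def dsumIncl (i : ι) : M i ⟶ dsumMod M :=
  ObjectProperty.homMk
    { app := fun c ↦ ModuleCat.ofHom (DFinsupp.lsingle (M := fun i ↦ (M i).obj.obj c) i)
      naturality := fun c d f ↦ by
        ext x
        exact (DFinsupp.mapRange_single (f := fun i ↦ ⇑((M i).obj.map f).hom)
          (hf := fun _ ↦ map_zero _)).symm }

open Classical in
/-- The morphism from a direct sum given by morphisms from the summands. -/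
def dsumDesc {N : GrMod A Z} (f : ∀ i, M i ⟶ N) : dsumMod M ⟶ N :=
  ObjectProperty.homMk
    { app := fun c ↦ ModuleCat.ofHom
        (DFinsupp.lsum (M := fun i ↦ (M i).obj.obj c) ℕ fun i ↦ ((f i).hom.app c).hom)
      naturality := fun c d g ↦ by
        refine ModuleCat.hom_ext (DFinsupp.lhom_ext fun i x ↦ ?_)
        refine (congrArg (DFinsupp.lsum (M := fun i ↦ (M i).obj.obj d) ℕ
          fun i ↦ ((f i).hom.app d).hom)
          (DFinsupp.mapRange_single (f := fun i ↦ ⇑((M i).obj.map g).hom)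
            (hf := fun _ ↦ map_zero _))).trans ?_
        refine (DFinsupp.lsum_single _ _ _ _).trans ?_
        refine Eq.trans ?_ (congrArg (N.obj.map g).hom (DFinsupp.lsum_single ℕ
          (fun i ↦ ((f i).hom.app c).hom) i x)).symm
        exact congrArg (fun φ ↦ φ.hom x) ((f i).hom.naturality g) }

lemma dsumIncl_desc {N : GrMod A Z} (f : ∀ i, M i ⟶ N) (i : ι) :
    dsumIncl M i ≫ dsumDesc M f = f i := by
  classical
  refine grHom_ext fun c x ↦ ?_
  exact DFinsupp.lsum_single ℕ (fun i ↦ ((f i).hom.app (vert A c)).hom) i x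

lemma dsum_hom_ext {N : GrMod A Z} {f g : dsumMod M ⟶ N}
    (h : ∀ i, dsumIncl M i ≫ f = dsumIncl M i ≫ g) : f = g := by
  classical
  refine ObjectProperty.hom_ext _ (repHom_ext fun c ↦ ?_)
  refine ModuleCat.hom_ext (DFinsupp.lhom_ext fun i x ↦ ?_)
  exact congrArg (fun φ : M i ⟶ N ↦ (φ.hom.app (vert A c)).hom x) (h i)

instance dsum_projective [∀ i, Projective (M i)] : Projective (dsumMod M) where
  factors {E X} f e _ := by
    refine ⟨dsumDesc M fun i ↦ Projective.factorThru (dsumIncl M i ≫ f) e, dsum_hom_ext M fun i ↦ ?_⟩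
    rw [← Category.assoc, dsumIncl_desc, Projective.factorThru_comp]

end

lemma PBWSystem.enoughProjectives (O : PBWSystem A) {Z : A.Op → ℤ → Prop} (hZ : O.Compat Z) :
    EnoughProjectives (GrMod A Z) where
  presentation M := by
    let ι : Type := Σ c : ℤ, M.obj.obj (vert A c)
    let P : ι → GrMod A Z := fun i ↦ O.cyc i.1 ⊤ hZ
    let f : ∀ i, P i ⟶ M := fun i ↦ O.freeHom i.1 hZ i.2
    have : ∀ i, Projective (P i) := fun i ↦ O.free_projective i.1 hZ
    refine ⟨{ p := dsumMod P, f := dsumDesc P f, projective := inferInstance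
              epi := grMod_epi _ fun c x ↦ ?_ }⟩
    refine ⟨(dsumIncl P ⟨c, x⟩).hom.app (vert A c) (O.gen c ⊤ hZ), ?_⟩
    refine (congrArg (fun φ : P ⟨c, x⟩ ⟶ M ↦ φ.hom.app (vert A c) (O.gen c ⊤ hZ))
      (dsumIncl_desc P f ⟨c, x⟩)).trans ?_
    exact O.freeHom_gen c hZ x



end DyerLashof

end

noncomputable section

namespace DyerLashof

variable {k : Type} [Field k] {A : QuadraticPresentation k}

/-! ### The short exact sequences of cyclic modules -/

namespace OpOrder

variable (O : OpOrder A)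

lemma preserved_length (n : ℕ) : O.Preserved fun w ↦ w.length = n := by
  intro x y h g h' g' _ _ H
  simpa using H

/-- The condition that `g` vanishes on elements of degree `a` if `v g + t < a`. -/
def unst (t : ℤ) : A.Op → ℤ → Prop := fun g a ↦ O.v g + t < a

/-- The first condition follows from the inequality that defines inadmissibility. The second is what
the field `excess` of `Step` is for. -/
lemma compat_unst (t : ℤ) : O.Compat (O.unst t) where
  of_inadm {h g a} h₁ h₂ := by
    unfold Inadm at h₁
    unfold unst at *
    omega
  of_step {h g h' g' a} h₁ h₂ := by
    have := h₁.excess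
    unfold unst at *
    omega

/-- In degrees at least `t` an allowed letter has nonnegative value, hence nonnegative degree, so
the word never leaves this range. -/
lemma wdeg_nonneg {t : ℤ} {c : ℤ} {w : List A.Op} (hw : Allowed (O.unst t) c w) (hc : t ≤ c) :
    0 ≤ wdeg w := by
  induction w generalizing c with
  | nil => simp
  | cons h w ih =>
    have h1 : ¬ (O.v h + t < c) := hw.1
    have h2 := O.le_deg (g := h) (by omega)
    have h3 := ih hw.2 (by omega)
    rw [wdeg_cons]
    omega

end OpOrder

namespace PBWSystem

open OpOrder

variable (O : PBWSystem A) {Z : A.Op → ℤ → Prop} (a : ℤ)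

lemma red_red {K K' : WithTop ℤ} (h : K ≤ K') (u : List A.Op →₀ k) :
    O.red Z a K (O.red Z a K' u) = O.red Z a K u := by
  classical
  have h1 : O.nf (O.red Z a K' u) = O.red Z a K' u := by
    refine O.nf_of_mem fun w hw ↦ O.nf_mem u ?_
    rw [red_apply] at hw
    exact Finsupp.support_subset_iff.2 (fun w' hw' ↦ by simpa using hw') (by
      simp only [Finset.mem_coe, Finsupp.mem_support_iff, Finsupp.filter_apply] at hw ⊢
      exact fun h ↦ hw (by simp [h]))
  rw [red_apply, h1, red_apply, red_apply]
  ext w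
  by_cases hw : O.Kept Z a K w
  · rw [Finsupp.filter_apply_pos _ _ hw, Finsupp.filter_apply_pos _ _ hw,
      Finsupp.filter_apply_pos]
    exact ⟨hw.1, fun g hg ↦ (hw.2 g hg).trans_le h⟩
  · rw [Finsupp.filter_apply_neg _ _ hw, Finsupp.filter_apply_neg _ _ hw]

lemma red_apply_le {K : WithTop ℤ} {u : List A.Op →₀ k} {P : List A.Op → Prop} (hP : O.Preserved P)
    (hu : u ∈ Finsupp.supported k k {w | P w}) {w : List A.Op} (hw : ¬ P w) :
    O.red Z a K u w = 0 := by
  classical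
  by_contra H
  rw [red_apply, Finsupp.filter_apply] at H
  split_ifs at H with h
  · exact hw (O.nf_preserved_of_mem hP hu (by simpa using H))
  · exact H rfl

variable (hZ : O.Compat Z)

/-- The projection between cyclic modules. -/
def cycProj {K K' : WithTop ℤ} (h : K ≤ K') : O.cyc a K' hZ ⟶ O.cyc a K hZ :=
  ObjectProperty.homMk (repHom
    (fun c ↦ ModuleCat.ofHom (LinearMap.restrict (p := O.piece Z a K' c) (q := O.piece Z a K c)
      (O.red Z a K) fun _ hu ↦ O.red_mem Z a K (O.piece_le a K' c hu)))
    fun g c c' hc ↦ by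
      ext u
      refine Subtype.ext ?_
      refine (congrArg (O.red Z a K) (O.act_cycRep a K' g hc u)).trans ?_
      refine Eq.trans ?_ (O.act_cycRep a K g hc _).symm
      refine (O.red_red a h _).trans ?_
      exact (O.red_app_red a K hZ g _).symm)

lemma cycProj_surjective {K K' : WithTop ℤ} (h : K ≤ K') (c : ℤ) :
    Function.Surjective ((O.cycProj a hZ h).hom.app (vert A c)) := by
  rintro ⟨u, hu⟩
  refine ⟨(⟨u, fun w hw ↦ ⟨⟨(hu hw).1.1, (hu hw).1.2.1, fun g hg ↦
    ((hu hw).1.2.2 g hg).trans_le h⟩, (hu hw).2⟩⟩ : O.piece Z a K' c), ?_⟩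
  exact Subtype.ext (O.red_piece a K hu)

/-- If `w` is kept with the bound `v g + deg g + 1`, its first letter is small enough for `g :: w`
to be admissible. If it fails only this bound, then `g` and the first letter form an inadmissible
composite; rewriting it yields words whose first letter has value above `v g`, and these vanish in
the module with bound `v g + 1`. A word forbidden by instability stays forbidden after prepending
`g`. -/
lemma red_pre (hZ : O.Compat Z) {g : A.Op} (hg : ¬ Z g a) (u : List A.Op →₀ k) :
    O.red Z a (O.v g + 1 : ℤ) (pre g u) =
      pre g (O.red Z (a + A.deg g) (O.v g + A.deg g + 1 : ℤ) u) := by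
  classical
  have key : ∀ u ∈ Finsupp.supported k k {w | O.Adm w}, O.red Z a (O.v g + 1 : ℤ) (pre g u) =
      pre g (O.red Z (a + A.deg g) (O.v g + A.deg g + 1 : ℤ) u) := by
    intro u hu
    rw [Finsupp.supported_eq_span_single] at hu
    refine Submodule.span_induction (p := fun u _ ↦ O.red Z a (O.v g + 1 : ℤ) (pre g u) =
      pre g (O.red Z (a + A.deg g) (O.v g + A.deg g + 1 : ℤ) u)) ?_ ?_ ?_ ?_ hu
    · rintro _ ⟨w, hw, rfl⟩
      change O.Adm w at hw
      by_cases hk : O.Kept Z (a + A.deg g) (O.v g + A.deg g + 1 : ℤ) w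
      · rw [O.red_of_mem _ _ _ (Finsupp.single_mem_supported _ _ ⟨hw, hk⟩), pre_single]
        refine O.red_of_mem _ _ _ (Finsupp.single_mem_supported _ _ ⟨?_, ⟨hg, hk.1⟩, ?_⟩)
        · cases w with
          | nil => exact List.isChain_singleton _
          | cons h w =>
            refine List.isChain_cons_cons.2 ⟨fun H ↦ ?_, hw⟩
            have h1 := hk.2 h (by simp)
            rw [WithTop.coe_lt_coe] at h1
            unfold Inadm at H
            omega
        · intro g' hg'
          obtain rfl : g = g' := by simpa using hg'
          exact WithTop.coe_lt_coe.2 (by omega)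
      · rw [O.red_eq_zero _ _ hZ (Finsupp.single_mem_supported _ _ hk), map_zero, pre_single]
        by_cases ha : Allowed Z (a + A.deg g) w
        · have hh : ∃ h ∈ w.head?, O.v g + A.deg g + 1 ≤ O.v h := by
            by_contra! H
            exact hk ⟨ha, fun h hh ↦ WithTop.coe_lt_coe.2 (H h hh)⟩
          obtain ⟨h, hh, hv⟩ := hh
          obtain ⟨y, rfl⟩ : ∃ y, w = h :: y := by
            cases w with
            | nil => simp at hh
            | cons q y =>
              obtain rfl : q = h := by simpa using hh
              exact ⟨y, rfl⟩
          obtain ⟨ρ, hρ, hL⟩ := O.exists_rel h g (by unfold Inadm; omega)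
          have h1 := hL.single_sub [] y
          rw [sub_eq_iff_eq_add] at h1
          rw [List.nil_append] at h1
          rw [h1, map_add, O.red_of_mem_relSpan Z _ _ (ins_mem _ _ hρ), add_zero, map_neg,
            neg_eq_zero]
          have h2 : ∑ q ∈ ρ.support.erase (h, g), ρ q • Finsupp.single ([] ++ q.2 :: q.1 :: y) 1 ∈
              Finsupp.supported k k
                {w : List A.Op | ∃ g' ∈ w.head?, (O.v g + 1 : ℤ) ≤ O.v g'} := by
            refine Submodule.sum_mem _ fun q hq ↦ Submodule.smul_mem _ _
              (Finsupp.single_mem_supported _ _ ⟨q.2, by simp, ?_⟩)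
            exact (hL.step q (by simpa using Finset.mem_of_mem_erase hq)
              (Finset.ne_of_mem_erase hq)).lt_right
          ext w
          by_cases hw : ∃ g' ∈ w.head?, (O.v g + 1 : ℤ) ≤ O.v g'
          · rw [red_apply, Finsupp.filter_apply_neg]
            · rfl
            · intro H
              obtain ⟨g', h3, h4⟩ := hw
              have := WithTop.coe_lt_coe.1 (H.2 g' h3)
              omega
          · exact O.red_apply_le a (preserved_head _) h2 hw
        · exact O.red_eq_zero _ _ hZ (Finsupp.single_mem_supported _ _ fun H ↦ ha H.1.2)
    · simp
    · intro u v _ _ hu hv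
      rw [map_add, map_add, map_add, map_add, hu, hv]
    · intro c u _ hu
      rw [map_smul, map_smul, map_smul, map_smul, hu]
  have h1 : O.red Z a (O.v g + 1 : ℤ) (pre g u) = O.red Z a (O.v g + 1 : ℤ) (pre g (O.nf u)) := by
    rw [red_apply, red_apply, nf_pre_nf]
  rw [h1, key _ (O.nf_mem u), red_apply, red_apply, O.nf_of_mem (O.nf_mem u)]

lemma app_pre (g g' : A.Op) (u : List A.Op →₀ k) : app g' (pre g u) = pre g (app g' u) := by
  simp only [app, pre, Finsupp.lmapDomain_apply, ← Finsupp.mapDomain_comp]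
  rfl

lemma pre_injective (g : A.Op) :
    Function.Injective (pre g : (List A.Op →₀ k) →ₗ[k] (List A.Op →₀ k)) :=
  Finsupp.mapDomain_injective fun _ _ h ↦ (List.cons.inj h).2

lemma pre_supported {c : ℤ} (g : A.Op) {u : List A.Op →₀ k}
    (hu : u ∈ Finsupp.supported k k {w : List A.Op | a + A.deg g + wdeg w = c}) :
    pre g u ∈ Finsupp.supported k k {w : List A.Op | a + wdeg w = c} := by
  have : Finsupp.supported k k {w : List A.Op | a + A.deg g + wdeg w = c} ≤
      (Finsupp.supported k k {w | a + wdeg w = c}).comap (pre g) := by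
    conv_lhs => rw [Finsupp.supported_eq_span_single]
    rw [Submodule.span_le]
    rintro _ ⟨w, hw, rfl⟩
    rw [SetLike.mem_coe, Submodule.mem_comap, pre_single]
    refine Finsupp.single_mem_supported _ _ ?_
    have : a + A.deg g + wdeg w = c := hw
    simp only [Set.mem_ofPred_eq, wdeg_cons]
    omega
  exact this hu

/-- The inclusion of the submodule generated by `g x` into the cyclic module on `x`. -/
def cycIncl {g : A.Op} (hg : ¬ Z g a) :
    O.cyc (a + A.deg g) (O.v g + A.deg g + 1 : ℤ) hZ ⟶ O.cyc a (O.v g + 1 : ℤ) hZ :=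
  ObjectProperty.homMk (repHom
    (fun c ↦ ModuleCat.ofHom (LinearMap.restrict
      (p := O.piece Z (a + A.deg g) (O.v g + A.deg g + 1 : ℤ) c)
      (q := O.piece Z a (O.v g + 1 : ℤ) c) (pre g) fun u hu ↦ by
        rw [← O.red_piece _ _ hu, ← O.red_pre a hZ hg]
        exact O.red_mem _ _ _ (pre_supported a g (O.piece_le _ _ c hu))))
    fun g' c c' hc ↦ by
      ext u
      refine Subtype.ext ?_
      refine (congrArg (pre g) (O.act_cycRep _ _ g' hc u)).trans ?_
      refine Eq.trans ?_ (O.act_cycRep a _ g' hc _).symm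
      refine (O.red_pre a hZ hg _).symm.trans ?_
      exact congrArg _ (app_pre _ _ _).symm)

/-- The filtration of the cyclic module by the submodule generated by `g x`. -/
def cycSeq {g : A.Op} (hg : ¬ Z g a) : ShortComplex (GrMod A Z) where
  f := O.cycIncl a hZ hg
  g := O.cycProj a hZ (K := (O.v g : ℤ)) (K' := (O.v g + 1 : ℤ)) (WithTop.coe_le_coe.2 (by omega))
  zero := by
    refine grHom_ext fun c u ↦ ?_
    obtain ⟨u, hu⟩ := u
    refine Subtype.ext ?_
    change O.red Z a (O.v g : ℤ) (pre g u) = 0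
    refine O.red_eq_zero a _ hZ ?_
    have h : ∀ u : List A.Op →₀ k, pre g u ∈
        Finsupp.supported k k {w | ¬ O.Kept Z a (O.v g : ℤ) w} := by
      intro u
      induction u using Finsupp.induction_linear with
      | zero => simp
      | add u v hu hv =>
        rw [map_add]
        exact add_mem hu hv
      | single w c =>
        rw [pre_single]
        exact Finsupp.single_mem_supported _ _ fun H ↦
          absurd (WithTop.coe_lt_coe.1 (H.2 g (by simp))) (lt_irrefl _)
    exact h u

/-- As `v` is injective, a word that is kept for the bound `v g + 1` but not for `v g` begins with
`g`. Admissibility then bounds its second letter by `v g + deg g`, which is exactly the bound on the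
submodule. -/
lemma cycSeq_shortExact {g : A.Op} (hg : ¬ Z g a) : (O.cycSeq a hZ hg).ShortExact := by
  classical
  refine shortExact_of_pointwise _ (fun c ↦ ?_) (fun c y hy ↦ ?_) fun c ↦
    O.cycProj_surjective a hZ (WithTop.coe_le_coe.2 (by omega)) c
  · rintro ⟨u, hu⟩ ⟨u', hu'⟩ h
    exact Subtype.ext (pre_injective g (congrArg Subtype.val h))
  · obtain ⟨y, hm⟩ := y
    change y ∈ O.piece Z a (O.v g + 1 : ℤ) c at hm
    have hy' : O.red Z a (O.v g : ℤ) y = 0 := congrArg Subtype.val hy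
    rw [red_apply, O.nf_of_mem fun w hw ↦ (hm hw).1.1, Finsupp.filter_eq_zero_iff] at hy'
    have hd : ∀ w ∈ y.support, ∃ z, w = g :: z := by
      intro w hw
      have h1 : ¬ O.Kept Z a (O.v g : ℤ) w := fun H ↦ by simp [hy' w H] at hw
      have h2 := (hm hw).1.2
      cases w with
      | nil => exact (h1 ⟨h2.1, by simp [HeadLt]⟩).elim
      | cons q z =>
        have h3 := WithTop.coe_lt_coe.1 (h2.2 q (by simp))
        have h4 : ¬ O.v q < O.v g := fun H ↦ h1 ⟨h2.1, fun r hr ↦ by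
          obtain rfl : q = r := by simpa using hr
          exact WithTop.coe_lt_coe.2 H⟩
        exact ⟨z, by rw [O.v.injective (by omega : O.v q = O.v g)]⟩
    have hpre : pre g (y.mapDomain List.tail) = y := by
      simp only [pre, Finsupp.lmapDomain_apply, ← Finsupp.mapDomain_comp]
      conv_rhs => rw [← Finsupp.mapDomain_id (v := y)]
      refine Finsupp.mapDomain_congr fun w hw ↦ ?_
      obtain ⟨z, rfl⟩ := hd w hw
      rfl
    refine ⟨(⟨y.mapDomain List.tail, ?_⟩ :
      O.piece Z (a + A.deg g) (O.v g + A.deg g + 1 : ℤ) c), Subtype.ext hpre⟩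
    intro w hw
    obtain ⟨w, hw', rfl⟩ := Finset.mem_image.1 (Finsupp.mapDomain_support hw)
    obtain ⟨⟨h1, h2⟩, h3⟩ := hm hw'
    obtain ⟨z, rfl⟩ := hd w hw'
    refine ⟨⟨?_, h2.1.2, ?_⟩, ?_⟩
    · exact List.IsChain.tail h1
    · intro q hq
      cases z with
      | nil => simp at hq
      | cons r z =>
        obtain rfl : r = q := by simpa using hq
        have := (List.isChain_cons_cons.1 h1).1
        unfold Inadm at this
        exact WithTop.coe_lt_coe.2 (by omega)
    · rw [wdeg_cons] at h3
      simp only [List.tail_cons]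
      omega

lemma act_simple (g : A.Op) (c c' : ℤ) : act (e Z a).obj g c c' = 0 := by
  by_cases h : c + A.deg g = c'
  · exact (act_lift _ _ h).trans rfl
  · exact act_of_ne _ _ h

/-- The quotient map from the cyclic module to the simple one. -/
def aug (K : WithTop ℤ) : O.cyc a K hZ ⟶ e Z a :=
  ObjectProperty.homMk (repHom
    (fun c ↦ ModuleCat.ofHom
      (LinearMap.pi (fun _ : PLift (c = a) ↦ Finsupp.lapply (R := k) ([] : List A.Op) ∘ₗ
        (O.piece Z a K c).subtype)))
    fun g c c' hc ↦ by
      refine Eq.trans ?_ ((congrArg (_ ≫ ·) (act_simple a g c c')).trans comp_zero).symm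
      ext u
      refine funext fun q ↦ ?_
      refine (congrArg (fun z : List A.Op →₀ k ↦ z []) (O.act_cycRep a K g hc u)).trans ?_
      have h1 : app g u.1 ∈ Finsupp.supported k k {w : List A.Op | w ≠ []} := by
        have : ∀ u : List A.Op →₀ k,
            app g u ∈ Finsupp.supported k k {w : List A.Op | w ≠ []} := by
          intro u
          induction u using Finsupp.induction_linear with
          | zero => simp
          | add u v hu hv =>
            rw [map_add]
            exact add_mem hu hv
          | single w c =>
            rw [app_single]
            exact Finsupp.single_mem_supported _ _ (by simp)
        exact this _
      refine (O.red_apply_le a (P := fun w ↦ w ≠ []) (fun _ _ _ _ _ _ _ _ _ ↦ by simp) h1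
        (by simp)))

lemma cycProj_aug {K K' : WithTop ℤ} (h : K ≤ K') :
    O.cycProj a hZ h ≫ O.aug a hZ K = O.aug a hZ K' := by
  classical
  refine grHom_ext fun c u ↦ funext fun q ↦ ?_
  obtain ⟨u, hu⟩ := u
  change O.red Z a K u [] = u []
  rw [red_apply, O.nf_of_mem fun w hw ↦ (hu hw).1.1, Finsupp.filter_apply_pos]
  exact ⟨trivial, by simp [HeadLt]⟩

/-- Rewriting preserves length. The coefficient of the one-letter word `[g]` after appending a
letter therefore depends only on the coefficient of the empty word. -/
lemma red_app_apply {g g' : A.Op} (hg : ¬ Z g a) (u : List A.Op →₀ k) [Decidable (g' = g)] :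
    O.red Z a (O.v g + 1 : ℤ) (app g' u) [g] = if g' = g then u [] else 0 := by
  classical
  induction u using Finsupp.induction_linear with
  | zero => simp
  | add u v h₁ h₂ =>
    simp only [map_add, Finsupp.add_apply]
    rw [h₁, h₂]
    split_ifs <;> simp
  | single w r =>
    simp only [app_single]
    by_cases hw : w = []
    · subst hw
      rw [List.nil_append]
      by_cases h : g' = g
      · subst h
        rw [O.red_of_mem _ _ _ (Finsupp.single_mem_supported _ _ ⟨List.isChain_singleton _,
          ⟨hg, trivial⟩, ?_⟩)]
        · simp
        · intro q hq
          obtain rfl : g' = q := by simpa using hq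
          exact WithTop.coe_lt_coe.2 (by omega)
      · rw [if_neg h, red_apply, O.nf_single (List.isChain_singleton _), Finsupp.filter_apply]
        split_ifs
        · rw [Finsupp.single_apply, if_neg (by simpa using h)]
        · rfl
    · rw [O.red_apply_le a (O.preserved_length (w ++ [g']).length)
        (Finsupp.single_mem_supported _ _ rfl), Finsupp.single_apply, if_neg hw]
      · simp
      · simpa [eq_comm] using hw

/-- The morphism from the filtration of the cyclic module to the extension dual to `g`. -/
def cycSeqHom {g : A.Op} (hg : ¬ Z g a) :
    O.cycSeq a hZ hg ⟶ extension Z g (a := a) rfl hg where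
  τ₁ := O.aug (a + A.deg g) hZ _
  τ₂ := ObjectProperty.homMk (repHom
    (fun c ↦ ModuleCat.ofHom (LinearMap.prod
      (LinearMap.pi (fun _ : PLift (c = a) ↦ Finsupp.lapply (R := k) ([] : List A.Op) ∘ₗ
        (O.piece Z a (O.v g + 1 : ℤ) c).subtype))
      (LinearMap.pi (fun _ : PLift (c = a + A.deg g) ↦ Finsupp.lapply (R := k) [g] ∘ₗ
        (O.piece Z a (O.v g + 1 : ℤ) c).subtype))))
    fun g' c c' hc ↦ by
      classical
      rw [show act (extension Z g (a := a) rfl hg).X₂.obj g' c c' = _ from act_lift _ _ hc]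
      ext u
      refine Prod.ext (funext fun q ↦ ?_) (funext fun q ↦ ?_)
      · have h2 := congrArg (fun φ ↦ (φ.hom u : PLift (c' = a) → k) q)
          (act_naturality (O.aug a hZ (O.v g + 1 : ℤ)).hom g' c c')
        rwa [act_simple, comp_zero] at h2
      · refine (congrArg (fun z : List A.Op →₀ k ↦ z [g]) (O.act_cycRep a _ g' hc u)).trans ?_
        refine (O.red_app_apply a hg u.1).trans ?_
        change _ = dite _ _ _
        split_ifs <;> rfl)
  τ₃ := O.aug a hZ _
  comm₁₂ := by
    refine grHom_ext fun c u ↦ ?_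
    obtain ⟨u, hu⟩ := u
    refine Prod.ext (funext fun q ↦ ?_) (funext fun q ↦ ?_)
    · change (0 : k) = pre g u []
      exact (Finsupp.mapDomain_of_notMem_range _ _ (by simp)).symm
    · change u [] = pre g u [g]
      exact (Finsupp.mapDomain_apply (fun _ _ h ↦ (List.cons.inj h).2) u []).symm
  comm₂₃ := (O.cycProj_aug a hZ (WithTop.coe_le_coe.2 (by omega))).symm

end PBWSystem

end DyerLashof

end

noncomputable section

namespace DyerLashof

variable {k : Type} [Field k] {A : QuadraticPresentation k}

/-! ### Generators of `Ext` -/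

lemma units_smul_eq {M : Type*} [AddCommGroup M] [Module k M] (u : ℤˣ) (x : M) :
    u • x = ((u : ℤ) : k) • x := by
  rw [Units.smul_def, Int.cast_smul_eq_zsmul]

lemma units_cast_mul_self (u : ℤˣ) : ((u : ℤ) : k) * ((u : ℤ) : k) = 1 := by
  rw [← Int.cast_mul, ← Units.val_mul, Int.units_mul_self]
  simp

lemma dualProd_succ (Z : A.Op → ℤ → Prop) (n : ℕ) (g : Fin (n + 1) → A.Op) (a b : ℤ) :
    ∃ u : ℤˣ, dualProd Z (n + 1) g a b =
      u • (dualClass Z (g 0) a (a + A.deg (g 0))).comp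
        (dualProd Z n (Fin.tail g) (a + A.deg (g 0)) b) (Nat.add_comm 1 n) := ⟨_, rfl⟩

lemma dualClass_eq {Z : A.Op → ℤ → Prop} {g : A.Op} {a : ℤ} (h : ¬ Z g a) :
    dualClass Z g a (a + A.deg g) = (extension_shortExact Z g rfl h).extClass :=
  dif_pos ⟨rfl, h⟩

/-- Every two consecutive letters form an inadmissible composite. -/
def OpOrder.Coadm (O : OpOrder A) {n : ℕ} (J : Fin n → A.Op) : Prop :=
  ∀ (i : ℕ) (h : i + 1 < n), O.Inadm (J ⟨i, by omega⟩) (J ⟨i + 1, h⟩)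

lemma OpOrder.coadm_cons (O : OpOrder A) {n : ℕ} {g : A.Op} {J : Fin n → A.Op} (hJ : O.Coadm J)
    (hg : ∀ h : 0 < n, O.Inadm g (J ⟨0, h⟩)) : O.Coadm (Fin.cons g J : Fin (n + 1) → A.Op) := by
  rintro ⟨⟩ h
  · exact hg (by omega)
  · exact hJ _ (by omega)

/-- The module vanishes in degrees at most `d`. -/
def Above {Z : A.Op → ℤ → Prop} (d : ℤ) (M : GrMod A Z) : Prop :=
  ∀ c ≤ d, ∀ x : M.obj.obj (vert A c), x = 0

lemma simple_eq_zero {Z : A.Op → ℤ → Prop} {b c : ℤ} (h : c ≠ b)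
    (x : (e Z b).obj.obj (vert A c)) : x = 0 :=
  funext fun q : PLift (c = b) ↦ (h q.down).elim

namespace PBWSystem

open OpOrder

variable (O : PBWSystem A)

lemma above_cyc {t a d : ℤ} (ht : t ≤ a) (hd : d < a) (K : WithTop ℤ) :
    Above d (O.cyc a K (O.compat_unst t)) := by
  rintro c hc ⟨u, hu⟩
  refine Subtype.ext (Finsupp.support_eq_empty.1 (Finset.eq_empty_of_forall_notMem fun w hw ↦ ?_))
  obtain ⟨⟨-, h, -⟩, hw⟩ := hu hw
  have hw : a + wdeg w = c := hw
  have := O.wdeg_nonneg h ht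
  omega

/-- Generators are needed only in degrees above `d`, and as `d ≥ t` the free modules on them have
nothing in degrees at most `d`. -/
lemma exists_cover {t d : ℤ} (ht : t ≤ d) (M : GrMod A (O.unst t)) (hM : Above d M) :
    ∃ (P : GrMod A (O.unst t)) (f : P ⟶ M), Projective P ∧ Epi f ∧ Above d P := by
  let ι : Type := Σ c : {c : ℤ // d < c}, M.obj.obj (vert A c.1)
  let P : ι → GrMod A (O.unst t) := fun i ↦ O.cyc i.1 ⊤ (O.compat_unst t)
  let f : ∀ i, P i ⟶ M := fun i ↦ O.freeHom i.1 (O.compat_unst t) i.2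
  have : ∀ i, Projective (P i) := fun i ↦ O.free_projective i.1 (O.compat_unst t)
  refine ⟨dsumMod P, dsumDesc P f, inferInstance, grMod_epi _ fun c x ↦ ?_, fun c hc x ↦ ?_⟩
  · by_cases hc : d < c
    · refine ⟨(dsumIncl P ⟨⟨c, hc⟩, x⟩).hom.app (vert A c) (O.gen c ⊤ (O.compat_unst t)), ?_⟩
      refine (congrArg (fun φ : P ⟨⟨c, hc⟩, x⟩ ⟶ M ↦ φ.hom.app (vert A c)
        (O.gen c ⊤ (O.compat_unst t))) (dsumIncl_desc P f ⟨⟨c, hc⟩, x⟩)).trans ?_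
      exact O.freeHom_gen c (O.compat_unst t) x
    · refine ⟨0, ?_⟩
      rw [map_zero, hM c (by omega) x]
  · refine dsum_ext (fun i ↦ (P i).obj) fun i ↦ ?_
    have hi := O.above_cyc (t := t) (a := i.1.1) (d := d) (by have := i.1.2; omega) i.1.2 ⊤ c hc
    exact (hi _).trans (hi _).symm

/-- The kernel of a morphism, as a short exact sequence. -/
lemma kernel_shortExact {Z : A.Op → ℤ → Prop} {P M : GrMod A Z} (f : P ⟶ M) [Epi f] :
    (ShortComplex.mk (kernel.ι f) f (kernel.condition f)).ShortExact where
  exact := ShortComplex.exact_of_f_is_kernel _ (kernelIsKernel f)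

/-- The covers `exists_cover` resolve `M` by projectives that vanish in degrees at most `d`, and
these have no nonzero map to `e_b`. -/
lemma ext_eq_zero_of_above {t d b : ℤ} (ht : t ≤ d) (hb : b ≤ d) (n : ℕ)
    (M : GrMod A (O.unst t)) (hM : Above d M) (x : Ext M (e (O.unst t) b) n) : x = 0 := by
  induction n generalizing M with
  | zero =>
    obtain ⟨f, rfl⟩ := Ext.mk₀_bijective _ _ |>.2 x
    rw [Ext.mk₀_eq_zero_iff]
    refine grHom_ext fun c y ↦ ?_
    by_cases hc : c ≤ d
    · rw [hM c hc y, map_zero, map_zero]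
    · exact (simple_eq_zero (by omega) _).trans (simple_eq_zero (by omega) _).symm
  | succ n ih =>
    obtain ⟨P, f, hP, hf, hPd⟩ := O.exists_cover ht M hM
    obtain ⟨y, rfl⟩ := Ext.contravariant_sequence_exact₃ (kernel_shortExact f) _ x
      (Ext.eq_zero_of_projective _) (n₀ := n) (Nat.add_comm 1 n)
    rw [ih (kernel f) ?_ y, Ext.comp_zero]
    intro c hc x
    refine app_injective (kernel.ι f) c ?_
    rw [map_zero]
    exact hPd c hc _

/-- The classes that generate the `Ext` of a cyclic module. -/
def cycSpan (t : ℤ) (n : ℕ) (a b m : ℤ) :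
    Submodule k (Ext (O.cyc a (m : ℤ) (O.compat_unst t)) (e (O.unst t) b) n) :=
  Submodule.span k {y | ∃ J : Fin n → A.Op, O.Coadm J ∧ (∀ h : 0 < n, m ≤ O.v (J ⟨0, h⟩)) ∧
    y = (Ext.mk₀ (O.aug a (O.compat_unst t) (m : ℤ))).comp (dualProd (O.unst t) n J a b)
      (zero_add n)}

lemma cycSpan_zero (t a b m : ℤ) : O.cycSpan t 0 a b m = ⊤ := by
  refine Submodule.eq_top_iff'.2 fun x ↦ ?_
  obtain ⟨f, rfl⟩ := Ext.mk₀_bijective _ _ |>.2 x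
  by_cases hab : a = b
  · subst hab
    let q : PLift (a = a) := ⟨rfl⟩
    let r : k := (f.hom.app (vert A a) (O.gen a (m : ℤ) (O.compat_unst t)) : PLift (a = a) → k) q
    have hf : f = r • O.aug a (O.compat_unst t) (m : ℤ) := by
      refine O.cyc_hom_ext a _ _ (funext fun q' ↦ ?_)
      change r = r * (Finsupp.single ([] : List A.Op) (1 : k)) []
      simp
    have hd : dualProd (O.unst t) 0 ![] a a = Ext.mk₀ (𝟙 _) := dif_pos rfl
    rw [hf, Ext.mk₀_smul]
    refine Submodule.smul_mem _ _ (Submodule.subset_span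
      ⟨![], fun i h ↦ absurd h (by omega), by simp, ?_⟩)
    rw [hd, Ext.comp_mk₀_id]
  · have : f = 0 := O.cyc_hom_ext a _ _
      ((simple_eq_zero hab _).trans (simple_eq_zero hab _).symm)
    rw [this, Ext.mk₀_zero]
    exact zero_mem _

/-- The kernel of the projection from the free module is spanned by words whose first letter has
value at least `m ≥ 0`, hence degree at least `m`, while the other letters contribute nonnegative
degrees. So the kernel lives in degrees at least `a + m`, beyond `b`, and one dimension shift
suffices. -/
lemma ext_cyc_eq_zero {t a b m : ℤ} (n : ℕ) (h0 : 0 ≤ m) (hb : b < a + m)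
    (ht : t < a + m) (x : Ext (O.cyc a (m : ℤ) (O.compat_unst t)) (e (O.unst t) b) (n + 1)) :
    x = 0 := by
  classical
  have hs := O.cycProj_surjective a (O.compat_unst t) (K := (m : ℤ)) (K' := ⊤) le_top
  have := grMod_epi (O.cycProj a (O.compat_unst t) (K := (m : ℤ)) (K' := ⊤) le_top) hs
  have : Projective (O.cyc a ⊤ (O.compat_unst t)) := O.free_projective a _
  obtain ⟨y, rfl⟩ := Ext.contravariant_sequence_exact₃ (kernel_shortExact
    (O.cycProj a (O.compat_unst t) (K := (m : ℤ)) (K' := ⊤) le_top)) _ x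
      (Ext.eq_zero_of_projective _) (n₀ := n) (Nat.add_comm 1 n)
  rw [O.ext_eq_zero_of_above (d := a + m - 1) (by omega) (by omega) n _ ?_ y, Ext.comp_zero]
  intro c hc x
  let p := O.cycProj a (O.compat_unst t) (K := (m : ℤ)) (K' := ⊤) le_top
  refine app_injective (kernel.ι p) c ?_
  rw [map_zero]
  have h1 : p.hom.app (vert A c) ((kernel.ι p).hom.app (vert A c) x) = 0 :=
    congrArg (fun φ : kernel p ⟶ _ ↦ φ.hom.app (vert A c) x) (kernel.condition p)
  generalize (kernel.ι p).hom.app (vert A c) x = u at h1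
  obtain ⟨u, hu⟩ := u
  change u ∈ O.piece (O.unst t) a ⊤ c at hu
  refine Subtype.ext (Finsupp.support_eq_empty.1 (Finset.eq_empty_of_forall_notMem fun w hw ↦ ?_))
  have h2 : O.red (O.unst t) a (m : ℤ) u = 0 := congrArg Subtype.val h1
  rw [red_apply, O.nf_of_mem fun w hw ↦ (hu hw).1.1, Finsupp.filter_eq_zero_iff] at h2
  have h3 : ¬ O.Kept (O.unst t) a (m : ℤ) w := fun H ↦ by simp [h2 w H] at hw
  obtain ⟨⟨-, h4, -⟩, h5⟩ := hu hw
  cases w with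
  | nil => exact h3 ⟨h4, by simp [HeadLt]⟩
  | cons g w =>
    have h6 : m ≤ O.v g := by
      by_contra! H
      refine h3 ⟨h4, fun q hq ↦ ?_⟩
      obtain rfl : g = q := by simpa using hq
      exact WithTop.coe_lt_coe.2 H
    have h7 := O.le_deg (g := g) (by omega)
    have h8 := O.wdeg_nonneg h4.2 (by omega)
    rw [wdeg_cons] at h5
    omega

/-- This is the long exact sequence of `cycSeq`. A class is first pulled back to the cyclic module
with bound `v g + 1`, where `h₂` describes it by words that begin above `g`. After subtracting the
corresponding classes the difference comes from the submodule, where `h₁` applies, and the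
connecting class puts `g` in front of the words. -/
lemma cycSpan_step {t : ℤ} {n : ℕ} {a b : ℤ} {g : A.Op} (hg : a - t ≤ O.v g)
    (h₁ : O.cycSpan t n (a + A.deg g) b (O.v g + A.deg g + 1) = ⊤)
    (h₂ : O.cycSpan t (n + 1) a b (O.v g + 1) = ⊤) : O.cycSpan t (n + 1) a b (O.v g) = ⊤ := by
  have hZ := O.compat_unst t
  have hg' : ¬ O.unst t g a := by
    unfold unst
    omega
  have hle : ((O.v g : ℤ) : WithTop ℤ) ≤ (O.v g + 1 : ℤ) := WithTop.coe_le_coe.2 (by omega)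
  let L₀ := Ext.bilinearCompOfLinear k (O.cyc a (O.v g + 1 : ℤ) hZ) (O.cyc a (O.v g : ℤ) hZ)
    (e (O.unst t) b) 0 (n + 1) (n + 1) (zero_add _) (Ext.mk₀ (O.cycProj a hZ hle))
  have hL : ∀ y, L₀ y = (Ext.mk₀ (O.cycProj a hZ hle)).comp y (zero_add _) := fun _ ↦ rfl
  let ξ : Ext (O.cyc a (O.v g : ℤ) hZ) (O.cyc (a + A.deg g) (O.v g + A.deg g + 1 : ℤ) hZ) 1 :=
    (O.cycSeq_shortExact a hZ hg').extClass
  let L₁ := Ext.bilinearCompOfLinear k (O.cyc a (O.v g : ℤ) hZ)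
    (O.cyc (a + A.deg g) (O.v g + A.deg g + 1 : ℤ) hZ) (e (O.unst t) b) 1 n (n + 1)
      (Nat.add_comm 1 n) ξ
  have hLL : ∀ y, L₁ y = ξ.comp y (Nat.add_comm 1 n) := fun _ ↦ rfl
  refine Submodule.eq_top_iff'.2 fun x ↦ ?_
  have hx : L₀ x ∈ (O.cycSpan t (n + 1) a b (O.v g)).map L₀ := by
    have : L₀ x ∈ O.cycSpan t (n + 1) a b (O.v g + 1) := h₂ ▸ Submodule.mem_top
    refine Submodule.span_le.2 ?_ this
    -- The generators lift along the pullback because the augmentations are compatible with the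
    -- projection.
    rintro _ ⟨J, hJ, hJ', rfl⟩
    refine ⟨_, Submodule.subset_span ⟨J, hJ, fun h ↦ by have := hJ' h; omega, rfl⟩, ?_⟩
    rw [hL, Ext.mk₀_comp_mk₀_assoc, O.cycProj_aug a hZ hle]
  obtain ⟨x', hx', he⟩ := hx
  obtain ⟨y, hy⟩ : ∃ y : Ext (O.cyc (a + A.deg g) (O.v g + A.deg g + 1 : ℤ) hZ)
      (e (O.unst t) b) n, ξ.comp y (Nat.add_comm 1 n) = x - x' :=
    Ext.contravariant_sequence_exact₃ (O.cycSeq_shortExact a hZ hg') _ (x - x') (by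
      change L₀ (x - x') = 0
      rw [map_sub, he, sub_self]) (n₀ := n) (Nat.add_comm 1 n)
  rw [← sub_add_cancel x x']
  refine add_mem ?_ hx'
  rw [← hy]
  change L₁ y ∈ _
  have hy' : y ∈ O.cycSpan t n (a + A.deg g) b (O.v g + A.deg g + 1) := h₁ ▸ Submodule.mem_top
  have : O.cycSpan t n (a + A.deg g) b (O.v g + A.deg g + 1) ≤
      (O.cycSpan t (n + 1) a b (O.v g)).comap L₁ := by
    refine Submodule.span_le.2 ?_
    rintro _ ⟨J, hJ, hJ', rfl⟩
    rw [SetLike.mem_coe, Submodule.mem_comap, hLL]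
    obtain ⟨u, hu⟩ := dualProd_succ (O.unst t) n (Fin.cons g J) a b
    rw [Fin.tail_cons, Fin.cons_zero] at hu
    -- Naturality of the connecting class along `cycSeqHom`: followed by the augmentation, it
    -- becomes the class dual to `g`.
    have key : ξ.comp (Ext.mk₀ (O.aug (a + A.deg g) hZ (O.v g + A.deg g + 1 : ℤ))) (add_zero 1) =
        (Ext.mk₀ (O.aug a hZ (O.v g : ℤ))).comp
          (dualClass (O.unst t) g a (a + A.deg g)) (zero_add 1) := by
      rw [dualClass_eq hg']
      exact ShortComplex.ShortExact.extClass_naturality (O.cycSeq_shortExact a hZ hg')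
        (extension_shortExact (O.unst t) g rfl hg') (O.cycSeqHom a hZ hg')
    have h3 : ξ.comp ((Ext.mk₀ (O.aug (a + A.deg g) hZ (O.v g + A.deg g + 1 : ℤ))).comp
          (dualProd (O.unst t) n J (a + A.deg g) b) (zero_add n)) (Nat.add_comm 1 n) =
        ((u : ℤ) : k) • (Ext.mk₀ (O.aug a hZ (O.v g : ℤ))).comp
          (dualProd (O.unst t) (n + 1) (Fin.cons g J) a b) (zero_add _) := by
      rw [hu, units_smul_eq (k := k), Ext.comp_smul, smul_smul, units_cast_mul_self, one_smul,
        ← Ext.comp_assoc _ _ _ (zero_add 1) (Nat.add_comm 1 n) (by omega), ← key,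
        Ext.comp_assoc_of_second_deg_zero]
    rw [h3]
    refine Submodule.smul_mem _ _ (Submodule.subset_span ⟨_, O.coadm_cons hJ fun h ↦ ?_, fun _ ↦
      le_rfl, rfl⟩)
    have := hJ' h
    unfold Inadm
    omega
  exact this hy'

theorem cycSpan_eq_top (t : ℤ) (n : ℕ) (a b m : ℤ) (hm : a - t ≤ m) :
    O.cycSpan t n a b m = ⊤ := by
  induction n generalizing a m with
  | zero => exact O.cycSpan_zero t a b m
  | succ n ih =>
    -- From `M` on, `ext_cyc_eq_zero` applies; the induction descends from there to `m`.
    obtain ⟨M, h1, h2, h3, h4⟩ : ∃ M : ℤ, 0 ≤ M ∧ b < a + M ∧ t < a + M ∧ a - t ≤ M :=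
      ⟨max 0 (max (b - a + 1) (t - a + 1) ⊔ (a - t)), by omega, by omega, by omega, by omega⟩
    have key : ∀ (N : ℕ) (m : ℤ), a - t ≤ m → M ≤ m + N → O.cycSpan t (n + 1) a b m = ⊤ := by
      intro N
      induction N with
      | zero =>
        intro m _ hm
        refine Submodule.eq_top_iff'.2 fun x ↦ ?_
        rw [O.ext_cyc_eq_zero n (by omega) (by omega) (by omega) x]
        exact zero_mem _
      | succ N ihN =>
        intro m hm hM
        have hg : O.v (O.v.symm m) = m := O.v.apply_symm_apply m
        have := O.cycSpan_step (t := t) (n := n) (a := a) (b := b) (g := O.v.symm m)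
          (by omega) (ih _ _ (by omega)) (ihN _ (by omega) (by push_cast at hM; omega))
        rwa [hg] at this
    exact key (M - m).toNat m hm (by omega)

/-- For the bound `a - t` nothing acts on the generator: smaller values vanish by instability, the
others by construction. The cyclic module is therefore `e_a` itself, and `cycSpan_eq_top` becomes a
statement about simple modules. -/
theorem span_dualProd (t : ℤ) (n : ℕ) (a b : ℤ) :
    Submodule.span k {y | ∃ J : Fin n → A.Op, O.Coadm J ∧ (∀ h : 0 < n, a - t ≤ O.v (J ⟨0, h⟩)) ∧
      y = dualProd (O.unst t) n J a b} = ⊤ := by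
  have hZ := O.compat_unst t
  let f := O.aug a hZ (a - t : ℤ)
  have h1 : Mono f := by
    refine grMod_mono _ fun c ↦ ?_
    refine (injective_iff_map_eq_zero (f.hom.app (vert A c)).hom).2 ?_
    rintro ⟨u, hu⟩ h
    change u ∈ O.piece (O.unst t) a (a - t : ℤ) c at hu
    refine Subtype.ext (Finsupp.support_eq_empty.1
      (Finset.eq_empty_of_forall_notMem fun w hw ↦ ?_))
    obtain ⟨⟨-, h1, h2⟩, h3⟩ := hu hw
    cases w with
    | nil =>
      have hc : c = a := by simpa using h3.symm
      have : u [] = 0 := congrFun h ⟨hc⟩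
      simp [this] at hw
    | cons g w =>
      have h4 : ¬ (O.v g + t < a) := h1.1
      have h5 := WithTop.coe_lt_coe.1 (h2 g (by simp))
      omega
  have h2 : Epi f := by
    refine grMod_epi _ fun c y ↦ ?_
    by_cases hc : c = a
    · subst hc
      refine ⟨((y : PLift (c = c) → k) ⟨rfl⟩) • (O.gen c (c - t : ℤ) hZ), funext fun q ↦ ?_⟩
      change (y : PLift (c = c) → k) ⟨rfl⟩ * (Finsupp.single ([] : List A.Op) (1 : k)) [] = _
      simp
    · exact ⟨0, (simple_eq_zero hc _).trans (simple_eq_zero hc _).symm⟩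
  have h3 : IsIso f := isIso_of_mono_of_epi f
  refine Submodule.eq_top_iff'.2 fun x ↦ ?_
  let L := Ext.bilinearCompOfLinear k (e (O.unst t) a) (O.cyc a (a - t : ℤ) hZ) (e (O.unst t) b)
    0 n n (zero_add _) (Ext.mk₀ (inv f))
  have hL : ∀ y, L ((Ext.mk₀ f).comp y (zero_add n)) = y := by
    intro y
    exact (Ext.mk₀_comp_mk₀_assoc _ _ _).trans (by rw [IsIso.inv_hom_id, Ext.mk₀_id_comp])
  have hx : (Ext.mk₀ f).comp x (zero_add n) ∈ O.cycSpan t n a b (a - t) := by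
    rw [O.cycSpan_eq_top t n a b _ le_rfl]
    trivial
  rw [← hL x]
  refine (Submodule.span_le (p := (Submodule.span k _).comap L)).2 ?_ hx
  rintro _ ⟨J, hJ, hJ', rfl⟩
  rw [SetLike.mem_coe, Submodule.mem_comap]
  refine Submodule.subset_span ⟨J, hJ, hJ', hL _⟩

end PBWSystem

end DyerLashof

end

noncomputable section

namespace DyerLashof

variable {k : Type} [Field k] {A : QuadraticPresentation k}

/-! ### The pairing with the Koszul complex -/

/-- The product of `dualProd` without its sign. -/
def rawProd (Z : A.Op → ℤ → Prop) : (n : ℕ) → (Fin n → A.Op) → (a b : ℤ) →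
    Ext (e Z a) (e Z b) n
  | 0, g, a, b => dualProd Z 0 g a b
  | n + 1, g, a, b =>
    (dualClass Z (g 0) a (a + A.deg (g 0))).comp
      (rawProd Z n (Fin.tail g) (a + A.deg (g 0)) b) (Nat.add_comm 1 n)

/-- The sign of `dualProd`. -/
def prodSign : (n : ℕ) → (Fin n → A.Op) → (a b : ℤ) → ℤˣ
  | 0, _, _, _ => 1
  | n + 1, g, a, b =>
    (a + A.deg (g 0) - b + n).negOnePow * prodSign n (Fin.tail g) (a + A.deg (g 0)) b

lemma dualProd_eq (Z : A.Op → ℤ → Prop) (n : ℕ) (g : Fin n → A.Op) (a b : ℤ) :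
    dualProd Z n g a b = ((prodSign n g a b : ℤ) : k) • rawProd Z n g a b := by
  induction n generalizing a with
  | zero => simp [prodSign, rawProd]
  | succ n ih =>
    rw [dualProd, mul, ih, units_smul_eq (k := k), Ext.comp_smul, smul_smul, rawProd, prodSign]
    push_cast
    simp

section

variable (V : Type*) [AddCommGroup V] [Module k V]

variable (A) in
/-- The formal sums, with coefficients in `V`, of words of length `n`, that are combinations of
relations at the places `i` and `i + 1`. -/
def relAt (n i : ℕ) (h : i + 1 < n) : Submodule k ((Fin n → A.Op) →₀ V) :=
  Submodule.span k {u | ∃ (w : Fin n → A.Op) (ρ : A.Op × A.Op →₀ k) (v : V), ρ ∈ A.rel ∧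
    u = ρ.sum fun q c ↦ Finsupp.single
      (Function.update (Function.update w ⟨i, by omega⟩ q.2) ⟨i + 1, h⟩ q.1) (c • v)}

variable (A) in
/-- The Koszul complex with coefficients in `V`. -/
def kos (n : ℕ) : Submodule k ((Fin n → A.Op) →₀ V) := ⨅ i, ⨅ h, relAt A V n i h

variable {V}

lemma mem_kos {n : ℕ} {μ : (Fin n → A.Op) →₀ V} :
    μ ∈ kos A V n ↔ ∀ i h, μ ∈ relAt A V n i h := by
  simp [kos, Submodule.mem_iInf]

variable {V' : Type*} [AddCommGroup V'] [Module k V']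

lemma kos_map {n : ℕ} {μ : (Fin n → A.Op) →₀ V} (hμ : μ ∈ kos A V n) (f : V →ₗ[k] V') :
    Finsupp.mapRange.linearMap f μ ∈ kos A V' n := by
  rw [mem_kos] at hμ ⊢
  intro i h
  refine (Submodule.span_le (p := (relAt A V' n i h).comap (Finsupp.mapRange.linearMap f))).2 ?_
    (hμ i h)
  rintro _ ⟨w, ρ, v, hρ, rfl⟩
  refine Submodule.subset_span ⟨w, ρ, f v, hρ, ?_⟩
  rw [Finsupp.sum, map_sum]
  exact Finset.sum_congr rfl fun q _ ↦ by simp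

end

/-- The differential of the Koszul complex: the first letter acts. -/
def kosD (M : Rep A) (n : ℕ) : ((Fin (n + 1) → A.Op) →₀ Tot M) →ₗ[k] ((Fin n → A.Op) →₀ Tot M) :=
  Finsupp.lsum k fun w ↦ Finsupp.lsingle (Fin.tail w) ∘ₗ totOp M (w 0)

@[simp] lemma kosD_single (M : Rep A) (n : ℕ) (w : Fin (n + 1) → A.Op) (m : Tot M) :
    kosD M n (Finsupp.single w m) = Finsupp.single (Fin.tail w) (totOp M (w 0) m) := by
  simp [kosD]

/-- Once the first letter is removed, relations at the places `i + 1` and `i + 2` become relations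
at the places `i` and `i + 1`. -/
lemma kosD_mem (M : Rep A) (n : ℕ) {μ : (Fin (n + 1) → A.Op) →₀ Tot M}
    (hμ : μ ∈ kos A (Tot M) (n + 1)) : kosD M n μ ∈ kos A (Tot M) n := by
  rw [mem_kos] at hμ ⊢
  intro i h
  refine (Submodule.span_le (p := (relAt A (Tot M) n i h).comap (kosD M n))).2 ?_
    (hμ (i + 1) (by omega))
  rintro _ ⟨w, ρ, v, hρ, rfl⟩
  refine Submodule.subset_span ⟨Fin.tail w, ρ, totOp M (w 0) v, hρ, ?_⟩
  rw [Finsupp.sum, map_sum]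
  refine Finset.sum_congr rfl fun q _ ↦ ?_
  rw [kosD_single, map_smul]
  congr 2
  · ext j
    simp only [Fin.tail, Function.update_apply, Fin.ext_iff, Fin.val_succ]
    simp

/-- Only the condition at place `0` is used: the first two letters act through a relation, hence by
zero on a module. -/
lemma kosD_kosD {Z : A.Op → ℤ → Prop} (O : AdemSystem A) {M : Rep A} (hM : isModule A Z M) (n : ℕ)
    {μ : (Fin (n + 2) → A.Op) →₀ Tot M} (hμ : μ ∈ kos A (Tot M) (n + 2)) :
    kosD M n (kosD M (n + 1) μ) = 0 := by
  rw [mem_kos] at hμ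
  refine (Submodule.span_le (p := LinearMap.ker (kosD M n ∘ₗ kosD M (n + 1)))).2 ?_
    (hμ 0 (by omega))
  rintro _ ⟨w, ρ, v, hρ, rfl⟩
  obtain ⟨D, hD⟩ := O.rel_deg hρ
  have key := totRel hM hρ hD v
  rw [SetLike.mem_coe, LinearMap.mem_ker, LinearMap.comp_apply, Finsupp.sum, map_sum, map_sum]
  have := congrArg (Finsupp.lsingle (R := k) (Fin.tail (Fin.tail w))) key
  rw [map_zero, Finsupp.sum, map_sum] at this
  refine Eq.trans (Finset.sum_congr rfl fun q _ ↦ ?_) this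
  rw [kosD_single, kosD_single, map_smul, map_smul, Finsupp.lsingle_apply]
  congr 1

lemma kosD_map {M N : Rep A} (f : M ⟶ N) (n : ℕ) (μ : (Fin (n + 1) → A.Op) →₀ Tot M) :
    kosD N n (Finsupp.mapRange.linearMap (totMap f) μ) =
      Finsupp.mapRange.linearMap (totMap f) (kosD M n μ) := by
  induction μ using Finsupp.induction_linear with
  | zero => simp
  | add u v hu hv => simp only [map_add, hu, hv]
  | single w m => simp [totMap_totOp]

/-- The coefficient of the basis vector of `e_a`. -/
def coef (Z : A.Op → ℤ → Prop) (a : ℤ) : Tot (e Z a).obj →ₗ[k] k where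
  toFun m := (m a : PLift (a = a) → k) ⟨rfl⟩
  map_add' _ _ := rfl
  map_smul' _ _ := rfl

lemma coef_totOp (Z : A.Op → ℤ → Prop) (a : ℤ) (g : A.Op) (m : Tot (e Z a).obj) :
    totOp (e Z a).obj g m = 0 := by
  funext c
  exact congrArg (fun φ : (e Z a).obj.obj (vert A (c - A.deg g)) ⟶ (e Z a).obj.obj (vert A c) ↦
    φ.hom (m (c - A.deg g))) (PBWSystem.act_simple (Z := Z) a g (c - A.deg g) c)

lemma act_lift_apply (φ : Degree A ⥤q ModuleCat.{0} k) (g : A.Op) {a b : ℤ} (h : a + A.deg g = b)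
    (x : φ.obj ⟨a⟩) :
    act (Paths.lift φ) g a b x = φ.map (X := ⟨a⟩) (Y := ⟨b⟩) ⟨g, h⟩ x := by
  rw [act_lift φ g h]
  rfl

/-- The map `φ` lifts to a map from the projective `S.X₂` to the extension dual to `g`. The
functional `l` is the coefficient of the second basis vector of that extension. As `g` is the only
operation acting there, `l` recovers `φ` after `g` and vanishes after all other operations. -/
lemma exists_connecting {Z : A.Op → ℤ → Prop} {S : ShortComplex (GrMod A Z)} (hS : S.ShortExact)
    [Projective S.X₂] {g : A.Op} {a : ℤ} (hg : ¬ Z g a) (φ : S.X₃ ⟶ e Z a) :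
    ∃ (ψ : S.X₁ ⟶ e Z (a + A.deg g)) (l : Tot S.X₂.obj →ₗ[k] k),
      (Ext.mk₀ φ).comp (dualClass Z g a (a + A.deg g)) (zero_add 1) =
        hS.extClass.comp (Ext.mk₀ ψ) (add_zero 1) ∧
      (∀ m, l (totMap S.f.hom m) = coef Z (a + A.deg g) (totMap ψ.hom m)) ∧
      (∀ p, l (totOp S.X₂.obj g p) = coef Z a (totMap φ.hom (totMap S.g.hom p))) ∧
      ∀ h ≠ g, ∀ p, l (totOp S.X₂.obj h p) = 0 := by
  classical
  have hE := extension_shortExact Z g (a := a) rfl hg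
  have := hE.mono_f
  have := hE.epi_g
  let τ : S.X₂ ⟶ (extension Z g (a := a) rfl hg).X₂ :=
    Projective.factorThru (X := (extension Z g (a := a) rfl hg).X₃) (S.g ≫ φ) (extension Z g (a := a) rfl hg).g
  have hτ : τ ≫ (extension Z g (a := a) rfl hg).g = S.g ≫ φ :=
    Projective.factorThru_comp (X := (extension Z g (a := a) rfl hg).X₃) (S.g ≫ φ) _
  have hz : (S.f ≫ τ) ≫ (extension Z g (a := a) rfl hg).g = 0 := by
    rw [Category.assoc, hτ]
    exact (S.zero_assoc φ).trans zero_comp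
  let ψ := hE.exact.lift (S.f ≫ τ) hz
  have hψ : ψ ≫ (extension Z g (a := a) rfl hg).f = S.f ≫ τ := hE.exact.lift_f _ _
  let T : S ⟶ extension Z g (a := a) rfl hg := { τ₁ := ψ, τ₂ := τ, τ₃ := φ, comm₁₂ := hψ,
                                                  comm₂₃ := hτ }
  let l' : Tot (extension Z g (a := a) rfl hg).X₂.obj →ₗ[k] k :=
    { toFun := fun m ↦ (m (a + A.deg g) : (PLift (a + A.deg g = a) → k) ×
        (PLift (a + A.deg g = a + A.deg g) → k)).2 ⟨rfl⟩
      map_add' := fun _ _ ↦ rfl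
      map_smul' := fun _ _ ↦ rfl }
  have hl : ∀ (h : A.Op) (m : Tot (extension Z g (a := a) rfl hg).X₂.obj),
      l' (totOp _ h m) = if h = g then (m a : (PLift (a = a) → k) ×
        (PLift (a = a + A.deg g) → k)).1 ⟨rfl⟩ else 0 := by
    intro h m
    by_cases hh : h = g
    · subst hh
      rw [if_pos rfl]
      have h1 : totOp (extension Z h (a := a) rfl hg).X₂.obj h m (a + A.deg h) =
        (extensionRep h (a := a) rfl).map (X := ⟨a⟩) (Y := ⟨a + A.deg h⟩) ⟨h, rfl⟩ (m a) := by
        rw [totOp_apply _ (a := a) rfl]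
        exact act_lift_apply _ _ _ _
      exact (congrArg (fun z : (PLift (a + A.deg h = a) → k) ×
        (PLift (a + A.deg h = a + A.deg h) → k) ↦ z.2 ⟨rfl⟩) h1).trans (dif_pos rfl)
    · rw [if_neg hh]
      have h1 : totOp (extension Z g (a := a) rfl hg).X₂.obj h m (a + A.deg g) =
        (extensionRep g (a := a) rfl).map (X := ⟨a + A.deg g - A.deg h⟩)
          (Y := ⟨a + A.deg g⟩) ⟨h, sub_add_cancel _ _⟩ (m _) := by
        exact act_lift_apply _ _ _ _
      exact (congrArg (fun z : (PLift (a + A.deg g = a) → k) ×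
        (PLift (a + A.deg g = a + A.deg g) → k) ↦ z.2 ⟨rfl⟩) h1).trans (dif_neg hh)
  refine ⟨ψ, l' ∘ₗ totMap τ.hom, ?_, fun m ↦ ?_, fun p ↦ ?_, fun h hh p ↦ ?_⟩
  · rw [dualClass_eq hg]
    exact (ShortComplex.ShortExact.extClass_naturality hS hE T).symm
  · exact (congrArg (fun φ : S.X₁ ⟶ (extension Z g (a := a) rfl hg).X₂ ↦ l' (totMap φ.hom m))
      hψ).symm
  · rw [LinearMap.comp_apply, totMap_totOp, hl, if_pos rfl]
    exact congrArg (fun φ : S.X₂ ⟶ e Z a ↦ coef Z a (totMap φ.hom p)) hτ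
  · rw [LinearMap.comp_apply, totMap_totOp, hl, if_neg hh]

lemma compat_stable (O : OpOrder A) : O.Compat (stable A) :=
  ⟨fun _ h ↦ h.elim, fun _ h ↦ h.elim⟩

/-- Dimension shifting is performed on the class and on the cycle at once. The first dual class of
each product is absorbed into a connecting class, which leaves shorter products on the kernel `N`.
The cycle is lifted to the projective, and its Koszul boundary lies in `N`. The functionals of
`exists_connecting` show that the value of the pairing does not change. -/
lemma pairing_step (O : PBWSystem A) (n : ℕ) (M : GrMod A (stable A)) {T : Type} [Fintype T]
    {a : T → ℤ} {b : ℤ} (φ : ∀ t, M ⟶ e (stable A) (a t)) {J : T → Fin (n + 1) → A.Op} {c : T → k}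
    (h0 : ∑ t, c t • (Ext.mk₀ (φ t)).comp (rawProd (stable A) (n + 1) (J t) (a t) b)
      (zero_add _) = 0) {μ : (Fin (n + 1) → A.Op) →₀ Tot M.obj}
    (hμ : μ ∈ kos A (Tot M.obj) (n + 1)) (hd : kosD M.obj n μ = 0) :
    ∃ (N P : GrMod A (stable A)) (i : N ⟶ P) (_ : Mono i) (_ : Projective P)
      (ψ : ∀ t, N ⟶ e (stable A) (a t + A.deg (J t 0))) (y : Ext P (e (stable A) b) n)
      (μ' : (Fin n → A.Op) →₀ Tot N.obj) (ν : (Fin (n + 1) → A.Op) →₀ Tot P.obj),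
      ∑ t, c t • (Ext.mk₀ (ψ t)).comp (rawProd (stable A) n (Fin.tail (J t))
        (a t + A.deg (J t 0)) b) (zero_add n) = (Ext.mk₀ i).comp y (zero_add n) ∧
      ν ∈ kos A (Tot P.obj) (n + 1) ∧
      Finsupp.mapRange.linearMap (totMap i.hom) μ' = kosD P.obj n ν ∧
      μ' ∈ kos A (Tot N.obj) n ∧
      ∀ t, coef (stable A) (a t + A.deg (J t 0)) (totMap (ψ t).hom (μ' (Fin.tail (J t)))) =
        coef (stable A) (a t) (totMap (φ t).hom (μ (J t))) := by
  classical
  obtain ⟨⟨P, f, hf⟩⟩ := (O.enoughProjectives (compat_stable O.toOpOrder)).presentation M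
  have hS := PBWSystem.kernel_shortExact f
  let S := ShortComplex.mk (kernel.ι f) f (kernel.condition f)
  have : Projective S.X₂ := ‹Projective P›
  choose ψ l h1 h2 h3 h4 using fun t ↦
    exists_connecting (S := S) hS (g := J t 0) (a := a t) not_false (φ t)
  let ξ : Ext M (kernel f) 1 := hS.extClass
  have e1 : ξ.comp (∑ t, c t • (Ext.mk₀ (ψ t)).comp (rawProd (stable A) n (Fin.tail (J t))
      (a t + A.deg (J t 0)) b) (zero_add n)) (Nat.add_comm 1 n) = 0 := by
    rw [← h0, Ext.comp_sum]
    refine Finset.sum_congr rfl fun t _ ↦ ?_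
    rw [Ext.comp_smul, rawProd]
    congr 1
    rw [← Ext.comp_assoc _ _ _ (zero_add 1) (Nat.add_comm 1 n) (by omega), h1 t,
      Ext.comp_assoc_of_second_deg_zero]
  obtain ⟨y, hy⟩ := Ext.contravariant_sequence_exact₁ hS _ _ (Nat.add_comm 1 n) e1
  have hsur : LinearMap.range (totMap f.hom) = ⊤ := by
    refine LinearMap.range_eq_top.2 fun m ↦ ?_
    choose p hp using fun c ↦ app_surjective f c (m c)
    exact ⟨p, funext hp⟩
  -- Linear sections suffice: the Koszul condition concerns only the words, so it is preserved by
  -- any linear map of coefficients.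
  obtain ⟨s, hs⟩ := LinearMap.exists_rightInverse_of_surjective _ hsur
  have hinj : LinearMap.ker (totMap (kernel.ι f).hom) = ⊥ := by
    refine LinearMap.ker_eq_bot.2 fun m m' h ↦ funext fun c ↦ ?_
    exact app_injective (kernel.ι f) c (congrFun h c)
  obtain ⟨r, hr⟩ := LinearMap.exists_leftInverse_of_injective _ hinj
  let ν := Finsupp.mapRange.linearMap s μ
  have hν : Finsupp.mapRange.linearMap (totMap f.hom) ν = μ := by
    change (Finsupp.mapRange.linearMap _ ∘ₗ Finsupp.mapRange.linearMap s) μ = μ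
    rw [← Finsupp.mapRange.linearMap_comp, hs, Finsupp.mapRange.linearMap_id]
    rfl
  have hνk : ν ∈ kos A (Tot P.obj) (n + 1) := kos_map hμ s
  have h5 : Finsupp.mapRange.linearMap (totMap (kernel.ι f).hom)
      (Finsupp.mapRange.linearMap r (kosD P.obj n ν)) = kosD P.obj n ν := by
    ext1 w
    have h6 : totMap f.hom (kosD P.obj n ν w) = 0 := by
      have := DFunLike.congr_fun (kosD_map f.hom n ν) w
      rw [hν, hd] at this
      exact this.symm
    obtain ⟨m, hm⟩ : ∃ m, totMap (kernel.ι f).hom m = kosD P.obj n ν w := by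
      choose m hm using fun c ↦ exact_pointwise hS c (kosD P.obj n ν w c) (congrFun h6 c)
      exact ⟨m, funext hm⟩
    simp only [Finsupp.mapRange.linearMap_apply, Finsupp.mapRange_apply]
    rw [← hm]
    exact congrArg (totMap (kernel.ι f).hom) (LinearMap.congr_fun hr m)
  refine ⟨kernel f, P, kernel.ι f, inferInstance, inferInstance, ψ, y,
    Finsupp.mapRange.linearMap r (kosD P.obj n ν), ν, hy.symm, hνk, h5,
    kos_map (kosD_mem _ _ hνk) r, fun t ↦ ?_⟩
  rw [← h2 t]
  have h7 := DFunLike.congr_fun h5 (Fin.tail (J t))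
  simp only [Finsupp.mapRange.linearMap_apply, Finsupp.mapRange_apply] at h7 ⊢
  refine (congrArg (l t) h7).trans ?_
  -- Words with the same tail as `J t` but another first letter do not contribute, because `l t`
  -- vanishes on the images of all operations other than `J t 0`.
  have h8 : ∀ ν : (Fin (n + 1) → A.Op) →₀ Tot P.obj, l t (kosD P.obj n ν (Fin.tail (J t))) =
      coef (stable A) (a t) (totMap (φ t).hom (totMap f.hom (ν (J t)))) := by
    intro ν
    induction ν using Finsupp.induction_linear with
    | zero => simp
    | add u v hu hv => simp only [map_add, Finsupp.add_apply, hu, hv]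
    | single w p =>
      rw [kosD_single, Finsupp.single_apply, Finsupp.single_apply]
      by_cases hw : w = J t
      · subst hw
        rw [if_pos rfl, if_pos rfl]
        exact h3 t p
      · rw [if_neg hw, map_zero, map_zero, map_zero]
        split_ifs with h
        · refine h4 t _ (fun H ↦ hw ?_) p
          rw [← Fin.cons_self_tail w, ← Fin.cons_self_tail (J t), H, h]
        · rw [map_zero]
  rw [h8]
  have h9 := DFunLike.congr_fun hν (J t)
  simp only [Finsupp.mapRange.linearMap_apply, Finsupp.mapRange_apply] at h9
  rw [h9]

lemma rawProd_zero_coef {Z : A.Op → ℤ → Prop} (g : Fin 0 → A.Op) {a b : ℤ} (h : a = b)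
    {N : GrMod A Z} (ψ : N ⟶ e Z a) : ∃ ψ' : N ⟶ e Z b,
      (Ext.mk₀ ψ).comp (rawProd Z 0 g a b) (zero_add 0) = Ext.mk₀ ψ' ∧
        ∀ m, coef Z b (totMap ψ'.hom m) = coef Z a (totMap ψ.hom m) := by
  subst h
  refine ⟨ψ, ?_, fun _ ↦ rfl⟩
  rw [show rawProd Z 0 g a a = Ext.mk₀ (𝟙 _) from dif_pos rfl, Ext.comp_mk₀_id]

/-- After the shifts, a class of degree zero on the kernel remains that extends to a projective. The
remaining cycle is a Koszul boundary there, and such a boundary maps to zero in `e_b`, whose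
operations are trivial. Before the last shift, the obstruction class `y` lives on a projective in
positive degree and is zero. -/
theorem pairing (O : PBWSystem A) (n : ℕ) (M : GrMod A (stable A)) {T : Type} [Fintype T]
    {a : T → ℤ} {b : ℤ} (φ : ∀ t, M ⟶ e (stable A) (a t)) {J : T → Fin (n + 1) → A.Op} {c : T → k}
    (hdeg : ∀ t, a t + ∑ i, A.deg (J t i) = b)
    (h0 : ∑ t, c t • (Ext.mk₀ (φ t)).comp (rawProd (stable A) (n + 1) (J t) (a t) b)
      (zero_add _) = 0) {μ : (Fin (n + 1) → A.Op) →₀ Tot M.obj}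
    (hμ : μ ∈ kos A (Tot M.obj) (n + 1)) (hd : kosD M.obj n μ = 0) :
    ∑ t, c t * coef (stable A) (a t) (totMap (φ t).hom (μ (J t))) = 0 := by
  induction n generalizing M a with
  | zero =>
    obtain ⟨N, P, i, hi, hP, ψ, y, μ', ν, h1, -, h2, -, h3⟩ := pairing_step O 0 M φ h0 hμ hd
    obtain ⟨y, rfl⟩ := Ext.mk₀_bijective _ _ |>.2 y
    choose ψ' h4 h5 using fun t ↦ rawProd_zero_coef (Fin.tail (J t))
      (by simpa using hdeg t : a t + A.deg (J t 0) = b) (ψ t)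
    have h6 : ∑ t, c t • ψ' t = i ≫ y := by
      refine Ext.mk₀_bijective _ _ |>.1 ?_
      rw [Ext.mk₀_sum, ← Ext.mk₀_comp_mk₀, ← h1]
      exact Finset.sum_congr rfl fun t _ ↦ by rw [Ext.mk₀_smul, h4 t]
    let m := μ' ![]
    have hm : ∀ t, μ' (Fin.tail (J t)) = m := fun t ↦ congrArg μ' (Subsingleton.elim _ _)
    have h7 : ∑ t, c t * coef (stable A) b (totMap (ψ' t).hom m) =
        coef (stable A) b (totMap (i ≫ y).hom m) := by
      let L : (N ⟶ e (stable A) b) →ₗ[k] k :=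
        { toFun := fun f ↦ coef (stable A) b (totMap f.hom m)
          map_add' := fun _ _ ↦ rfl
          map_smul' := fun _ _ ↦ rfl }
      change ∑ t, c t • L (ψ' t) = L (i ≫ y)
      rw [← h6, map_sum]
      simp
    -- The element `m` becomes a Koszul boundary in `P`, and boundaries are natural, so its image
    -- under `y` is a boundary with coefficients in `e_b`.
    have h8 : totMap (i ≫ y).hom m = 0 := by
      change totMap y.hom (totMap i.hom m) = 0
      have h9 := DFunLike.congr_fun h2 ![]
      simp only [Finsupp.mapRange.linearMap_apply, Finsupp.mapRange_apply] at h9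
      refine (congrArg (totMap y.hom) h9).trans ?_
      have h10 := DFunLike.congr_fun (kosD_map y.hom 0 ν) ![]
      simp only [Finsupp.mapRange.linearMap_apply, Finsupp.mapRange_apply] at h10
      rw [← h10]
      have : ∀ ν, kosD (e (stable A) b).obj 0 ν = 0 := by
        intro ν
        induction ν using Finsupp.induction_linear with
        | zero => simp
        | add u v hu hv => rw [map_add, hu, hv, add_zero]
        | single w p => rw [kosD_single, coef_totOp, Finsupp.single_zero]
      rw [this]
      rfl
    rw [h8, map_zero] at h7
    rw [← h7]
    exact Finset.sum_congr rfl fun t _ ↦ by rw [← h3 t, hm, h5]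
  | succ n ih =>
    obtain ⟨N, P, i, hi, hP, ψ, y, μ', ν, h1, hν, h2, hμ', h3⟩ :=
      pairing_step O (n + 1) M φ h0 hμ hd
    rw [Ext.eq_zero_of_projective y, Ext.comp_zero] at h1
    have hdeg' : ∀ t, a t + A.deg (J t 0) + ∑ i, A.deg (Fin.tail (J t) i) = b := fun t ↦ by
      refine (add_assoc _ _ _).trans (Eq.trans ?_ (hdeg t))
      rw [Fin.sum_univ_succ fun i ↦ A.deg (J t i)]
      rfl
    have hd' : kosD N.obj n μ' = 0 := by
      have h4 := kosD_map i.hom n μ'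
      rw [h2, kosD_kosD O.toAdemSystem P.property n hν] at h4
      ext1 w
      have h5 := (DFunLike.congr_fun h4 w).symm
      simp only [Finsupp.mapRange.linearMap_apply, Finsupp.mapRange_apply] at h5
      exact funext fun c ↦ app_injective i c ((congrFun h5 c).trans (map_zero _).symm)
    rw [← ih N ψ hdeg' h1 hμ' hd']
    exact Finset.sum_congr rfl fun t _ ↦ by rw [← h3 t]

end DyerLashof

end

noncomputable section

namespace DyerLashof

variable {k : Type} [Field k] {A : QuadraticPresentation k}

/-! ### Self-dual systems -/

/-- A rewriting system whose relations are, up to signs, orthogonal to their images under the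
involution `star`, and that has triangular elements in the Koszul complex. -/
structure KoszulSystem (A : QuadraticPresentation k) extends AdemSystem A where
  star : A.Op → A.Op
  star_star : ∀ g, star (star g) = g
  inadm_star : ∀ h g, toOpOrder.Inadm (star h) (star g) ↔ ¬ toOpOrder.Inadm h g
  deg_star : ∀ g, A.deg (star g) = -A.deg g - 1
  sgn : ℕ → A.Op → k
  sgn_ne : ∀ i g, sgn i g ≠ 0
  dual : ∀ ρ ∈ A.rel, ∀ ρ' ∈ A.rel, ∀ i : ℕ,
    ρ.sum (fun q c ↦ c * (sgn i q.2 * sgn (i + 1) q.1) * ρ' (star q.1, star q.2)) = 0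
  wt : ∀ {n : ℕ}, (Fin n → A.Op) → ℤ
  koszul : ∀ {n : ℕ} (J : Fin n → A.Op), toOpOrder.Coadm J → ∃ κ ∈ kos A k n, κ J ≠ 0 ∧
    ∀ J', κ J' ≠ 0 → J' ≠ J → wt J' < wt J
  opp_sign : ∀ ρ ∈ A.rel, ∃ c : k, ∀ q ∈ ρ.support,
    (((A.deg q.1 * A.deg q.2).negOnePow * (A.deg q.1).negOnePow : ℤˣ) : ℤ) =
      c * (sgn 0 q.2 * sgn 1 q.1)

namespace KoszulSystem

variable (O : KoszulSystem A)

/-- The function on words given by an element of the Koszul complex. -/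
def ev {n : ℕ} (κ : (Fin n → A.Op) →₀ k) (w : Fin n → A.Op) : k :=
  (∏ i : Fin n, O.sgn i (w i)) * κ fun i ↦ O.star (w i)

/-- All letters outside the two places are fixed. If they do not match under `star`, every term
vanishes; if they do, the sum is the orthogonality `dual` of two relations multiplied by a common
factor. -/
lemma sum_ev_eq_zero {n i : ℕ} (h : i + 1 < n) {κ : (Fin n → A.Op) →₀ k} (hκ : κ ∈ relAt A k n i h)
    {ρ : A.Op × A.Op →₀ k} (hρ : ρ ∈ A.rel) (w : Fin n → A.Op) :
    ρ.sum (fun q c ↦ c * O.ev κ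
      (Function.update (Function.update w ⟨i, by omega⟩ q.2) ⟨i + 1, h⟩ q.1)) = 0 := by
  classical
  let j₀ : Fin n := ⟨i, by omega⟩
  let j₁ : Fin n := ⟨i + 1, h⟩
  have hj : j₀ ≠ j₁ := by simp [j₀, j₁, Fin.ext_iff]
  let up : (Fin n → A.Op) → A.Op × A.Op → Fin n → A.Op := fun w q ↦
    Function.update (Function.update w j₀ q.2) j₁ q.1
  have up₀ : ∀ w q, up w q j₀ = q.2 := fun w q ↦ by simp [up, hj]
  have up₁ : ∀ w q, up w q j₁ = q.1 := fun w q ↦ by simp [up]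
  have up₂ : ∀ w q j, j ≠ j₀ → j ≠ j₁ → up w q j = w j := fun w q j h h' ↦ by simp [up, h, h']
  change ρ.sum (fun q c ↦ c * O.ev κ (up w q)) = 0
  refine Submodule.span_induction
    (p := fun κ _ ↦ ρ.sum (fun q c ↦ c * O.ev κ (up w q)) = 0) ?_ ?_ ?_ ?_ hκ
  · rintro _ ⟨w', ρ', v, hρ', rfl⟩
    let R : k := ∏ j ∈ (Finset.univ.erase j₀).erase j₁, O.sgn j (w j)
    have hs : ∀ q, ∏ j : Fin n, O.sgn j (up w q j) = O.sgn i q.2 * O.sgn (i + 1) q.1 * R := by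
      intro q
      rw [← Finset.mul_prod_erase _ _ (Finset.mem_univ j₀),
        ← Finset.mul_prod_erase _ _ (Finset.mem_erase.2 ⟨hj.symm, Finset.mem_univ j₁⟩), up₀, up₁,
        ← mul_assoc]
      congr 1
      refine Finset.prod_congr rfl fun j hj ↦ ?_
      simp only [Finset.mem_erase, Finset.mem_univ, and_true] at hj
      rw [up₂ _ _ _ hj.2 hj.1]
    have hκ' : ∀ q, (ρ'.sum fun q c ↦ Finsupp.single (up w' q) (c • v))
        (fun j ↦ O.star (up w q j)) =
        if ∀ j, j ≠ j₀ → j ≠ j₁ → w' j = O.star (w j) then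
          ρ' (O.star q.1, O.star q.2) * v else 0 := by
      intro q
      rw [Finsupp.sum, Finsupp.finsetSum_apply]
      split_ifs with hC
      · have hq' : ∀ q', up w' q' = (fun j ↦ O.star (up w q j)) ↔
            q' = (O.star q.1, O.star q.2) := by
          intro q'
          constructor
          · intro H
            refine Prod.ext ?_ ?_
            · simpa only [up₁] using congrFun H j₁
            · simpa only [up₀] using congrFun H j₀
          · rintro rfl
            funext j
            by_cases h0 : j = j₀
            · subst h0
              simp only [up₀]
            · by_cases h1 : j = j₁
              · subst h1
                simp only [up₁]
              · rw [up₂ _ _ _ h0 h1, up₂ _ _ _ h0 h1, hC j h0 h1]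
        simp only [Finsupp.single_apply, hq']
        rw [Finset.sum_ite_eq']
        split_ifs with hm
        · rfl
        · rw [Finsupp.notMem_support_iff.1 hm, zero_mul]
      · push Not at hC
        obtain ⟨j, h0, h1, h2⟩ := hC
        refine Finset.sum_eq_zero fun q' _ ↦ Finsupp.single_eq_of_ne fun H ↦ h2 ?_
        have := congrFun H j
        simp only [up₂ _ _ _ h0 h1] at this
        exact this.symm
    have key := O.dual ρ hρ ρ' hρ' i
    by_cases hC : ∀ j, j ≠ j₀ → j ≠ j₁ → w' j = O.star (w j)
    · refine Eq.trans ?_ ((congrArg (fun z ↦ z * (R * v)) key).trans (zero_mul _))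
      rw [Finsupp.sum_mul]
      refine Finset.sum_congr rfl fun q _ ↦ ?_
      change ρ q * ((∏ j : Fin n, O.sgn j (up w q j)) * _) = _
      rw [hs]
      refine (congrArg (fun z ↦ ρ q * (O.sgn i q.2 * O.sgn (i + 1) q.1 * R * z))
        ((hκ' q).trans (if_pos hC))).trans ?_
      ring
    · refine Finset.sum_eq_zero fun q _ ↦ ?_
      change ρ q * ((∏ j : Fin n, O.sgn j (up w q j)) * _) = _
      refine (congrArg (fun z ↦ ρ q * (_ * z)) ((hκ' q).trans (if_neg hC))).trans ?_
      rw [mul_zero, mul_zero]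
  · simp [ev]
  · intro κ κ' _ _ h1 h2
    simp only [ev, Finsupp.add_apply, mul_add] at h1 h2 ⊢
    rw [Finsupp.sum, Finset.sum_add_distrib]
    exact (congrArg₂ (· + ·) h1 h2).trans (add_zero 0)
  · intro r κ _ h1
    simp only [ev, Finsupp.smul_apply, smul_eq_mul] at h1 ⊢
    refine Eq.trans ?_ ((congrArg (r * ·) h1).trans (mul_zero r))
    rw [Finsupp.sum, Finsupp.sum, Finset.mul_sum]
    exact Finset.sum_congr rfl fun q _ ↦ by ring

/-- The functional on formal sums of words given by an element of the Koszul complex. -/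
def evList {n : ℕ} (κ : (Fin n → A.Op) →₀ k) : (List A.Op →₀ k) →ₗ[k] k :=
  Finsupp.linearCombination k fun w : List A.Op ↦
    if h : w.length = n then O.ev κ fun i ↦ w.get (i.cast h.symm) else 0

lemma evList_relSpan {n : ℕ} {κ : (Fin n → A.Op) →₀ k} (hκ : κ ∈ kos A k n) {u : List A.Op →₀ k}
    (hu : u ∈ relSpan A) : O.evList κ u = 0 := by
  refine (Submodule.span_le (p := LinearMap.ker (O.evList κ))).2 ?_ hu
  rintro _ ⟨x, y, ρ, hρ, rfl⟩
  rw [SetLike.mem_coe, LinearMap.mem_ker, ins_eq, Finsupp.sum, map_sum]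
  obtain ⟨g, -, -⟩ := O.rel_lead ρ hρ
  by_cases hn : x.length + (y.length + 2) = n
  · have hi : x.length + 1 < n := by omega
    -- The two letters `g` are placeholders, overwritten by the letters of the relation.
    have key := O.sum_ev_eq_zero hi (mem_kos.1 hκ _ hi) hρ
      fun i ↦ (x ++ g :: g :: y).get (i.cast (by simp [← hn]))
    refine Eq.trans (Finset.sum_congr rfl fun q _ ↦ ?_) key
    rw [evList, Finsupp.linearCombination_single, dif_pos (by simp [← hn]), smul_eq_mul]
    congr 2
    funext i
    simp only [Function.update_apply, Fin.ext_iff, List.get_eq_getElem, Fin.val_cast]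
    split_ifs with h1 h2
    · simp [h1]
    · simp [h2]
    · rcases lt_or_ge i.1 x.length with h3 | h3
      · rw [List.getElem_append_left h3, List.getElem_append_left h3]
      · rw [List.getElem_append_right h3, List.getElem_append_right h3]
        obtain ⟨d, hd⟩ : ∃ d, i.1 - x.length = d + 2 := ⟨i.1 - x.length - 2, by omega⟩
        simp only [hd, List.getElem_cons_succ]
  · refine Finset.sum_eq_zero fun q _ ↦ ?_
    rw [evList, Finsupp.linearCombination_single, dif_neg (by simpa using hn), smul_zero]

lemma coadm_of_adm {w : List A.Op} (h : O.Adm w) :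
    O.Coadm fun i : Fin w.length ↦ O.star (w.get i) := by
  intro i hi
  rw [O.inadm_star]
  exact List.isChain_iff_getElem.1 h i hi

/-- Among the admissible words of a fixed length in `u`, choose one whose image under `star` has
least weight. That image is coadmissible, hence the leading word of some `κ`. All other words of `κ`
have smaller weight, so the functional of `κ` sees only the chosen word, although it must vanish on
`u`. -/
theorem indep {u : List A.Op →₀ k} (hu : u ∈ relSpan A)
    (hu' : u ∈ Finsupp.supported k k {w | O.Adm w}) : u = 0 := by
  classical
  by_contra h0
  obtain ⟨w₀, hw₀⟩ := Finsupp.support_nonempty_iff.2 h0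
  let n := w₀.length
  let J : ∀ w : List A.Op, w.length = n → Fin n → A.Op := fun w h i ↦
    O.star (w.get (i.cast h.symm))
  let S := u.support.filter fun w ↦ w.length = n
  let f : List A.Op → ℤ := fun w ↦ if h : w.length = n then O.wt (J w h) else 0
  obtain ⟨w₁, hw₁, hmin⟩ := Finset.exists_min_image S f ⟨w₀, by simp [S, n] at hw₀ ⊢; exact hw₀⟩
  obtain ⟨h1, hl⟩ := Finset.mem_filter.1 hw₁
  have hJ : O.Coadm (J w₁ hl) := by
    have := O.coadm_of_adm (hu' h1)
    intro i hi
    exact this i (by omega)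
  obtain ⟨κ, hκ, h2, h3⟩ := O.koszul _ hJ
  have h4 := O.evList_relSpan hκ hu
  rw [evList, Finsupp.linearCombination_apply, Finsupp.sum, Finset.sum_eq_single w₁,
    dif_pos hl] at h4
  · refine (mul_ne_zero (Finsupp.mem_support_iff.1 h1) (mul_ne_zero (b := κ (J w₁ hl)) ?_ h2)) h4
    exact Finset.prod_ne_zero_iff.2 fun i _ ↦ O.sgn_ne _ _
  · intro w hw hne
    split_ifs with h
    · have : κ (J w h) = 0 := by
        by_contra H
        have hJJ : J w h ≠ J w₁ hl := by
          intro e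
          refine hne (List.ext_get (h.trans hl.symm) fun i hi hi' ↦ ?_)
          have := congrArg O.star (congrFun e ⟨i, by omega⟩)
          simp only [J, O.star_star] at this
          exact this
        have h5 := h3 _ H hJJ
        have h6 := hmin w (Finset.mem_filter.2 ⟨hw, h⟩)
        simp only [f, dif_pos hl, dif_pos h] at h6
        omega
      rw [ev]
      refine (congrArg (fun z ↦ u w • (_ * z)) this).trans ?_
      simp
    · simp
  · exact fun h ↦ (h h1).elim

/-- The words form a Poincaré-Birkhoff-Witt basis. -/
def toPBW : PBWSystem A := { O.toAdemSystem with indep := fun _ h h' ↦ O.indep h h' }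

end KoszulSystem

end DyerLashof

end

noncomputable section

namespace DyerLashof

variable {k : Type} [Field k] {A : QuadraticPresentation k}

/-! ### Bases of `Ext` -/

lemma dualProd_eq_zero_of_deg (Z : A.Op → ℤ → Prop) {n : ℕ} {J : Fin n → A.Op} {a b : ℤ}
    (h : a + ∑ i, A.deg (J i) ≠ b) : dualProd Z n J a b = 0 := by
  induction n generalizing a with
  | zero => exact dif_neg (by simpa using h)
  | succ n ih =>
    rw [dualProd, mul, ih, Ext.comp_zero, smul_zero]
    rw [Fin.sum_univ_succ, ← add_assoc] at h
    exact h

lemma extToStable_dualClass {Z : A.Op → ℤ → Prop} {g : A.Op} {a : ℤ} (hg : ¬ Z g a) :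
    extToStable Z 1 a (a + A.deg g) (dualClass Z g a (a + A.deg g)) =
      dualClass (stable A) g a (a + A.deg g) := by
  rw [dualClass_eq hg, dualClass_eq (Z := stable A) not_false]
  exact Ext.mapExactFunctor_extClass (toStable Z) (extension_shortExact Z g rfl hg)

lemma extToStable_dualProd {Z : A.Op → ℤ → Prop} {n : ℕ} {J : Fin n → A.Op} {a b : ℤ}
    (h : Allowed Z a (List.ofFn J)) :
    extToStable Z n a b (dualProd Z n J a b) = dualProd (stable A) n J a b := by
  induction n generalizing a with
  | zero =>
    by_cases hab : a = b
    · subst hab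
      rw [show dualProd Z 0 J a a = Ext.mk₀ (𝟙 _) from dif_pos rfl,
        show dualProd (stable A) 0 J a a = Ext.mk₀ (𝟙 _) from dif_pos rfl]
      exact (Ext.mapExactFunctor_mk₀ (toStable Z) (𝟙 (e Z a))).trans
        (congrArg Ext.mk₀ ((toStable Z).map_id _))
    · rw [show dualProd Z 0 J a b = 0 from dif_neg hab,
        show dualProd (stable A) 0 J a b = 0 from dif_neg hab, map_zero]
  | succ n ih =>
    rw [List.ofFn_succ] at h
    have h1 := ih (J := Fin.tail J) (a := a + A.deg (J 0)) h.2
    rw [dualProd, mul, units_smul_eq (k := k), map_smul, dualProd, mul, units_smul_eq (k := k),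
      ← h1, ← extToStable_dualClass h.1]
    congr 1
    exact Ext.mapExactFunctor_comp (toStable Z) _ _ _

/-- Inadmissibility of consecutive letters carries the bound on the first letter to all later ones,
so only the first letter enters the instability condition. -/
lemma OpOrder.allowed_of_coadm (O : OpOrder A) {t : ℤ} {n : ℕ} {J : Fin n → A.Op} {a : ℤ}
    (hJ : O.Coadm J) (h : ∀ h : 0 < n, a - t ≤ O.v (J ⟨0, h⟩)) :
    Allowed (O.unst t) a (List.ofFn J) := by
  induction n generalizing a with
  | zero => simp [Allowed]
  | succ n ih =>
    have h0 := h (Nat.succ_pos n)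
    change a - t ≤ O.v (J 0) at h0
    rw [List.ofFn_succ]
    refine ⟨by unfold unst; omega, ih (fun i hi ↦ hJ (i + 1) (by omega)) fun hn ↦ ?_⟩
    have h1 := hJ 0 (by omega)
    unfold Inadm at h1
    change O.v (J 0) + A.deg (J 0) < _ at h1
    change a + A.deg (J 0) - t ≤ O.v (J ⟨0 + 1, _⟩)
    omega

/-- Increasing `t` weakens the vanishing condition. This reduces statements about products over the
big algebra to unstable modules, where `Ext` is under control. -/
lemma OpOrder.exists_allowed (O : OpOrder A) {n : ℕ} (J : Fin n → A.Op) (a : ℤ) :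
    ∃ t, Allowed (O.unst t) a (List.ofFn J) := by
  have mono : ∀ (w : List A.Op) (a t t' : ℤ), t ≤ t' → Allowed (O.unst t) a w →
      Allowed (O.unst t') a w := by
    intro w
    induction w with
    | nil => exact fun _ _ _ _ _ ↦ trivial
    | cons g w ih =>
      intro a t t' h h'
      refine ⟨fun H ↦ h'.1 ?_, ih _ _ _ h h'.2⟩
      unfold unst at *
      omega
  generalize List.ofFn J = w
  induction w generalizing a with
  | nil => exact ⟨0, trivial⟩
  | cons g w ih =>
    obtain ⟨t, ht⟩ := ih (a + A.deg g)
    refine ⟨max t (a - O.v g), ?_, mono _ _ _ _ (le_max_left _ _) ht⟩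
    unfold unst
    omega

/-- The class given by a formal sum of words. -/
def wordExt (Z : A.Op → ℤ → Prop) (n : ℕ) (a b : ℤ) :
    ((Fin n → A.Op) →₀ k) →ₗ[k] Ext (e Z a) (e Z b) n :=
  Finsupp.linearCombination k fun J ↦ dualProd Z n J a b

/-- The pairing of formal sums of words with the Koszul complex. -/
def pair (n : ℕ) (a b : ℤ) (κ : (Fin n → A.Op) →₀ k) : ((Fin n → A.Op) →₀ k) →ₗ[k] k :=
  Finsupp.linearCombination k fun J ↦ ((prodSign n J a b : ℤ) : k) * κ J

/-- This is `pairing` for `M = e_a`: the operations are zero there, so every `κ` times the basis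
vector is a cycle. Words of length zero are treated apart since `pairing` starts in length one. -/
lemma pair_eq_zero (O : PBWSystem A) {n : ℕ} {a b : ℤ} {u : (Fin n → A.Op) →₀ k}
    (hu : u ∈ Finsupp.supported k k {J | a + ∑ i, A.deg (J i) = b})
    (h : wordExt (stable A) n a b u = 0) {κ : (Fin n → A.Op) →₀ k} (hκ : κ ∈ kos A k n) :
    pair n a b κ u = 0 := by
  classical
  cases n with
  | zero =>
    have hu0 : u = 0 := by
      refine Finsupp.ext fun J ↦ ?_
      by_contra hJ
      have hab : a + ∑ i, A.deg (J i) = b := hu (Finsupp.mem_support_iff.2 hJ)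
      obtain rfl : a = b := by simpa using hab
      have h1 : u = Finsupp.single J (u J) := by
        refine Finsupp.ext fun J' ↦ ?_
        rw [Subsingleton.elim J' J, Finsupp.single_eq_same]
      rw [h1, wordExt, Finsupp.linearCombination_single,
        show dualProd (stable A) 0 J a a = Ext.mk₀ (𝟙 _) from dif_pos rfl,
        ← Ext.mk₀_smul, Ext.mk₀_eq_zero_iff] at h
      have h2 := congrArg (fun f : e (stable A) a ⟶ e (stable A) a ↦
        (f.hom.app (vert A a) (fun _ ↦ (1 : k)) : PLift (a = a) → k) ⟨rfl⟩) h
      refine hJ ((mul_one _).symm.trans h2)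
    rw [hu0, map_zero]
  | succ n =>
    let m : Tot (e (stable A) a).obj := Pi.single a ((fun _ ↦ (1 : k)) : PLift (a = a) → k)
    have hm : coef (stable A) a m = 1 :=
      congrFun (Pi.single_eq_same (M := fun c ↦ PLift (c = a) → k) a
        ((fun _ ↦ (1 : k)) : PLift (a = a) → k)) ⟨rfl⟩
    have key := pairing O n (e (stable A) a) (T := u.support) (a := fun _ ↦ a) (b := b)
      (fun _ ↦ 𝟙 _) (J := fun t ↦ t.1)
      (c := fun t ↦ u t.1 * ((prodSign (n + 1) t.1 a b : ℤ) : k)) (fun t ↦ hu t.2) ?_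
      (μ := Finsupp.mapRange.linearMap (LinearMap.toSpanSingleton k _ m) κ) (kos_map hκ _) ?_
    · rw [pair, Finsupp.linearCombination_apply, Finsupp.sum, ← Finset.sum_coe_sort u.support]
      rw [← key]
      refine Finset.sum_congr rfl fun t _ ↦ ?_
      rw [Finsupp.mapRange.linearMap_apply, Finsupp.mapRange_apply]
      have : coef (stable A) a (totMap (𝟙 (e (stable A) a) : _ ⟶ e (stable A) a).hom
        (κ t.1 • m)) = κ t.1 * coef (stable A) a m := by
        rw [map_smul, map_smul]
        rfl
      refine Eq.trans ?_ (congrArg _ this).symm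
      rw [hm, smul_eq_mul]
      ring
    · rw [← h, wordExt, Finsupp.linearCombination_apply, Finsupp.sum, ← Finset.sum_coe_sort u.support]
      refine Finset.sum_congr rfl fun t _ ↦ ?_
      rw [Ext.mk₀_id_comp, dualProd_eq, smul_smul]
    · generalize Finsupp.mapRange.linearMap (LinearMap.toSpanSingleton k _ m) κ = ν
      induction ν using Finsupp.induction_linear with
      | zero => simp
      | add u v hu hv => rw [map_add, hu, hv, add_zero]
      | single w p => rw [kosD_single, coef_totOp, Finsupp.single_zero]

lemma isBasisOf_subtype {ι ι' M : Type*} [AddCommGroup M] [Module k M] {f : ι → M} {Q : ι → Prop}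
    {P : ι' → Prop} (s : ι' → ι) (hs : Function.Bijective s) (hPQ : ∀ I, P I ↔ Q (s I))
    {N : Submodule k M}
    (h₁ : ∀ u ∈ Finsupp.supported k k {J | Q J}, Finsupp.linearCombination k f u = 0 → u = 0)
    (h₂ : Submodule.span k (f '' {J | Q J}) = N) :
    IsBasisOf (fun I : {I // P I} ↦ f (s I.1)) N := by
  constructor
  · have h : LinearIndepOn k f {J | Q J} := linearIndepOn_iff.2 h₁
    refine LinearIndependent.comp h (fun I : {I // P I} ↦ ⟨s I.1, (hPQ _).1 I.2⟩) ?_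
    exact fun I I' h ↦ Subtype.ext (hs.1 (congrArg Subtype.val h))
  · rw [← h₂]
    congr 1
    ext x
    constructor
    · rintro ⟨I, rfl⟩
      exact ⟨s I.1, (hPQ _).1 I.2, rfl⟩
    · rintro ⟨J, hJ, rfl⟩
      obtain ⟨I, rfl⟩ := hs.2 J
      exact ⟨⟨I, (hPQ _).2 hJ⟩, rfl⟩

namespace KoszulSystem

variable (O : KoszulSystem A)

/-- Triangularity again: the word of `u` of least weight is the only one of its words seen by the
Koszul element that it leads. -/
lemma eq_zero_of_pair {n : ℕ} {a b : ℤ} {u : (Fin n → A.Op) →₀ k}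
    (hu : u ∈ Finsupp.supported k k {J | O.Coadm J})
    (h : ∀ κ ∈ kos A k n, pair n a b κ u = 0) : u = 0 := by
  classical
  by_contra h0
  obtain ⟨J, hJ, hmin⟩ := Finset.exists_min_image u.support (fun J ↦ O.wt J)
    (Finsupp.support_nonempty_iff.2 h0)
  obtain ⟨κ, hκ, h1, h2⟩ := O.koszul J (hu hJ)
  have h3 := h κ hκ
  rw [pair, Finsupp.linearCombination_apply, Finsupp.sum, Finset.sum_eq_single J] at h3
  · refine mul_ne_zero (Finsupp.mem_support_iff.1 hJ) (mul_ne_zero ?_ h1) h3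
    have := units_cast_mul_self (k := k) (prodSign n J a b)
    exact left_ne_zero_of_mul (this.symm ▸ one_ne_zero)
  · intro J' hJ' hne
    have : κ J' = 0 := by
      by_contra H
      have h4 := h2 J' H hne
      have h5 := hmin J' hJ'
      omega
    rw [this, mul_zero, smul_zero]
  · exact fun h ↦ (h hJ).elim

lemma wordExt_injective {n : ℕ} {a b : ℤ} {u : (Fin n → A.Op) →₀ k}
    (hu : u ∈ Finsupp.supported k k {J | O.Coadm J ∧ a + ∑ i, A.deg (J i) = b})
    (h : wordExt (stable A) n a b u = 0) : u = 0 :=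
  O.eq_zero_of_pair (a := a) (b := b) (Finsupp.supported_mono (fun _ h ↦ h.1) hu) fun _ hκ ↦
    pair_eq_zero O.toPBW (Finsupp.supported_mono (fun _ h ↦ h.2) hu) h hκ

/-- The index set of the basis of `Ext` over the modules with vanishing condition `unst t`. -/
def Idx (t : ℤ) {n : ℕ} (a b : ℤ) (J : Fin n → A.Op) : Prop :=
  O.Coadm J ∧ a + ∑ i, A.deg (J i) = b ∧ ∀ h : 0 < n, a - t ≤ O.v (J ⟨0, h⟩)

lemma span_unst (t : ℤ) (n : ℕ) (a b : ℤ) :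
    Submodule.span k ((fun J : Fin n → A.Op ↦ dualProd (O.unst t) n J a b) '' {J | O.Idx t a b J}) =
      ⊤ := by
  have h : Submodule.span k {y | ∃ J : Fin n → A.Op, O.Coadm J ∧
      (∀ h : 0 < n, a - t ≤ O.v (J ⟨0, h⟩)) ∧ y = dualProd (O.unst t) n J a b} = ⊤ :=
    O.toPBW.span_dualProd t n a b
  rw [eq_top_iff, ← h, Submodule.span_le]
  rintro _ ⟨J, hJ, h, rfl⟩
  by_cases hD : a + ∑ i, A.deg (J i) = b
  · exact Submodule.subset_span ⟨J, ⟨hJ, hD, h⟩, rfl⟩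
  · rw [dualProd_eq_zero_of_deg _ hD]
    exact zero_mem _

lemma exists_wordExt (t : ℤ) {n : ℕ} {a b : ℤ} (x : Ext (e (O.unst t) a) (e (O.unst t) b) n) :
    ∃ u ∈ Finsupp.supported k k {J | O.Idx t a b J}, wordExt (O.unst t) n a b u = x := by
  have : x ∈ Submodule.span k ((fun J : Fin n → A.Op ↦ dualProd (O.unst t) n J a b) ''
      {J | O.Idx t a b J}) := by
    rw [O.span_unst t n a b]
    trivial
  exact (Finsupp.mem_span_image_iff_linearCombination k).1 this

variable {O} in
lemma supported_of_idx {t : ℤ} {n : ℕ} {a b : ℤ} {u : (Fin n → A.Op) →₀ k}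
    (hu : u ∈ Finsupp.supported k k {J | O.Idx t a b J}) :
    u ∈ Finsupp.supported k k {J | O.Coadm J ∧ a + ∑ i, A.deg (J i) = b} :=
  fun _ hJ ↦ ⟨(hu hJ).1, (hu hJ).2.1⟩

lemma extToStable_dualProd_of_idx {t : ℤ} {n : ℕ} {a b : ℤ} {J : Fin n → A.Op}
    (hJ : O.Idx t a b J) :
    extToStable (O.unst t) n a b (dualProd (O.unst t) n J a b) = dualProd (stable A) n J a b :=
  extToStable_dualProd (O.allowed_of_coadm hJ.1 hJ.2.2)

lemma extToStable_wordExt {t : ℤ} {n : ℕ} {a b : ℤ} {u : (Fin n → A.Op) →₀ k}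
    (hu : u ∈ Finsupp.supported k k {J | O.Idx t a b J}) :
    extToStable (O.unst t) n a b (wordExt (O.unst t) n a b u) = wordExt (stable A) n a b u := by
  rw [wordExt, wordExt, Finsupp.linearCombination_apply, Finsupp.linearCombination_apply,
    Finsupp.sum, Finsupp.sum, map_sum]
  refine Finset.sum_congr rfl fun J hJ ↦ ?_
  rw [map_smul, O.extToStable_dualProd_of_idx (hu hJ)]

lemma wordExt_injective_of_idx {t : ℤ} {n : ℕ} {a b : ℤ} {u : (Fin n → A.Op) →₀ k}
    (hu : u ∈ Finsupp.supported k k {J | O.Idx t a b J})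
    (h : wordExt (stable A) n a b u = 0) : u = 0 :=
  O.wordExt_injective (supported_of_idx hu) h

/-- Classes that span the unstable `Ext` map to classes that are independent over the big algebra.
-/
theorem extToStable_injective (t : ℤ) (n : ℕ) (a b : ℤ) :
    Function.Injective (extToStable (O.unst t) n a b) := by
  refine (injective_iff_map_eq_zero _).2 fun x hx ↦ ?_
  obtain ⟨u, hu, rfl⟩ := O.exists_wordExt t x
  rw [O.extToStable_wordExt hu] at hx
  rw [O.wordExt_injective_of_idx hu hx, map_zero]

lemma star_bijective (n : ℕ) : Function.Bijective fun (I : Fin n → A.Op) i ↦ O.star (I i) :=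
  Function.Involutive.bijective fun I ↦ funext fun i ↦ O.star_star (I i)

theorem isBasisOf_range (t : ℤ) {n : ℕ} {a b : ℤ} {P : (Fin n → A.Op) → Prop}
    (hP : ∀ I, P I ↔ O.Idx t a b fun i ↦ O.star (I i)) :
    IsBasisOf (fun I : {I // P I} ↦ dualProd (stable A) n (fun i ↦ O.star (I.1 i)) a b)
      (LinearMap.range (extToStable (O.unst t) n a b)) := by
  have h₁ : ∀ u ∈ Finsupp.supported k k {J | O.Idx t a b J},
      wordExt (stable A) n a b u = 0 → u = 0 := fun u hu h ↦ O.wordExt_injective_of_idx hu h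
  have h₂ : Submodule.span k ((fun J : Fin n → A.Op ↦ dualProd (stable A) n J a b) ''
      {J | O.Idx t a b J}) = LinearMap.range (extToStable (O.unst t) n a b) := by
    rw [LinearMap.range_eq_map, ← O.span_unst t n a b, Submodule.map_span]
    congr 1
    rw [Set.image_image]
    exact Set.image_congr fun J hJ ↦ (O.extToStable_dualProd_of_idx hJ).symm
  exact isBasisOf_subtype (f := fun J ↦ dualProd (stable A) n J a b)
    (fun (I : Fin n → A.Op) i ↦ O.star (I i)) (O.star_bijective n) hP h₁ h₂

theorem isBasisOf_top (t : ℤ) {n : ℕ} {a b : ℤ} {P : (Fin n → A.Op) → Prop}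
    (hP : ∀ I, P I ↔ O.Idx t a b fun i ↦ O.star (I i)) :
    IsBasisOf (fun I : {I // P I} ↦ dualProd (O.unst t) n (fun i ↦ O.star (I.1 i)) a b)
      (⊤ : Submodule k (Ext (e (O.unst t) a) (e (O.unst t) b) n)) := by
  have h₁ : ∀ u ∈ Finsupp.supported k k {J | O.Idx t a b J},
      wordExt (O.unst t) n a b u = 0 → u = 0 := fun u hu h ↦ by
    refine O.wordExt_injective_of_idx hu ?_
    rw [← O.extToStable_wordExt hu, h, map_zero]
  exact isBasisOf_subtype (f := fun J ↦ dualProd (O.unst t) n J a b)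
    (fun (I : Fin n → A.Op) i ↦ O.star (I i)) (O.star_bijective n) hP h₁ (O.span_unst t n a b)

/-- The product exists already over `unst t` for a large `t`, where the coadmissible products span,
and this expansion maps to the big algebra. -/
lemma mem_span_coadm {n : ℕ} (a b : ℤ) (J : Fin n → A.Op) :
    dualProd (stable A) n J a b ∈ Submodule.span k
      ((fun J : Fin n → A.Op ↦ dualProd (stable A) n J a b) ''
        {J | O.Coadm J ∧ a + ∑ i, A.deg (J i) = b}) := by
  obtain ⟨t, ht⟩ := O.exists_allowed J a
  obtain ⟨u, hu, hx⟩ := O.exists_wordExt t (dualProd (O.unst t) n J a b)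
  rw [← extToStable_dualProd ht, ← hx, O.extToStable_wordExt hu]
  exact (Finsupp.mem_span_image_iff_linearCombination k).2
    ⟨u, supported_of_idx hu, rfl⟩

theorem isBasisOf_span {n : ℕ} {a b : ℤ} {P : (Fin n → A.Op) → Prop}
    (hP : ∀ I, P I ↔ O.Coadm (fun i ↦ O.star (I i)) ∧ a + ∑ i, A.deg (O.star (I i)) = b) :
    IsBasisOf (fun I : {I // P I} ↦ dualProd (stable A) n (fun i ↦ O.star (I.1 i)) a b)
      (Submodule.span k (Set.range fun I : Fin n → A.Op ↦
        dualProd (stable A) n (fun i ↦ O.star (I i)) a b)) := by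
  have h₁ : ∀ u ∈ Finsupp.supported k k {J | O.Coadm J ∧ a + ∑ i, A.deg (J i) = b},
      wordExt (stable A) n a b u = 0 → u = 0 := fun u hu h ↦ O.wordExt_injective hu h
  have h₂ : Submodule.span k ((fun J : Fin n → A.Op ↦ dualProd (stable A) n J a b) ''
      {J | O.Coadm J ∧ a + ∑ i, A.deg (J i) = b}) = Submodule.span k (Set.range
        fun I : Fin n → A.Op ↦ dualProd (stable A) n (fun i ↦ O.star (I i)) a b) := by
    refine le_antisymm (Submodule.span_mono ?_) (Submodule.span_le.2 ?_)
    · rintro _ ⟨J, -, rfl⟩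
      obtain ⟨I, rfl⟩ := (O.star_bijective n).2 J
      exact ⟨I, rfl⟩
    · rintro _ ⟨I, rfl⟩
      exact O.mem_span_coadm a b _
  exact isBasisOf_subtype (f := fun J ↦ dualProd (stable A) n J a b)
    (fun (I : Fin n → A.Op) i ↦ O.star (I i)) (O.star_bijective n) hP h₁ h₂

/-- The element in question is expanded as a combination `u'` of coadmissible products. Every Koszul
element pairs with `u'` as it does with the original sum, and there the pairing is the orthogonality
of relations, up to the constant of `opp_sign`. Hence all pairings vanish and `u' = 0`. -/
theorem oppositeRelations : OppositeRelations A O.star := by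
  classical
  intro ρ hρ a b
  obtain ⟨D, hD⟩ := O.rel_deg hρ
  obtain ⟨g, h, -⟩ := O.rel_lead ρ hρ
  obtain ⟨c, hc⟩ := O.opp_sign ρ hρ
  let W : A.Op × A.Op → Fin 2 → A.Op := fun q ↦ ![O.star q.2, O.star q.1]
  let s : A.Op × A.Op → k := fun q ↦ (((A.deg q.1 * A.deg q.2).negOnePow : ℤˣ) : ℤ)
  have hW : ∀ q ∈ ρ.support, ∑ i, A.deg (W q i) = -D - 2 := by
    intro q hq
    have := hD q hq
    rw [Fin.sum_univ_two]
    change A.deg (O.star q.2) + A.deg (O.star q.1) = _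
    rw [O.deg_star, O.deg_star]
    omega
  let u : (Fin 2 → A.Op) →₀ k := ∑ q ∈ ρ.support, Finsupp.single (W q) (ρ q * s q)
  have hu : ρ.sum (fun gh c ↦ c • ((A.deg gh.1 * A.deg gh.2).negOnePow •
      dualProd (stable A) 2 ![O.star gh.2, O.star gh.1] a b)) = wordExt (stable A) 2 a b u := by
    rw [wordExt, map_sum, Finsupp.sum]
    refine Finset.sum_congr rfl fun q _ ↦ ?_
    rw [Finsupp.linearCombination_single, units_smul_eq (k := k), smul_smul]
  rw [hu]
  by_cases hb : a + (-D - 2) = b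
  · have hu' : u ∈ Finsupp.supported k k {J : Fin 2 → A.Op | a + ∑ i, A.deg (J i) = b} :=
      Submodule.sum_mem _ fun q hq ↦ Finsupp.single_mem_supported _ _ (by
        change a + ∑ i, A.deg (W q i) = b
        rw [hW q hq, hb])
    have h1 : wordExt (stable A) 2 a b u ∈ Submodule.span k
        ((fun J : Fin 2 → A.Op ↦ dualProd (stable A) 2 J a b) ''
          {J | O.Coadm J ∧ a + ∑ i, A.deg (J i) = b}) :=
      Submodule.sum_mem _ fun J _ ↦ Submodule.smul_mem _ _ (O.mem_span_coadm a b J)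
    obtain ⟨u', hu'', h2⟩ := (Finsupp.mem_span_image_iff_linearCombination k).1 h1
    suffices u' = 0 by
      rw [← h2, this, map_zero]
    refine O.eq_zero_of_pair (a := a) (b := b) (Finsupp.supported_mono (fun _ h ↦ h.1) hu'')
      fun κ hκ ↦ ?_
    have h3 := pair_eq_zero O.toPBW (u := u - u') (sub_mem hu'
      (Finsupp.supported_mono (fun _ h ↦ h.2) hu''))
      (by rw [map_sub, sub_eq_zero]; exact h2.symm) hκ
    rw [map_sub, sub_eq_zero] at h3
    rw [← h3]
    have h4 := O.sum_ev_eq_zero (i := 0) (by omega) (mem_kos.1 hκ 0 (by omega)) hρ fun _ ↦ g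
    have h5 := congrArg (c * ·) h4
    simp only [mul_zero] at h5
    rw [← h5, Finsupp.sum, Finset.mul_sum, map_sum]
    refine Finset.sum_congr rfl fun q hq ↦ ?_
    -- The two degrees add up to `b - a`, so the second factor of the sign is trivial. The exponent
    -- of the first is `1 - deg (star q.1) = deg q.1 + 2`.
    have h6 : prodSign 2 (W q) a b = (A.deg q.1).negOnePow := by
      have h7 := hW q hq
      rw [Fin.sum_univ_two] at h7
      have h8 : a + A.deg (W q 0) + A.deg (W q 1) - b + (0 : ℕ) = 0 := by
        push_cast
        omega
      have h9 : a + A.deg (W q 0) - b + (1 : ℕ) = A.deg q.1 + 2 := by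
        have : A.deg (W q 1) = -A.deg q.1 - 1 := O.deg_star q.1
        push_cast
        omega
      change (a + A.deg (W q 0) - b + (1 : ℕ)).negOnePow *
        ((a + A.deg (W q 0) + A.deg (W q 1) - b + (0 : ℕ)).negOnePow * 1) = _
      rw [h8, h9, Int.negOnePow_zero, mul_one, mul_one, Int.negOnePow_add,
        Int.negOnePow_even 2 even_two, mul_one]
    have h7 : Function.update (Function.update (fun _ : Fin 2 ↦ g) ⟨0, by omega⟩ q.2)
        ⟨0 + 1, by omega⟩ q.1 = ![q.2, q.1] := by
      funext i
      fin_cases i <;> rfl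
    have h8 : (fun i ↦ O.star (![q.2, q.1] i)) = W q := by
      funext i
      fin_cases i <;> rfl
    rw [pair, Finsupp.linearCombination_single, h6, h7, ev, h8, Fin.prod_univ_two, smul_eq_mul]
    have h9 := hc q hq
    rw [Units.val_mul, Int.cast_mul] at h9
    change ρ q * s q * (_ * κ (W q)) = c * (ρ q * (O.sgn 0 q.2 * O.sgn 1 q.1 * κ (W q)))
    linear_combination (ρ q * κ (W q)) * h9
  · rw [wordExt, map_sum]
    refine Finset.sum_eq_zero fun q hq ↦ ?_
    rw [Finsupp.linearCombination_single, dualProd_eq_zero_of_deg, smul_zero]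
    rwa [hW q hq]

end KoszulSystem

end DyerLashof

end

noncomputable section

namespace DyerLashof

/-! ### The coefficients of the Adem relations -/

section coeff

variable (k : Type) [Field k] (p : ℕ)

/-- The coefficient of `X ^ i` in `(1 - X) ^ ((p - 1) * j - 1)`. -/
def ademCoeff (i j : ℕ) : k :=
  PowerSeries.coeff i (PowerSeries.mk 1 * (1 - PowerSeries.X) ^ ((p - 1) * j))

lemma ademCoeff_zero_right (i : ℕ) : ademCoeff k p i 0 = 1 := by
  simp [ademCoeff]

lemma coeff_one_sub_X_pow (N i : ℕ) :
    PowerSeries.coeff i ((1 - PowerSeries.X : PowerSeries k) ^ N) = (-1) ^ i * (N.choose i : k) := by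
  induction N generalizing i with
  | zero => cases i <;> simp [PowerSeries.coeff_one]
  | succ N ih =>
    rw [pow_succ, mul_sub, mul_one, map_sub, ih]
    cases i with
    | zero => simp
    | succ i =>
      rw [PowerSeries.coeff_succ_mul_X, ih, Nat.choose_succ_succ]
      push_cast
      ring

lemma ademCoeff_eq {j N : ℕ} (h : (p - 1) * j = N + 1) (i : ℕ) :
    ademCoeff k p i j = (-1) ^ i * (N.choose i : k) := by
  rw [ademCoeff, h, pow_succ', ← mul_assoc, PowerSeries.mk_one_mul_one_sub_eq_one, one_mul,
    coeff_one_sub_X_pow]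

lemma ademCoeff_sub (i j : ℕ) :
    ademCoeff k p (i + 1) j - ademCoeff k p i j = (-1) ^ (i + 1) * (((p - 1) * j).choose (i + 1) : k) := by
  have h : (PowerSeries.mk 1 * (1 - PowerSeries.X : PowerSeries k) ^ ((p - 1) * j)) *
      (1 - PowerSeries.X) = (1 - PowerSeries.X) ^ ((p - 1) * j) := by
    rw [mul_right_comm, PowerSeries.mk_one_mul_one_sub_eq_one, one_mul]
  rw [← coeff_one_sub_X_pow, ← h, mul_sub, mul_one, map_sub, PowerSeries.coeff_succ_mul_X]
  rfl

lemma ademCoeff_zero_left (j : ℕ) : ademCoeff k p 0 j = 1 := by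
  simp [ademCoeff]

variable [Fact p.Prime] [CharP k p]

/-- Compare coefficients of `X ^ (i + 1)` after multiplying by `1 - X`. The exponents for `j` and `j
+ 1` differ by `p - 1`, so a factor `(1 - X) ^ p = 1 - X ^ p` appears. -/
lemma ademCoeff_rec (i j : ℕ) :
    ademCoeff k p (i + 1) (j + 1) - ademCoeff k p i (j + 1) =
      ademCoeff k p (i + 1) j - if p ≤ i + 1 then ademCoeff k p (i + 1 - p) j else 0 := by
  have hp : 1 ≤ p := (Fact.out : p.Prime).one_lt.le
  have key : (PowerSeries.mk 1 * (1 - PowerSeries.X : PowerSeries k) ^ ((p - 1) * (j + 1))) *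
      (1 - PowerSeries.X) = (PowerSeries.mk 1 * (1 - PowerSeries.X) ^ ((p - 1) * j)) *
        (1 - PowerSeries.X ^ p) := by
    have : CharP (PowerSeries k) p :=
      charP_of_injective_algebraMap (algebraMap k (PowerSeries k)).injective p
    have h1 : (1 - PowerSeries.X ^ p : PowerSeries k) = (1 - PowerSeries.X) ^ p := by
      rw [sub_pow_char, one_pow]
    rw [h1, mul_assoc, mul_assoc, ← pow_succ, ← pow_add]
    congr 2
    obtain ⟨q, rfl⟩ := Nat.exists_eq_add_of_le' hp
    simp only [Nat.add_sub_cancel]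
    ring
  have := congrArg (PowerSeries.coeff (i + 1)) key
  rw [mul_sub, mul_sub, mul_one, mul_one, map_sub, map_sub, PowerSeries.coeff_succ_mul_X,
    PowerSeries.coeff_mul_X_pow'] at this
  exact this

end coeff

/-! ### Shifts of pairs of operations -/

section pairs

variable {k : Type} [Field k] {Op : Type} [AddAction ℤ Op]

/-- The shift of both operations of a pair. -/
def pairShift (a b : ℤ) : (Op × Op →₀ k) →ₗ[k] (Op × Op →₀ k) :=
  Finsupp.lmapDomain k k fun q ↦ (a +ᵥ q.1, b +ᵥ q.2)

@[simp]
lemma pairShift_single (a b : ℤ) (q : Op × Op) (c : k) :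
    pairShift a b (Finsupp.single q c) = Finsupp.single (a +ᵥ q.1, b +ᵥ q.2) c :=
  Finsupp.mapDomain_single

lemma pairShift_pairShift (a b c d : ℤ) (u : Op × Op →₀ k) :
    pairShift a b (pairShift c d u) = pairShift (a + c) (b + d) u := by
  induction u using Finsupp.induction_linear with
  | zero => simp
  | add u v hu hv => simp only [map_add, hu, hv]
  | single q c => simp [add_vadd]

@[simp]
lemma pairShift_zero (u : Op × Op →₀ k) : pairShift 0 0 u = u := by
  induction u using Finsupp.induction_linear with
  | zero => simp
  | add u v hu hv => simp only [map_add, hu, hv]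
  | single q c => simp

/-- The sum of the shifts of the two operations of a pair. -/
def pairSum : (Op × Op →₀ k) →ₗ[k] (Op × Op →₀ k) := pairShift 1 0 + pairShift 0 1

variable (p : ℕ)

/-- The combination of shifts that occurs in the Adem relations. -/
def ademSum (r : ℕ) : (Op × Op →₀ k) →ₗ[k] (Op × Op →₀ k) :=
  ∑ i ∈ Finset.range (r + 1), ademCoeff k p i (r - i) • pairShift (i : ℤ) ((r - i : ℕ) : ℤ)

/-- The relations generated by the element `u`. -/
def ademFamily (u : Op × Op →₀ k) (s : ℤ) (r : ℕ) : Op × Op →₀ k :=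
  pairShift (p * s) s (ademSum p r u)

lemma ademSum_apply (r : ℕ) (u : Op × Op →₀ k) :
    ademSum p r u = ∑ i ∈ Finset.range (r + 1),
      ademCoeff k p i (r - i) • pairShift (i : ℤ) ((r - i : ℕ) : ℤ) u := by
  simp [ademSum]

lemma ademFamily_eq (u : Op × Op →₀ k) (s : ℤ) (r : ℕ) :
    ademFamily p u s r = ∑ i ∈ Finset.range (r + 1),
      ademCoeff k p i (r - i) • pairShift (p * s + i) (s + (r - i : ℕ)) u := by
  simp [ademFamily, ademSum_apply, pairShift_pairShift]

lemma ademFamily_zero (u : Op × Op →₀ k) (s : ℤ) :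
    ademFamily p u s 0 = pairShift (p * s) s u := by
  simp [ademFamily_eq, ademCoeff_zero_right]

lemma pairShift_ademFamily (u : Op × Op →₀ k) (m s : ℤ) (r : ℕ) :
    pairShift (p * m) m (ademFamily p u s r) = ademFamily p u (m + s) r := by
  rw [ademFamily, pairShift_pairShift, ← mul_add, ademFamily]

variable [Fact p.Prime] [CharP k p]

/-- This is `ademCoeff_rec` summed along `i + j = r`: the two shifts in `pairSum` raise `i` and `j`
respectively. The terms at both ends agree because the coefficients with `i = 0` or `j = 0` are
equal to `1`. -/
lemma pairSum_ademSum (r : ℕ) (u : Op × Op →₀ k) :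
    pairSum (ademSum p r u) = ademSum p (r + 1) u +
      if p ≤ r then pairShift p 1 (ademSum p (r - p) u) else 0 := by
  have hp : 1 < p := (Fact.out : p.Prime).one_lt
  let f : ℕ → Op × Op →₀ k := fun i ↦ pairShift (i : ℤ) ((r + 1 - i : ℕ) : ℤ) u
  let c : ℕ → ℕ → k := ademCoeff k p
  have h1 : pairShift 1 0 (ademSum p r u) = ∑ i ∈ Finset.range (r + 1), c i (r - i) • f (i + 1) := by
    rw [ademSum_apply, map_sum]
    refine Finset.sum_congr rfl fun i hi ↦ ?_
    rw [map_smul, pairShift_pairShift]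
    simp only [f, Nat.cast_add, Nat.cast_one, Nat.add_sub_add_right, add_comm]
    rfl
  have h2 : pairShift 0 1 (ademSum p r u) = ∑ i ∈ Finset.range (r + 1), c i (r - i) • f i := by
    rw [ademSum_apply, map_sum]
    refine Finset.sum_congr rfl fun i hi ↦ ?_
    have hi' : i ≤ r := Nat.lt_succ_iff.1 (Finset.mem_range.1 hi)
    rw [map_smul, pairShift_pairShift]
    simp only [f, Nat.sub_add_comm hi', Nat.cast_add, Nat.cast_one, add_comm]
    rfl
  have h3 : (if p ≤ r then pairShift p 1 (ademSum p (r - p) u) else 0) =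
      ∑ i ∈ Finset.range (r + 1), (if p ≤ i then c (i - p) (r - i) else 0) • f i := by
    split_ifs with hr
    · obtain ⟨d, rfl⟩ := Nat.exists_eq_add_of_le hr
      rw [add_assoc, Finset.sum_range_add, Finset.sum_eq_zero, zero_add, ademSum_apply, map_sum,
        Nat.add_sub_cancel_left]
      · refine Finset.sum_congr rfl fun i hi ↦ ?_
        have hi' : i ≤ d := Nat.lt_succ_iff.1 (Finset.mem_range.1 hi)
        have e1 : p + d - (p + i) = d - i := by omega
        have e2 : p + d + 1 - (p + i) = 1 + (d - i) := by omega
        rw [if_pos (Nat.le_add_right _ _), map_smul, pairShift_pairShift]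
        simp only [f, e1, e2, Nat.add_sub_cancel_left, Nat.cast_add, Nat.cast_one]
        rfl
      · intro i hi
        rw [if_neg (not_le.2 (Finset.mem_range.1 hi)), zero_smul]
    · refine (Finset.sum_eq_zero fun i hi ↦ ?_).symm
      have := Finset.mem_range.1 hi
      rw [if_neg (by omega), zero_smul]
  rw [pairSum, LinearMap.add_apply, h1, h2, h3, ademSum_apply]
  change _ = ∑ i ∈ Finset.range (r + 1 + 1), c i (r + 1 - i) • f i + _
  rw [Finset.sum_range_succ' (fun i ↦ c i (r + 1 - i) • f i),
    Finset.sum_range_succ (fun i ↦ c i (r - i) • f (i + 1)),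
    Finset.sum_range_succ (fun i ↦ c (i + 1) (r + 1 - (i + 1)) • f (i + 1)),
    Finset.sum_range_succ' (fun i ↦ c i (r - i) • f i),
    Finset.sum_range_succ' (fun i ↦ (if p ≤ i then c (i - p) (r - i) else 0) • f i)]
  have h4 : ∑ i ∈ Finset.range r, c i (r - i) • f (i + 1) +
      ∑ i ∈ Finset.range r, c (i + 1) (r - (i + 1)) • f (i + 1) =
      ∑ i ∈ Finset.range r, c (i + 1) (r + 1 - (i + 1)) • f (i + 1) +
      ∑ i ∈ Finset.range r,
        (if p ≤ i + 1 then c (i + 1 - p) (r - (i + 1)) else 0) • f (i + 1) := by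
    rw [← Finset.sum_add_distrib, ← Finset.sum_add_distrib]
    refine Finset.sum_congr rfl fun i hi ↦ ?_
    rw [← add_smul, ← add_smul]
    obtain ⟨j, rfl⟩ : ∃ j, r = i + 1 + j := ⟨r - (i + 1), by have := Finset.mem_range.1 hi; omega⟩
    have e1 : i + 1 + j - i = j + 1 := by omega
    have e2 : i + 1 + j - (i + 1) = j := by omega
    have e3 : i + 1 + j + 1 - (i + 1) = j + 1 := by omega
    rw [e1, e2, e3]
    congr 1
    linear_combination - ademCoeff_rec k p i j
  have e0 : ¬ p ≤ 0 := by omega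
  have e1 : r + 1 - (r + 1) = 0 := by omega
  have e2 : c (r + 1) 0 = c r 0 := by simp only [c, ademCoeff_zero_right]
  have e3 : c 0 (r + 1 - 0) = c 0 (r - 0) := by simp only [c, ademCoeff_zero_left]
  rw [if_neg e0, zero_smul, add_zero, e1, Nat.sub_self, e2, e3]
  rw [add_add_add_comm, h4]
  abel

lemma pairSum_pairShift (a b : ℤ) (u : Op × Op →₀ k) :
    pairSum (pairShift a b u) = pairShift a b (pairSum u) := by
  simp only [pairSum, LinearMap.add_apply, map_add, pairShift_pairShift, add_comm]

lemma pairSum_ademFamily (u : Op × Op →₀ k) (s : ℤ) (r : ℕ) :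
    pairSum (ademFamily p u s r) = ademFamily p u s (r + 1) +
      if p ≤ r then ademFamily p u (s + 1) (r - p) else 0 := by
  rw [ademFamily, pairSum_pairShift, pairSum_ademSum, map_add]
  congr 1
  split_ifs
  · rw [pairShift_pairShift, ademFamily, mul_add, mul_one]
  · exact map_zero _

/-- A subspace that contains the elements `u` and is closed under the operators `pairSum` and
`pairShift (p * m) m` contains the relations generated by `u`. -/
lemma ademFamily_mem {W : Submodule k (Op × Op →₀ k)} {u : Op × Op →₀ k} (hu : u ∈ W)
    (h1 : ∀ x ∈ W, pairSum x ∈ W) (h2 : ∀ (m : ℤ), ∀ x ∈ W, pairShift (p * m) m x ∈ W) (s : ℤ)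
    (r : ℕ) : ademFamily p u s r ∈ W := by
  induction r using Nat.strong_induction_on generalizing s with
  | _ r ih =>
    cases r with
    | zero =>
      rw [ademFamily_zero]
      exact h2 s _ hu
    | succ r =>
      rw [eq_sub_of_add_eq (pairSum_ademFamily p u s r).symm]
      refine W.sub_mem (h1 _ (ih r (by omega) s)) ?_
      split_ifs
      · exact ih _ (by omega) _
      · exact W.zero_mem

end pairs

end DyerLashof
end

noncomputable section

namespace DyerLashof

variable {k : Type} [Field k] {A : QuadraticPresentation k}

/-! ### Relations that are generated by shifts -/

/-- Elements that generate the relations under the shifts `pairSum` and `pairShift (p * m) m`. -/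
structure AdemGenerators (p : ℕ) (A : QuadraticPresentation k) [AddAction ℤ A.Op] where
  gens : Set (A.Op × A.Op →₀ k)
  span_rel : Submodule.span k A.rel =
    Submodule.span k {ρ | ∃ u ∈ gens, ∃ (s : ℤ) (r : ℕ), ρ = ademFamily p u s r}

section pairing

variable (sg : A.Op × A.Op → k) (st : A.Op → A.Op)

/-- The bilinear form on pairs of operations given by an involution and signs. -/
def relPairing : (A.Op × A.Op →₀ k) →ₗ[k] (A.Op × A.Op →₀ k) →ₗ[k] k :=
  Finsupp.linearCombination k fun q ↦ sg q • Finsupp.lapply (st q.1, st q.2)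

lemma relPairing_apply (ρ ρ' : A.Op × A.Op →₀ k) :
    relPairing sg st ρ ρ' = ρ.sum fun q c ↦ c * sg q * ρ' (st q.1, st q.2) := by
  rw [relPairing, Finsupp.linearCombination_apply, Finsupp.sum, LinearMap.sum_apply]
  exact Finset.sum_congr rfl fun q _ ↦ (mul_assoc _ _ _).symm

lemma relPairing_single (q : A.Op × A.Op) (c : k) (ρ' : A.Op × A.Op →₀ k) :
    relPairing sg st (Finsupp.single q c) ρ' = c * sg q * ρ' (st q.1, st q.2) := by
  rw [relPairing_apply, Finsupp.sum_single_index]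
  rw [zero_mul, zero_mul]

end pairing

section AdemGenerators

variable [AddAction ℤ A.Op]

lemma pairShift_apply (a b : ℤ) (u : A.Op × A.Op →₀ k) (q : A.Op × A.Op) :
    pairShift a b u q = u (-a +ᵥ q.1, -b +ᵥ q.2) := by
  have hi : Function.Injective fun q : A.Op × A.Op ↦ (a +ᵥ q.1, b +ᵥ q.2) := by
    rintro ⟨x, y⟩ ⟨x', y'⟩ h
    simpa using h
  have := Finsupp.mapDomain_apply hi u (-a +ᵥ q.1, -b +ᵥ q.2)
  simp only [vadd_neg_vadd] at this
  exact this

variable {p : ℕ}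

lemma AdemGenerators.ademFamily_mem_span (G : AdemGenerators p A) {u : A.Op × A.Op →₀ k} (hu : u ∈ G.gens) (s : ℤ) (r : ℕ) :
    ademFamily p u s r ∈ Submodule.span k A.rel := by
  rw [G.span_rel]
  exact Submodule.subset_span ⟨u, hu, s, r, rfl⟩

lemma AdemGenerators.pairShift_mem_span (G : AdemGenerators p A) {u : A.Op × A.Op →₀ k} (hu : u ∈ G.gens) (s : ℤ) :
    pairShift (p * s) s u ∈ Submodule.span k A.rel := by
  rw [← ademFamily_zero]
  exact G.ademFamily_mem_span hu s 0

lemma AdemGenerators.pairShift_mem (G : AdemGenerators p A) (m : ℤ) {x : A.Op × A.Op →₀ k}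
    (hx : x ∈ Submodule.span k A.rel) : pairShift (p * m) m x ∈ Submodule.span k A.rel := by
  rw [G.span_rel] at hx
  refine (Submodule.span_le (p := (Submodule.span k A.rel).comap (pairShift (p * m) m))).2 ?_ hx
  rintro _ ⟨u, hu, s, r, rfl⟩
  rw [SetLike.mem_coe, Submodule.mem_comap, pairShift_ademFamily]
  exact G.ademFamily_mem_span hu _ _

variable [Fact p.Prime] [CharP k p]

lemma AdemGenerators.pairSum_mem (G : AdemGenerators p A) {x : A.Op × A.Op →₀ k}
    (hx : x ∈ Submodule.span k A.rel) : pairSum x ∈ Submodule.span k A.rel := by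
  rw [G.span_rel] at hx
  refine (Submodule.span_le (p := (Submodule.span k A.rel).comap pairSum)).2 ?_ hx
  rintro _ ⟨u, hu, s, r, rfl⟩
  rw [SetLike.mem_coe, Submodule.mem_comap, pairSum_ademFamily]
  refine Submodule.add_mem _ (G.ademFamily_mem_span hu _ _) ?_
  split_ifs
  · exact G.ademFamily_mem_span hu _ _
  · exact Submodule.zero_mem _

lemma AdemGenerators.span_rel_le (G : AdemGenerators p A) {W : Submodule k (A.Op × A.Op →₀ k)} (hu : G.gens ⊆ W)
    (h1 : ∀ x ∈ W, pairSum x ∈ W) (h2 : ∀ (m : ℤ), ∀ x ∈ W, pairShift (p * m) m x ∈ W) :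
    Submodule.span k A.rel ≤ W := by
  rw [G.span_rel, Submodule.span_le]
  rintro _ ⟨u, h, s, r, rfl⟩
  exact ademFamily_mem p (hu h) h1 h2 s r

/-- Orthogonality of the relations follows from conditions on the generators. -/
lemma AdemGenerators.pairing_eq_zero (G : AdemGenerators p A) {sg : A.Op × A.Op → k} {st : A.Op → A.Op}
    (hst : ∀ (a : ℤ) g, st (a +ᵥ g) = -a +ᵥ st g)
    (hsg : ∀ (a b : ℤ) q, sg (a +ᵥ q.1, b +ᵥ q.2) = sg q)
    (hG : ∀ u ∈ G.gens, ∀ u' ∈ G.gens, ∀ a b : ℤ,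
      relPairing sg st u (pairShift a b u') ≠ 0 → a = p * b - 1)
    {ρ ρ' : A.Op × A.Op →₀ k} (hρ : ρ ∈ A.rel) (hρ' : ρ' ∈ A.rel) :
    ρ.sum (fun q c ↦ c * sg q * ρ' (st q.1, st q.2)) = 0 := by
  have hp : 1 < p := (Fact.out : p.Prime).one_lt
  -- The involution reverses shifts, so shifts are self-adjoint for the pairing.
  have adj (a b : ℤ) (x y : A.Op × A.Op →₀ k) :
      relPairing sg st (pairShift a b x) y = relPairing sg st x (pairShift a b y) := by
    induction x using Finsupp.induction_linear with
    | zero => simp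
    | add u v hu hv => simp only [map_add, LinearMap.add_apply, hu, hv]
    | single q c =>
      rw [pairShift_single, relPairing_single, relPairing_single, pairShift_apply, hsg, hst, hst]
  have hu : ∀ u ∈ G.gens, ∀ y ∈ Submodule.span k A.rel, relPairing sg st u y = 0 := by
    intro u hu y hy
    rw [G.span_rel] at hy
    refine (Submodule.span_le (p := LinearMap.ker (relPairing sg st u))).2 ?_ hy
    rintro _ ⟨u', hu', s, r, rfl⟩
    rw [SetLike.mem_coe, LinearMap.mem_ker, ademFamily_eq, map_sum]
    refine Finset.sum_eq_zero fun i _ ↦ ?_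
    rw [map_smul]
    by_contra hne
    have h1 := hG u hu u' hu' _ _ (right_ne_zero_of_smul hne)
    refine left_ne_zero_of_smul hne ?_
    -- With `j = r - i`, a term that survives would satisfy `i + 1 = p * j`. Then `i` exceeds `(p -
    -- 1) * j - 1`, so the Adem coefficient of this term is zero.
    have h2 : (i : ℤ) + 1 = p * (r - i : ℕ) := by linear_combination h1
    norm_cast at h2
    generalize r - i = j at h2 ⊢
    obtain ⟨q, rfl⟩ : ∃ q, p = 1 + 1 + q := Nat.exists_eq_add_of_le hp
    cases j with
    | zero => omega
    | succ j =>
      rw [ademCoeff_eq k (1 + 1 + q) (N := (1 + q) * j + q) (by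
        rw [show 1 + 1 + q - 1 = 1 + q by omega]; ring),
        Nat.choose_eq_zero_of_lt, Nat.cast_zero, mul_zero]
      have : (1 + 1 + q) * (j + 1) = (1 + q) * j + q + j + 2 := by ring
      omega
  rw [← relPairing_apply]
  -- By self-adjointness, the orthogonal complement of the relations is closed under the operators
  -- that generate the relations, so it suffices that it contains the generators.
  have key : Submodule.span k A.rel ≤
      { carrier := {x | ∀ y ∈ Submodule.span k A.rel, relPairing sg st x y = 0}
        add_mem' := fun {x x'} h h' y hy ↦ by rw [map_add, LinearMap.add_apply, h y hy, h' y hy, add_zero]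
        zero_mem' := fun y _ ↦ by rw [map_zero, LinearMap.zero_apply]
        smul_mem' := fun c x h y hy ↦ by rw [map_smul, LinearMap.smul_apply, h y hy, smul_zero] } := by
    refine G.span_rel_le hu (fun x hx y hy ↦ ?_) fun m x hx y hy ↦ ?_
    · rw [pairSum, LinearMap.add_apply, map_add, LinearMap.add_apply, adj, adj, ← map_add,
        ← LinearMap.add_apply]
      exact hx _ (G.pairSum_mem hy)
    · rw [adj]
      exact hx _ (G.pairShift_mem m hy)
  exact key (Submodule.subset_span hρ) _ (Submodule.subset_span hρ')

end AdemGenerators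

/-! ### Laurent polynomials acting on words -/

section words

/-- The insertion of pairs of operations into a word. -/
def insPair {n i : ℕ} (h : i + 1 < n) (w : Fin n → A.Op) :
    (A.Op × A.Op →₀ k) →ₗ[k] ((Fin n → A.Op) →₀ k) :=
  Finsupp.lmapDomain k k fun q ↦
    Function.update (Function.update w ⟨i, by omega⟩ q.2) ⟨i + 1, h⟩ q.1

lemma insPair_single {n i : ℕ} (h : i + 1 < n) (w : Fin n → A.Op) (q : A.Op × A.Op) (c : k) :
    insPair h w (Finsupp.single q c) = Finsupp.single
      (Function.update (Function.update w ⟨i, by omega⟩ q.2) ⟨i + 1, h⟩ q.1) c :=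
  Finsupp.mapDomain_single

lemma insPair_congr {n i : ℕ} (h : i + 1 < n) {w w' : Fin n → A.Op}
    (hw : ∀ j : Fin n, j ≠ ⟨i, by omega⟩ → j ≠ ⟨i + 1, h⟩ → w j = w' j) :
    insPair (k := k) h w = insPair h w' := by
  rw [insPair, insPair]
  congr 1
  funext q j
  simp only [Function.update_apply]
  split_ifs with h1 h2
  · rfl
  · rfl
  · exact hw j h2 h1

lemma insPair_self {n i : ℕ} (h : i + 1 < n) (w : Fin n → A.Op) (c : k) :
    insPair h w (Finsupp.single (w ⟨i + 1, h⟩, w ⟨i, by omega⟩) c) = Finsupp.single w c := by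
  rw [insPair_single, Function.update_eq_self, Function.update_eq_self]

lemma insPair_mem {n i : ℕ} (h : i + 1 < n) (w : Fin n → A.Op) {x : A.Op × A.Op →₀ k}
    (hx : x ∈ Submodule.span k A.rel) : insPair h w x ∈ relAt A k n i h := by
  refine (Submodule.span_le (p := (relAt A k n i h).comap (insPair h w))).2 (fun ρ hρ ↦ ?_) hx
  refine Submodule.subset_span ⟨w, ρ, 1, hρ, ?_⟩
  simp only [smul_eq_mul, mul_one]
  rfl

lemma relAt_le {n i : ℕ} (h : i + 1 < n) {W : Submodule k ((Fin n → A.Op) →₀ k)}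
    (hW : ∀ w, Submodule.span k A.rel ≤ W.comap (insPair h w)) : relAt A k n i h ≤ W := by
  refine Submodule.span_le.2 ?_
  rintro _ ⟨w, ρ, v, hρ, rfl⟩
  have := W.smul_mem v (hW w (Submodule.subset_span hρ))
  refine (congrArg (· ∈ W) ?_).mp this
  change v • Finsupp.mapDomain _ ρ = _
  rw [Finsupp.mapDomain, Finsupp.smul_sum]
  simp only [Finsupp.smul_single, smul_eq_mul, mul_comm]

variable [AddAction ℤ A.Op]

/-- The shift of the operations of a word. -/
def wordShift {n : ℕ} (a : ℕ → ℤ) (w : Fin n → A.Op) : Fin n → A.Op := fun i ↦ a i +ᵥ w i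

variable (k) in
/-- The ring of Laurent polynomials in variables `z_0, z_1, …`. -/
abbrev Laurent := AddMonoidAlgebra k (ℕ → ℤ)

variable (k) in
/-- The monomial with exponents `a`. -/
def mono (a : ℕ → ℤ) : Laurent k := AddMonoidAlgebra.single a 1

lemma mono_mul (a b : ℕ → ℤ) : mono k a * mono k b = mono k (a + b) := by
  rw [mono, mono, AddMonoidAlgebra.single_mul_single, one_mul, mono]

lemma mono_zero : mono k 0 = 1 := rfl

lemma mono_pow (a : ℕ → ℤ) (m : ℕ) : mono k a ^ m = mono k (m • a) := by
  rw [mono, AddMonoidAlgebra.single_pow, one_pow, mono]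

variable (A) in
/-- Laurent polynomials act on formal sums of words by shifting the operations. -/
def laurentAct (n : ℕ) : Laurent k →ₐ[k] Module.End k ((Fin n → A.Op) →₀ k) :=
  AddMonoidAlgebra.lift k _ (ℕ → ℤ)
    { toFun a := Finsupp.lmapDomain k k (wordShift (Multiplicative.toAdd a))
      map_one' := by
        refine Finsupp.lhom_ext fun w c ↦ ?_
        refine Finsupp.mapDomain_single.trans ?_
        exact congrArg (fun w ↦ Finsupp.single w c) (funext fun i ↦ zero_vadd ℤ (w i))
      map_mul' a b := by
        refine Finsupp.lhom_ext fun w c ↦ ?_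
        refine Finsupp.mapDomain_single.trans ?_
        refine Eq.trans ?_ (congrArg (Finsupp.mapDomain _) Finsupp.mapDomain_single).symm
        refine Eq.trans ?_ Finsupp.mapDomain_single.symm
        exact congrArg (fun w ↦ Finsupp.single w c) (funext fun i ↦ add_vadd _ _ _) }

lemma laurentAct_mono {n : ℕ} (a : ℕ → ℤ) (w : Fin n → A.Op) (c : k) :
    laurentAct A n (mono k a) (Finsupp.single w c) = Finsupp.single (wordShift a w) c := by
  rw [laurentAct, mono, AddMonoidAlgebra.lift_single, one_smul]
  exact Finsupp.mapDomain_single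

lemma laurentAct_insPair {n i : ℕ} (h : i + 1 < n) (a : ℕ → ℤ) (w : Fin n → A.Op)
    (x : A.Op × A.Op →₀ k) :
    laurentAct A n (mono k a) (insPair h w x) =
      insPair h (wordShift a w) (pairShift (a (i + 1)) (a i) x) := by
  induction x using Finsupp.induction_linear with
  | zero => simp
  | add u v hu hv => simp only [map_add, hu, hv]
  | single q c =>
    rw [insPair_single, laurentAct_mono, pairShift_single, insPair_single]
    congr 1
    funext j
    simp only [wordShift, Function.update_apply]
    split_ifs with h1 h2
    · rw [h1]
    · rw [h2]
    · rfl

variable (A) in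
/-- The Laurent polynomials that preserve the relations at a given place. -/
def stab {n i : ℕ} (h : i + 1 < n) : Subalgebra k (Laurent k) where
  carrier := {f | ∀ u ∈ relAt A k n i h, laurentAct A n f u ∈ relAt A k n i h}
  mul_mem' {f g} hf hg u hu := by
    rw [map_mul]
    exact hf _ (hg _ hu)
  add_mem' {f g} hf hg u hu := by
    rw [map_add]
    exact Submodule.add_mem _ (hf _ hu) (hg _ hu)
  algebraMap_mem' c u hu := by
    rw [AlgHom.commutes]
    exact Submodule.smul_mem _ c hu

variable {p : ℕ} {n i : ℕ} (h : i + 1 < n)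

/-- At the places `i` and `i + 1` the monomial acts as a shift `pairShift (p * m) m`, under which
the relations are closed; its exponents at other places only move letters that the relation does not
involve. -/
lemma AdemGenerators.mono_mem_stab (G : AdemGenerators p A) {a : ℕ → ℤ} (ha : a (i + 1) = p * a i) :
    mono k a ∈ stab A h := by
  change ∀ u ∈ relAt A k n i h, laurentAct A n (mono k a) u ∈ relAt A k n i h
  intro u hu
  refine relAt_le h (W := (relAt A k n i h).comap (laurentAct A n (mono k a)))
    (fun w x hx ↦ ?_) hu
  change laurentAct A n (mono k a) (insPair h w x) ∈ relAt A k n i h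
  rw [laurentAct_insPair, ha]
  exact insPair_mem h _ (G.pairShift_mem _ hx)

variable (k) in
/-- The variable `z_j`. -/
def zvar (j : ℕ) : Laurent k := mono k (Pi.single j 1)

lemma AdemGenerators.zvar_mem_stab (G : AdemGenerators p A) {j : ℕ} (h1 : j ≠ i) (h2 : j ≠ i + 1) : zvar k j ∈ stab A h :=
  G.mono_mem_stab h (by simp [h1.symm, h2.symm])

lemma AdemGenerators.mul_mem_stab (G : AdemGenerators p A) : zvar k (i + 1) ^ p * zvar k i ∈ stab A h := by
  rw [zvar, zvar, mono_pow, mono_mul]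
  exact G.mono_mem_stab h (by simp)

lemma laurentAct_add_insPair (w : Fin n → A.Op) (x : A.Op × A.Op →₀ k) :
    laurentAct A n (zvar k i + zvar k (i + 1)) (insPair h w x) = insPair h w (pairSum x) := by
  have hw (j : ℕ) (hj : j = i ∨ j = i + 1) :
      insPair (k := k) h (wordShift (Pi.single j 1) w) = insPair h w := by
    refine insPair_congr h fun l h1 h2 ↦ ?_
    have : (l : ℕ) ≠ j := by
      rintro rfl
      rcases hj with hj | hj
      · exact h1 (Fin.ext hj)
      · exact h2 (Fin.ext hj)
    rw [wordShift, Pi.single_eq_of_ne this, zero_vadd]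
  rw [map_add, LinearMap.add_apply, zvar, zvar, laurentAct_insPair, laurentAct_insPair,
    hw i (Or.inl rfl), hw (i + 1) (Or.inr rfl), ← map_add, add_comm]
  simp [pairSum]

variable (k p) in
/-- The sum of the monomials `∏ z_{j_t} ^ (p ^ t)` over all `j_0 < ⋯ < j_{m-1} < n`. -/
def frobSym : ℕ → ℕ → Laurent k
  | _, 0 => 1
  | 0, _ + 1 => 0
  | j + 1, m + 1 => frobSym j (m + 1) + zvar k j ^ p ^ m * frobSym j m

lemma AdemGenerators.frobSym_mem_stab_of_le (G : AdemGenerators p A) {j : ℕ} (hj : j ≤ i) (m : ℕ) :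
    frobSym k p j m ∈ stab A h := by
  induction j generalizing m with
  | zero =>
    cases m
    · exact Subalgebra.one_mem _
    · exact Subalgebra.zero_mem _
  | succ j ih =>
    cases m with
    | zero => exact Subalgebra.one_mem _
    | succ m =>
      exact Subalgebra.add_mem _ (ih (by omega) _) (Subalgebra.mul_mem _
        (Subalgebra.pow_mem _ (G.zvar_mem_stab h (by omega) (by omega)) _) (ih (by omega) _))

variable [Fact p.Prime] [CharP k p]

lemma AdemGenerators.add_mem_stab (G : AdemGenerators p A) :
    zvar k i + zvar k (i + 1) ∈ stab A h := by
  change ∀ u ∈ relAt A k n i h,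
    laurentAct A n (zvar k i + zvar k (i + 1)) u ∈ relAt A k n i h
  intro u hu
  refine relAt_le h
    (W := (relAt A k n i h).comap (laurentAct A n (zvar k i + zvar k (i + 1))))
    (fun w x hx ↦ ?_) hu
  change laurentAct A n (zvar k i + zvar k (i + 1)) (insPair h w x) ∈ relAt A k n i h
  rw [laurentAct_add_insPair]
  exact insPair_mem h w (G.pairSum_mem hx)

/-- An operator that commutes with the Laurent polynomials preserves the relations at a given place
if it sends the generators of the relations to relations. -/
lemma AdemGenerators.relAt_of_gens (G : AdemGenerators p A)
    {φ : Module.End k ((Fin n → A.Op) →₀ k)}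
    (hφ : ∀ f u, φ (laurentAct A n f u) = laurentAct A n f (φ u))
    (hg : ∀ u ∈ G.gens, ∀ w, φ (insPair h w u) ∈ relAt A k n i h) {x : (Fin n → A.Op) →₀ k}
    (hx : x ∈ relAt A k n i h) : φ x ∈ relAt A k n i h := by
  have key : Submodule.span k A.rel ≤ ⨅ w, ((relAt A k n i h).comap φ).comap (insPair h w) := by
    refine G.span_rel_le (fun u hu ↦ ?_) (fun x hx ↦ ?_) fun m x hx ↦ ?_
    · rw [SetLike.mem_coe, Submodule.mem_iInf]
      exact hg u hu
    · rw [Submodule.mem_iInf] at hx ⊢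
      intro w
      rw [Submodule.mem_comap, ← laurentAct_add_insPair, Submodule.mem_comap, hφ]
      exact G.add_mem_stab h _ (hx w)
    · rw [Submodule.mem_iInf] at hx ⊢
      intro w
      let a : ℕ → ℤ := Pi.single i m + Pi.single (i + 1) (p * m)
      have ha : a (i + 1) = p * m := by simp [a]
      have ha' : a i = m := by simp [a]
      have e : insPair h w (pairShift (p * m) m x) = laurentAct A n (mono k a) (insPair h w x) := by
        rw [laurentAct_insPair, ha, ha']
        refine LinearMap.congr_fun (insPair_congr h fun j h1 h2 ↦ ?_) _
        have h1' : (j : ℕ) ≠ i := fun e ↦ h1 (Fin.ext e)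
        have h2' : (j : ℕ) ≠ i + 1 := fun e ↦ h2 (Fin.ext e)
        rw [wordShift, show a j = 0 by simp [a, h1', h2'], zero_vadd]
      rw [Submodule.mem_comap, e, Submodule.mem_comap, hφ]
      exact G.mono_mem_stab h (by rw [ha, ha']) _ (hx w)
  exact relAt_le h (W := (relAt A k n i h).comap φ)
    (fun w y hy ↦ (Submodule.mem_iInf _).1 (key hy) w) hx

instance : CharP (Laurent k) p :=
  charP_of_injective_algebraMap (algebraMap k (Laurent k)).injective p

/-- As Frobenius is additive, the last two variables enter only through `z_j + z_{j+1}` and `z_{j+1}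
^ p * z_j`. These are the two elements that preserve the relations at the places `j` and `j + 1`. -/
lemma frobSym_add_two (j m : ℕ) : frobSym k p (j + 2) (m + 2) = frobSym k p j (m + 2) +
    (zvar k j + zvar k (j + 1)) ^ p ^ (m + 1) * frobSym k p j (m + 1) +
    (zvar k (j + 1) ^ p * zvar k j) ^ p ^ m * frobSym k p j m := by
  rw [add_pow_char_pow]
  simp only [frobSym]
  ring

/-- The elements `frobSym` preserve the relations at all places. -/
lemma AdemGenerators.frobSym_mem_stab (G : AdemGenerators p A) {j : ℕ} (hj : i + 2 ≤ j) (m : ℕ) :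
    frobSym k p j m ∈ stab A h := by
  induction j, hj using Nat.le_induction generalizing m with
  | base =>
    match m with
    | 0 => exact Subalgebra.one_mem _
    | 1 =>
      have : frobSym k p (i + 2) 1 = frobSym k p i 1 + (zvar k i + zvar k (i + 1)) := by
        simp only [frobSym]
        cases i <;> simp [frobSym, add_assoc]
      rw [this]
      exact Subalgebra.add_mem _ (G.frobSym_mem_stab_of_le h le_rfl _) (G.add_mem_stab h)
    | m + 2 =>
      rw [frobSym_add_two]
      exact Subalgebra.add_mem _ (Subalgebra.add_mem _ (G.frobSym_mem_stab_of_le h le_rfl _)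
        (Subalgebra.mul_mem _ (Subalgebra.pow_mem _ (G.add_mem_stab h) _)
          (G.frobSym_mem_stab_of_le h le_rfl _)))
        (Subalgebra.mul_mem _ (Subalgebra.pow_mem _ (G.mul_mem_stab h) _)
          (G.frobSym_mem_stab_of_le h le_rfl _))
  | succ j hj ih =>
    cases m with
    | zero => exact Subalgebra.one_mem _
    | succ m =>
      exact Subalgebra.add_mem _ (ih _) (Subalgebra.mul_mem _
        (Subalgebra.pow_mem _ (G.zvar_mem_stab h (by omega) (by omega)) _) (ih _))

end words

end DyerLashof
end

noncomputable section

namespace DyerLashof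

variable {k : Type} [Field k] {A : QuadraticPresentation k}

/-! ### Leading terms of operators on words -/

section lead

variable {W : Type} (wt : W → ℤ)

variable (k) in
/-- The formal sums of elements of weight at most `d`. -/
def fil (d : ℤ) : Submodule k (W →₀ k) := Finsupp.supported k k {w | wt w ≤ d}

variable (k) in
/-- The operators that raise the weight by at most `d`. -/
def bdd (d : ℤ) : Submodule k (Module.End k (W →₀ k)) where
  carrier := {φ | ∀ w, φ (Finsupp.single w 1) ∈ fil k wt (wt w + d)}
  add_mem' hφ hψ _ := Submodule.add_mem _ (hφ _) (hψ _)
  zero_mem' _ := Submodule.zero_mem _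
  smul_mem' c _ hφ _ := Submodule.smul_mem _ c (hφ _)

variable (k) in
/-- The operators that raise the weight by exactly `d`. -/
def homog (d : ℤ) : Submodule k (Module.End k (W →₀ k)) where
  carrier := {φ | ∀ w, φ (Finsupp.single w 1) ∈ Finsupp.supported k k {w' | wt w' = wt w + d}}
  add_mem' hφ hψ _ := Submodule.add_mem _ (hφ _) (hψ _)
  zero_mem' _ := Submodule.zero_mem _
  smul_mem' c _ hφ _ := Submodule.smul_mem _ c (hφ _)

variable {wt}

lemma fil_mono {d e : ℤ} (h : d ≤ e) : fil k wt d ≤ fil k wt e :=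
  Finsupp.supported_mono fun _ hw ↦ le_trans hw h

lemma bdd_mono {d e : ℤ} (h : d ≤ e) : bdd k wt d ≤ bdd k wt e :=
  fun _ hφ w ↦ fil_mono (by omega) (hφ w)

lemma homog_le_bdd (d : ℤ) : homog k wt d ≤ bdd k wt d :=
  fun _ hφ w ↦ Finsupp.supported_mono (fun _ hw ↦ le_of_eq hw) (hφ w)

lemma apply_mem {s : Set W} {N : Submodule k (W →₀ k)} {φ : Module.End k (W →₀ k)}
    (h : ∀ w ∈ s, φ (Finsupp.single w 1) ∈ N) {u : W →₀ k} (hu : u ∈ Finsupp.supported k k s) :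
    φ u ∈ N := by
  rw [Finsupp.supported_eq_span_single] at hu
  refine (Submodule.span_le (p := N.comap φ)).2 ?_ hu
  rintro _ ⟨w, hw, rfl⟩
  exact h w hw

lemma bdd_apply {d x : ℤ} {φ : Module.End k (W →₀ k)} (hφ : φ ∈ bdd k wt d) {u : W →₀ k}
    (hu : u ∈ fil k wt x) : φ u ∈ fil k wt (x + d) :=
  apply_mem (fun w hw ↦ fil_mono (by have : wt w ≤ x := hw; omega) (hφ w)) hu

lemma bdd_mul {d e : ℤ} {φ ψ : Module.End k (W →₀ k)} (hφ : φ ∈ bdd k wt d)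
    (hψ : ψ ∈ bdd k wt e) : φ * ψ ∈ bdd k wt (d + e) := fun w ↦ by
  rw [add_comm d, ← add_assoc]
  exact bdd_apply hφ (hψ w)

lemma homog_mul {d e : ℤ} {φ ψ : Module.End k (W →₀ k)} (hφ : φ ∈ homog k wt d)
    (hψ : ψ ∈ homog k wt e) : φ * ψ ∈ homog k wt (d + e) := fun w ↦ by
  refine apply_mem (fun w' hw' ↦ Finsupp.supported_mono (fun w'' hw'' ↦ ?_) (hφ w')) (hψ w)
  have h1 : wt w' = wt w + e := hw'
  have h2 : wt w'' = wt w' + d := hw''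
  change wt w'' = wt w + (d + e)
  omega

variable (wt) in
/-- The operator `ψ` is homogeneous of degree `d` and is the leading term of `φ`. -/
structure IsLeadTerm (d : ℤ) (φ ψ : Module.End k (W →₀ k)) : Prop where
  eq_add : ∃ χ ∈ bdd k wt (d - 1), φ = χ + ψ
  mem : ψ ∈ homog k wt d

namespace IsLeadTerm

lemma refl {d : ℤ} {ψ : Module.End k (W →₀ k)} (h : ψ ∈ homog k wt d) : IsLeadTerm wt d ψ ψ :=
  ⟨⟨0, Submodule.zero_mem _, (zero_add ψ).symm⟩, h⟩

lemma one : IsLeadTerm wt 0 (1 : Module.End k (W →₀ k)) 1 := by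
  refine refl fun w ↦ Finsupp.single_mem_supported k 1 ?_
  simp

lemma left_mem {d : ℤ} {φ ψ : Module.End k (W →₀ k)} (h : IsLeadTerm wt d φ ψ) :
    φ ∈ bdd k wt d := by
  obtain ⟨χ, hχ, rfl⟩ := h.eq_add
  exact Submodule.add_mem _ (bdd_mono (by omega) hχ) (homog_le_bdd d h.mem)

lemma add {d : ℤ} {φ ψ χ : Module.End k (W →₀ k)} (h : IsLeadTerm wt d φ ψ)
    (hχ : χ ∈ bdd k wt (d - 1)) : IsLeadTerm wt d (χ + φ) ψ := by
  obtain ⟨ξ, hξ, rfl⟩ := h.eq_add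
  exact ⟨⟨χ + ξ, Submodule.add_mem _ hχ hξ, (add_assoc _ _ _).symm⟩, h.mem⟩

lemma mul {d e : ℤ} {φ ψ φ' ψ' : Module.End k (W →₀ k)} (h : IsLeadTerm wt d φ ψ)
    (h' : IsLeadTerm wt e φ' ψ') : IsLeadTerm wt (d + e) (φ * φ') (ψ * ψ') := by
  have h1 := h'.left_mem
  obtain ⟨χ, hχ, rfl⟩ := h.eq_add
  obtain ⟨χ', hχ', rfl⟩ := h'.eq_add
  refine ⟨⟨χ * (χ' + ψ') + ψ * χ', Submodule.add_mem _ (bdd_mono (by omega) (bdd_mul hχ h1))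
    (bdd_mono (by omega) (bdd_mul (homog_le_bdd _ h.mem) hχ')), ?_⟩, homog_mul h.mem h'.mem⟩
  rw [add_mul, mul_add ψ, add_assoc]

lemma pow {d : ℤ} {φ ψ : Module.End k (W →₀ k)} (h : IsLeadTerm wt d φ ψ) (m : ℕ) :
    IsLeadTerm wt (m * d) (φ ^ m) (ψ ^ m) := by
  induction m with
  | zero => simpa using one
  | succ m ih =>
    rw [pow_succ, pow_succ]
    have := ih.mul h
    rwa [← add_one_mul, ← Nat.cast_succ] at this

/-- The leading term determines the summand of largest weight. -/
lemma apply_single {d : ℤ} {φ ψ : Module.End k (W →₀ k)} (h : IsLeadTerm wt d φ ψ) {b J : W}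
    {c : k} (hc : c ≠ 0) (hb : ψ (Finsupp.single b 1) = Finsupp.single J c) :
    φ (Finsupp.single b 1) J ≠ 0 ∧
      ∀ J', φ (Finsupp.single b 1) J' ≠ 0 → J' ≠ J → wt J' < wt J := by
  have h2 := h.mem b
  obtain ⟨χ, hχ, rfl⟩ := h.eq_add
  have h1 := hχ b
  rw [hb] at h2
  have hJ : wt J = wt b + d :=
    h2 (Finset.mem_coe.2 (Finsupp.mem_support_iff.2 (by rwa [Finsupp.single_eq_same])))
  have h4 : ∀ J', (χ + ψ) (Finsupp.single b 1) J' =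
      χ (Finsupp.single b 1) J' + Finsupp.single J c J' := fun J' ↦ by
    rw [LinearMap.add_apply, hb, Finsupp.add_apply]
  have h3 : ∀ J', (χ + ψ) (Finsupp.single b 1) J' ≠ Finsupp.single J c J' → wt J' < wt J := by
    intro J' hne
    rw [h4] at hne
    have : J' ∈ {w | wt w ≤ wt b + (d - 1)} := h1 (Finset.mem_coe.2 (Finsupp.mem_support_iff.2
      fun h0 ↦ hne (by rw [h0, zero_add])))
    have : wt J' ≤ wt b + (d - 1) := this
    omega
  refine ⟨fun h0 ↦ ?_, fun J' hne hJ' ↦ h3 J' ?_⟩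
  · exact lt_irrefl _ (h3 J (by rw [h0, Finsupp.single_eq_same]; exact hc.symm))
  · rwa [Finsupp.single_eq_of_ne hJ']

end IsLeadTerm

end lead

/-! ### Leading terms of Laurent polynomials -/

section

variable [AddAction ℤ A.Op]

/-- The weight of a word. -/
def OpOrder.weight (O : OpOrder A) {n : ℕ} (J : Fin n → A.Op) : ℤ := ∑ i : Fin n, (i : ℤ) * O.v (J i)

/-- The weight of a monomial. -/
def monoWeight (n : ℕ) (C : ℤ) (a : ℕ → ℤ) : ℤ := ∑ i : Fin n, C * ((i : ℤ) * a i)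

lemma monoWeight_add (n : ℕ) (C : ℤ) (a b : ℕ → ℤ) :
    monoWeight n C (a + b) = monoWeight n C a + monoWeight n C b := by
  simp only [monoWeight, Pi.add_apply, mul_add, Finset.sum_add_distrib]

lemma monoWeight_single {n : ℕ} (C : ℤ) {j : ℕ} (hj : j < n) (x : ℤ) :
    monoWeight n C (Pi.single j x) = C * (j * x) := by
  rw [monoWeight, Finset.sum_eq_single ⟨j, hj⟩]
  · rw [Pi.single_eq_same]
  · intro i _ hi
    rw [Pi.single_eq_of_ne fun h ↦ hi (Fin.ext h), mul_zero, mul_zero]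
  · exact fun h ↦ (h (Finset.mem_univ _)).elim

variable {O : OpOrder A} {C : ℤ} {n : ℕ}

lemma laurentAct_mono_mem (hv : ∀ (a : ℤ) g, O.v (a +ᵥ g) = C * a + O.v g)
    (a : ℕ → ℤ) :
    laurentAct A n (mono k a) ∈ homog k O.weight (monoWeight n C a) := by
  intro w
  rw [laurentAct_mono]
  refine Finsupp.single_mem_supported k 1 ?_
  change O.weight _ = _
  rw [OpOrder.weight, OpOrder.weight, monoWeight, ← Finset.sum_add_distrib]
  refine Finset.sum_congr rfl fun i _ ↦ ?_
  rw [wordShift, hv]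
  ring

lemma laurentAct_zvar_pow_mem (hv : ∀ (a : ℤ) g, O.v (a +ᵥ g) = C * a + O.v g)
    {j : ℕ} (hj : j < n) (m : ℕ) :
    laurentAct A n (zvar k j ^ m) ∈ homog k O.weight (C * (j * m)) := by
  rw [zvar, mono_pow, ← monoWeight_single C hj, ← Pi.single_smul, nsmul_one]
  exact laurentAct_mono_mem hv _

variable (p : ℕ)

/-- The weight of the leading monomial of `frobSym`. -/
def frobWeight (j m : ℕ) : ℤ := ∑ t ∈ Finset.range m, ((j : ℤ) - m + t) * p ^ t

lemma frobWeight_succ (j m : ℕ) :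
    frobWeight p (j + 1) (m + 1) = frobWeight p j m + j * p ^ m := by
  rw [frobWeight, Finset.sum_range_succ, frobWeight]
  congr 1
  · refine Finset.sum_congr rfl fun t _ ↦ ?_
    push_cast
    ring
  · push_cast
    ring

lemma frobWeight_lt [Fact p.Prime] (j m : ℕ) :
    frobWeight p j (m + 1) < frobWeight p (j + 1) (m + 1) := by
  have hp : (0 : ℤ) < p := by exact_mod_cast (Fact.out : p.Prime).pos
  refine Finset.sum_lt_sum_of_nonempty ⟨0, by simp⟩ fun t _ ↦ ?_
  have := pow_pos hp t
  push_cast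
  nlinarith

/-- The exponents of the leading monomial of `frobSym (i + d) d`. -/
def topExp (i d : ℕ) : ℕ → ℤ := fun x ↦ if i ≤ x ∧ x < i + d then p ^ (x - i) else 0

lemma topExp_succ (i d : ℕ) :
    topExp p i (d + 1) = topExp p i d + Pi.single (i + d) ((p : ℤ) ^ d) := by
  funext x
  rw [topExp, Pi.add_apply, topExp]
  by_cases hx : x = i + d
  · subst hx
    rw [Pi.single_eq_same, if_pos (by omega), if_neg (by omega), zero_add, Nat.add_sub_cancel_left]
  · rw [Pi.single_eq_of_ne hx, add_zero]
    by_cases h1 : i ≤ x ∧ x < i + d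
    · rw [if_pos h1, if_pos (by omega)]
    · rw [if_neg h1, if_neg (by omega)]

/-- The exponents of the leading monomial of `frobProd`. -/
def frobExp (m : ℕ → ℕ) : ℕ → ℤ
  | 0 => m 0
  | j + 1 => p * frobExp m j + m (j + 1)

lemma frobExp_eq (m : ℕ → ℕ) (j : ℕ) :
    frobExp p m j = ∑ i ∈ Finset.range (j + 1), (m i : ℤ) * p ^ (j - i) := by
  induction j with
  | zero => simp [frobExp]
  | succ j ih =>
    rw [frobExp, ih, Finset.sum_range_succ _ (j + 1), Nat.sub_self, pow_zero, mul_one,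
      Finset.mul_sum]
    congr 1
    refine Finset.sum_congr rfl fun i hi ↦ ?_
    rw [Nat.sub_add_comm (Nat.lt_succ_iff.1 (Finset.mem_range.1 hi)), pow_succ]
    ring

variable [Fact p.Prime]

lemma laurentAct_frobSym_mem (hv : ∀ (a : ℤ) g, O.v (a +ᵥ g) = C * a + O.v g)
    (hC : 1 ≤ C) {j : ℕ} (hj : j ≤ n) (m : ℕ) :
    laurentAct A n (frobSym k p j m) ∈ bdd k O.weight (C * frobWeight p j m) := by
  induction j generalizing m with
  | zero =>
    cases m with
    | zero => simpa [frobSym, frobWeight] using IsLeadTerm.one.left_mem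
    | succ m =>
      rw [frobSym, map_zero]
      exact Submodule.zero_mem _
  | succ j ih =>
    cases m with
    | zero => simpa [frobSym, frobWeight] using IsLeadTerm.one.left_mem
    | succ m =>
      rw [frobSym, map_add, map_mul]
      refine Submodule.add_mem _ (bdd_mono ?_ (ih (by omega) (m + 1))) ?_
      · exact mul_le_mul_of_nonneg_left (frobWeight_lt p j m).le (by omega)
      · have h1 := bdd_mul (homog_le_bdd _ (laurentAct_zvar_pow_mem (k := k) hv (n := n) (j := j)
          (by omega) (p ^ m))) (ih (by omega) m)
        refine bdd_mono (le_of_eq ?_) h1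
        rw [frobWeight_succ]
        push_cast
        ring

/-- The recursion splits off the power of the last variable. Monomials that omit this variable have
smaller weight, by `frobWeight_lt`, so the leading monomial uses the `d` largest indices. -/
lemma isLeadTerm_frobSym (hv : ∀ (a : ℤ) g, O.v (a +ᵥ g) = C * a + O.v g)
    (hC : 1 ≤ C) (i d : ℕ) (hn : i + d ≤ n) :
    IsLeadTerm O.weight (C * frobWeight p (i + d) d) (laurentAct A n (frobSym k p (i + d) d))
      (laurentAct A n (mono k (topExp p i d))) := by
  induction d with
  | zero =>
    have h1 : frobSym k p (i + 0) 0 = 1 := by cases i <;> rfl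
    have h2 : mono k (topExp p i 0) = 1 := by
      rw [← mono_zero]
      congr 1
      funext x
      exact if_neg (by omega)
    rw [h1, h2, map_one, frobWeight, Finset.sum_range_zero, mul_zero]
    exact IsLeadTerm.one
  | succ d ih =>
    have h1 := (IsLeadTerm.refl (laurentAct_zvar_pow_mem (k := k) hv (n := n) (j := i + d)
      (by omega) (p ^ d))).mul (ih (by omega))
    have h2 : mono k (topExp p i (d + 1)) =
        zvar k (i + d) ^ p ^ d * mono k (topExp p i d) := by
      rw [topExp_succ, zvar, mono_pow, mono_mul, add_comm, ← Pi.single_smul, nsmul_one,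
        Nat.cast_pow]
    have h3 := laurentAct_frobSym_mem (k := k) p hv hC (n := n) (j := i + d) (by omega) (d + 1)
    have h4 : C * ((i + d : ℕ) * (p ^ d : ℕ)) + C * frobWeight p (i + d) d =
        C * frobWeight p (i + d + 1) (d + 1) := by
      rw [frobWeight_succ]
      push_cast
      ring
    rw [h2, ← add_assoc, frobSym, map_add, map_mul, map_mul]
    rw [h4] at h1
    refine h1.add (bdd_mono ?_ h3)
    have := frobWeight_lt p (i + d) d
    nlinarith

/-- A product of powers of the elements `frobSym`. -/
def frobProd (n : ℕ) (m : ℕ → ℕ) : Laurent k :=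
  ∏ i ∈ Finset.range n, frobSym k p n (n - i) ^ m i

/-- Leading monomials multiply. The exponents of the product are a unitriangular function of `m`, so
`m` can be solved for from the desired exponents. -/
lemma isLeadTerm_frobProd (hv : ∀ (a : ℤ) g, O.v (a +ᵥ g) = C * a + O.v g)
    (hC : 1 ≤ C) (n : ℕ) (m : ℕ → ℕ) : ∃ d a,
    IsLeadTerm O.weight d (laurentAct A n (frobProd p n m)) (laurentAct A n (mono k a)) ∧
      ∀ j < n, a j = frobExp p m j := by
  have key (r : ℕ) (hr : r ≤ n) : ∃ d, IsLeadTerm O.weight d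
      (laurentAct A n (∏ i ∈ Finset.range r, frobSym k p n (n - i) ^ m i))
      (laurentAct A n (mono k (∑ i ∈ Finset.range r, m i • topExp p i (n - i)))) := by
    induction r with
    | zero =>
      refine ⟨0, ?_⟩
      rw [Finset.prod_range_zero, Finset.sum_range_zero, mono_zero, map_one]
      exact IsLeadTerm.one
    | succ r ih =>
      obtain ⟨d, hd⟩ := ih (by omega)
      have h1 := isLeadTerm_frobSym (k := k) p hv hC r (n - r) (n := n) (by omega)
      rw [Nat.add_sub_cancel' (by omega : r ≤ n)] at h1
      refine ⟨d + m r * (C * frobWeight p n (n - r)), ?_⟩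
      rw [Finset.prod_range_succ, Finset.sum_range_succ, ← mono_mul, ← mono_pow, map_mul, map_mul,
        map_pow, map_pow]
      exact hd.mul (h1.pow (m r))
  obtain ⟨d, hd⟩ := key n le_rfl
  refine ⟨d, _, hd, fun j hj ↦ ?_⟩
  rw [frobExp_eq, Finset.sum_apply]
  symm
  refine Finset.sum_subset_zero_on_sdiff (fun i hi ↦ ?_) (fun i hi ↦ ?_) fun i hi ↦ ?_
  · have := Finset.mem_range.1 hi
    exact Finset.mem_range.2 (by omega)
  · simp only [Finset.mem_sdiff, Finset.mem_range] at hi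
    rw [Pi.smul_apply, topExp, if_neg (by omega), smul_zero]
  · have := Finset.mem_range.1 hi
    rw [Pi.smul_apply, topExp, if_pos (by omega), nsmul_eq_mul]

lemma AdemGenerators.frobProd_mem_kos {p : ℕ} [Fact p.Prime] [CharP k p] (G : AdemGenerators p A)
    {n : ℕ} (m : ℕ → ℕ) {u : (Fin n → A.Op) →₀ k} (hu : u ∈ kos A k n) :
    laurentAct A n (frobProd p n m) u ∈ kos A k n := by
  rw [mem_kos] at hu ⊢
  intro i h
  have : frobProd p n m ∈ stab A h := Subalgebra.prod_mem _ fun j _ ↦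
    Subalgebra.pow_mem _ (G.frobSym_mem_stab h (by omega) _) _
  exact this u (hu i h)

end

end DyerLashof
end

noncomputable section

namespace DyerLashof

variable {k : Type} [Field k] {A : QuadraticPresentation k}

/-! ### Leading terms of the relations and binomial coefficients modulo `p` -/

lemma OpOrder.isLead_single_sub (O : OpOrder A) {g h : A.Op} (hi : O.Inadm h g)
    {u : A.Op × A.Op →₀ k} (hu : ∀ q, u q ≠ 0 → O.Step h g q.2 q.1) :
    O.IsLead (Finsupp.single (g, h) 1 - u) g h where
  inadm := hi
  coeff := by
    have : u (g, h) = 0 := by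
      by_contra h0
      exact lt_irrefl _ (hu _ h0).lt_left
    rw [Finsupp.sub_apply, this, Finsupp.single_eq_same, sub_zero]
  step q hq hne := by
    refine hu q fun h0 ↦ hq ?_
    rw [Finsupp.sub_apply, h0, Finsupp.single_eq_of_ne hne, sub_zero]

lemma sum_single_ne_zero {X : Type} {r : ℕ} {x : ℕ → X} {c : ℕ → k} {q : X}
    (h : (∑ i ∈ Finset.range r, Finsupp.single (x i) (c i)) q ≠ 0) :
    ∃ i, i < r ∧ c i ≠ 0 ∧ x i = q := by
  rw [Finsupp.finsetSum_apply] at h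
  obtain ⟨i, hi, h⟩ := Finset.exists_ne_zero_of_sum_ne_zero h
  refine ⟨i, Finset.mem_range.1 hi, fun h0 ↦ h ?_, ?_⟩
  · rw [h0, Finsupp.single_zero, Finsupp.zero_apply]
  · by_contra hne
    exact h (Finsupp.single_eq_of_ne (Ne.symm hne))

lemma relPairing_single_ne_zero [AddAction ℤ A.Op] {sg : A.Op × A.Op → k} {st : A.Op → A.Op}
    {q q' : A.Op × A.Op} {c c' : k} {a b : ℤ}
    (h : relPairing sg st (Finsupp.single q c) (pairShift a b (Finsupp.single q' c')) ≠ 0) :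
    a +ᵥ q'.1 = st q.1 ∧ b +ᵥ q'.2 = st q.2 := by
  rw [relPairing_single, pairShift_single] at h
  by_contra hne
  refine h ?_
  rw [Finsupp.single_eq_of_ne, mul_zero]
  exact fun he ↦ hne ⟨(congrArg Prod.fst he).symm, (congrArg Prod.snd he).symm⟩

lemma AdemGenerators.single_mem_span [AddAction ℤ A.Op] {p : ℕ} (G : AdemGenerators p A)
    {q : A.Op × A.Op} {c : k} (hq : Finsupp.single q c ∈ G.gens) (s : ℤ) :
    Finsupp.single ((p * s : ℤ) +ᵥ q.1, s +ᵥ q.2) c ∈ Submodule.span k A.rel := by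
  rw [← pairShift_single]
  exact G.pairShift_mem_span hq s

lemma le_of_binom_ne_zero {n m : ℤ} (h : (binom n m : k) ≠ 0) : m ≤ n := by
  by_contra hlt
  exact h (by rw [binom, if_neg fun h ↦ hlt h.2, Nat.cast_zero])

section

variable (p : ℕ)

lemma binom_self (r : ℕ) : binom ((p - 1) * ((r : ℤ) - r) - 1) r = 0 := by
  rw [sub_self, mul_zero, binom, if_neg (by omega)]

variable [Fact p.Prime]

lemma neg_one_pow_mul_binom {r i : ℕ} (hi : i < r) :
    (-1 : ZMod p) ^ (i + 1) * (binom ((p - 1) * (r - i) - 1) i : ZMod p) =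
      -ademCoeff (ZMod p) p i (r - i) := by
  obtain ⟨q, hq⟩ : ∃ q, p = q + 2 := ⟨p - 2, by have := (Fact.out : p.Prime).two_le; omega⟩
  obtain ⟨j, rfl⟩ := Nat.exists_eq_add_of_lt hi
  have e1 : (p - 1) * (i + j + 1 - i) = ((q + 1) * j + q) + 1 := by
    rw [hq, show i + j + 1 - i = j + 1 by omega, show q + 2 - 1 = q + 1 by omega]
    ring
  have e2 : ((p : ℤ) - 1) * (((i + j + 1 : ℕ) : ℤ) - i) - 1 = ((q + 1) * j + q : ℕ) := by
    rw [hq]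
    push_cast
    ring
  rw [ademCoeff_eq _ _ e1, e2, binom]
  split_ifs with h
  · rw [Int.toNat_natCast, Int.toNat_natCast, pow_succ]
    ring
  · rw [Nat.choose_eq_zero_of_lt (by omega)]
    simp

/-- The left-hand side of an Adem relation is absorbed as the summand `i = r`: there the binomial
coefficient is zero by convention, whereas `ademCoeff` has the value `1`. Each relation becomes one
uniform sum. -/
lemma sub_sum_binom {M : Type} [AddCommGroup M] [Module (ZMod p) M] (r : ℕ) (x : ℕ → M) :
    x r - ∑ i ∈ Finset.range (r + 1),
        ((-1 : ZMod p) ^ (i + 1) * (binom ((p - 1) * (r - i) - 1) i : ZMod p)) • x i =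
      ∑ i ∈ Finset.range (r + 1), ademCoeff (ZMod p) p i (r - i) • x i := by
  rw [Finset.sum_range_succ, Finset.sum_range_succ, binom_self, Nat.cast_zero, mul_zero, zero_smul,
    add_zero, Nat.sub_self, ademCoeff_zero_right, one_smul, sub_eq_neg_add,
    ← Finset.sum_neg_distrib]
  congr 1
  refine Finset.sum_congr rfl fun i hi ↦ ?_
  rw [neg_one_pow_mul_binom p (Finset.mem_range.1 hi), neg_smul, neg_neg]

end

/-! ### The prime `2` -/

section two

instance : AddAction ℤ big₂.Op := inferInstanceAs (AddAction ℤ ℤ)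

/-- The order of the operations `Q^s`. -/
def order₂ : OpOrder big₂ where
  v := Equiv.refl ℤ
  deg_lt := id
  deg_zero := rfl

lemma rel₂_eq (s : ℤ) (r : ℕ) :
    (Finsupp.single (2 * s + r + 1, s) 1 -
      ∑ i ∈ Finset.range (r + 1),
        Finsupp.single (2 * s + i + 1, r + s - i) (binom (r - i - 1) i : ZMod 2) :
          ℤ × ℤ →₀ ZMod 2) =
      ademFamily (Op := ℤ) 2 (Finsupp.single (1, 0) 1) s r := by
  have := sub_sum_binom 2 r fun i ↦ (Finsupp.single (2 * s + i + 1, r + s - i) 1 : ℤ × ℤ →₀ ZMod 2)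
  rw [ademFamily_eq]
  refine Eq.trans ?_ (this.trans ?_)
  · congr 1
    · rw [show (r : ℤ) + s - r = s by ring]
    · refine Finset.sum_congr rfl fun i _ ↦ ?_
      have h1 : (-1 : ZMod 2) = 1 := by decide
      have h2 : (((2 : ℕ) : ℤ) - 1) * ((r : ℤ) - i) - 1 = r - i - 1 := by push_cast; ring
      rw [h1, one_pow, one_mul, h2, Finsupp.smul_single, smul_eq_mul, mul_one]
  · refine Finset.sum_congr rfl fun i hi ↦ ?_
    have hi' : i ≤ r := Nat.lt_succ_iff.1 (Finset.mem_range.1 hi)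
    rw [pairShift_single]
    congr 3
    change _ = s + _ + 0
    push_cast [hi']
    ring

/-- The relations of the big Steenrod algebra for the prime `2` come from `Q^1 Q^0 = 0`. -/
def generators₂ : AdemGenerators 2 big₂ where
  gens := {Finsupp.single ((1 : ℤ), (0 : ℤ)) 1}
  span_rel := by
    congr 1
    ext ρ
    constructor
    · rintro ⟨s, r, rfl⟩
      exact ⟨_, rfl, s, r, rel₂_eq s r⟩
    · rintro ⟨_, rfl, s, r, rfl⟩
      exact ⟨s, r, (rel₂_eq s r).symm⟩

lemma isLead₂ (s : ℤ) (r : ℕ) : order₂.IsLead (Finsupp.single ((2 * s + r + 1 : ℤ), s) 1 -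
      ∑ i ∈ Finset.range (r + 1),
        Finsupp.single ((2 * s + i + 1 : ℤ), (r + s - i : ℤ)) (binom (r - i - 1) i : ZMod 2))
      (2 * s + r + 1 : ℤ) s := by
  refine order₂.isLead_single_sub ?_ fun q hq ↦ ?_
  · change s + s < 2 * s + r + 1
    omega
  · obtain ⟨i, hi, hc, rfl⟩ := sum_single_ne_zero hq
    -- A nonzero coefficient forces `i ≤ r - i - 1`; all five conditions of a step follow from this
    -- inequality.
    have := le_of_binom_ne_zero hc
    refine ⟨?_, ?_, ?_, ?_, ?_⟩
    · change (r + s - i : ℤ) + (2 * s + i + 1) = s + (2 * s + r + 1)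
      ring
    · change (2 * s + i + 1 : ℤ) < 2 * s + r + 1
      omega
    · change s < (r + s - i : ℤ)
      omega
    · change s + s < (2 * s + i + 1 : ℤ)
      omega
    · change (2 * s + i + 1 : ℤ) ≤ s + (r + s - i)
      omega

/-- The rewriting system of the Adem relations for the prime `2`. -/
def adem₂ : AdemSystem big₂ where
  toOpOrder := order₂
  rel_lead := by
    rintro _ ⟨s, r, rfl⟩
    exact ⟨_, _, isLead₂ s r⟩
  exists_rel (g h : ℤ) hi := by
    have hi' : (h + h : ℤ) < g := hi
    obtain ⟨r, hr⟩ := Int.eq_ofNat_of_zero_le (show 0 ≤ g - 2 * h - 1 by omega)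
    obtain rfl : g = 2 * h + r + 1 := by omega
    exact ⟨_, ⟨h, r, rfl⟩, isLead₂ h r⟩

/-- In the word `b` each index is twice the preceding one plus one. All its consecutive composites
are then translates of `Q^1 Q^0 = 0`, so `b` lies in the Koszul complex. A product of powers of
`frobSym` moves its leading word to `J`. -/
lemma koszul₂ {n : ℕ} (J : Fin n → ℤ) (hJ : order₂.Coadm (n := n) J) :
    ∃ κ ∈ kos big₂ (ZMod 2) n, κ J ≠ 0 ∧
      ∀ J', κ J' ≠ 0 → J' ≠ J → order₂.weight J' < order₂.weight J := by
  let x : ℕ → ℤ := fun j ↦ if h : j < n then J ⟨j, h⟩ else 0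
  -- The exponents measure the excess of `J` over the recursion `2 * x + 1`. Coadmissibility makes
  -- them nonnegative, so `toNat` truncates nothing; `m 0 = 0` because the first letter of `b` is
  -- free.
  let m : ℕ → ℕ := fun j ↦ match j with
    | 0 => 0
    | j + 1 => (x (j + 1) - 2 * x j - 1).toNat
  let b : Fin n → big₂.Op := fun j ↦ (x j - frobExp 2 m j : ℤ)
  have hx (j : Fin n) : J j = x j := by simp [x]
  have hb : Finsupp.single b 1 ∈ kos big₂ (ZMod 2) n := by
    rw [mem_kos]
    intro i h
    have h1 : x i + x i < x (i + 1) := by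
      have : J ⟨i, by omega⟩ + J ⟨i, by omega⟩ < J ⟨i + 1, h⟩ := hJ i h
      rw [hx, hx] at this
      exact this
    have h2 : frobExp 2 m (i + 1) = 2 * frobExp 2 m i + (x (i + 1) - 2 * x i - 1) := by
      rw [frobExp]
      congr 1
      exact Int.toNat_of_nonneg (by omega)
    rw [← insPair_self h b]
    refine insPair_mem h b ?_
    have := generators₂.single_mem_span rfl (x i - frobExp 2 m i)
    refine (congrArg (fun q ↦ Finsupp.single q (1 : ZMod 2) ∈ Submodule.span (ZMod 2) big₂.rel)
      (Prod.ext ?_ ?_)).mp this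
    · change ((2 : ℕ) : ℤ) * (x i - frobExp 2 m i) + 1 = x (i + 1) - frobExp 2 m (i + 1)
      rw [h2]
      push_cast
      ring
    · change (x i - frobExp 2 m i) + 0 = x i - frobExp 2 m i
      ring
  obtain ⟨d, a, hd, ha⟩ := isLeadTerm_frobProd (k := ZMod 2) (O := order₂) (C := 1) 2
    (fun a g ↦ (by rw [one_mul]; rfl)) le_rfl n m
  refine ⟨_, generators₂.frobProd_mem_kos m hb, hd.apply_single one_ne_zero ?_⟩
  rw [laurentAct_mono]
  congr 1
  funext j
  rw [wordShift, ha j j.2]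
  refine Eq.trans ?_ (hx j).symm
  change frobExp 2 m j + (x j - frobExp 2 m j) = x j
  ring

lemma intCast_units_zmod_two (u : ℤˣ) : ((u : ℤ) : ZMod 2) = 1 := by
  rcases Int.units_eq_one_or u with rfl | rfl
  · rfl
  · decide

/-- The Koszul system of the big Steenrod algebra for the prime `2`. -/
def koszulSystem₂ : KoszulSystem big₂ where
  toAdemSystem := adem₂
  star := star₂
  star_star (g : ℤ) := by
    change (-(-g - 1) - 1 : ℤ) = g
    ring
  inadm_star (h g : ℤ) := by
    change (-h - 1 + (-h - 1) : ℤ) < -g - 1 ↔ ¬ (h + h : ℤ) < g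
    omega
  deg_star _ := rfl
  sgn _ _ := 1
  sgn_ne _ _ := one_ne_zero
  dual ρ hρ ρ' hρ' i := by
    refine generators₂.pairing_eq_zero (sg := fun _ ↦ 1 * 1) (st := fun g : big₂.Op ↦ star₂ g) (fun a (g : ℤ) ↦ ?_)
      (fun _ _ _ ↦ rfl) ?_ hρ hρ'
    · change (-(a + g) - 1 : ℤ) = -a + (-g - 1)
      ring
    · rintro _ rfl _ rfl a b h
      obtain ⟨h1, h2⟩ := relPairing_single_ne_zero h
      -- Only `a = -3`, `b = -1` gives a nonzero value, and then `a = 2 * b - 1`.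
      have h1' : (a + 1 : ℤ) = -1 - 1 := h1
      have h2' : (b + 0 : ℤ) = -0 - 1 := h2
      push_cast
      omega
  wt := order₂.weight
  koszul J hJ := koszul₂ J hJ
  opp_sign _ _ := ⟨1, fun _ _ ↦ by rw [intCast_units_zmod_two, one_mul, one_mul]⟩

end two

end DyerLashof
end

noncomputable section

namespace DyerLashof

/-! ### Odd primes: the relations -/

lemma ademFamily_sub {Op : Type} [AddAction ℤ Op] {k : Type} [Field k] (p : ℕ) (u u' : Op × Op →₀ k)
    (s : ℤ) (r : ℕ) :
    ademFamily p (u - u') s r = ademFamily p u s r - ademFamily p u' s r := by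
  rw [ademFamily, map_sub, map_sub, ademFamily, ademFamily]

section odd

variable (p : ℕ) [Fact p.Prime]

/-- The operation `Q^s_δ`. -/
def opOdd (δ : Fin 2) (s : ℤ) : (bigOdd p).Op := ((δ, s) : Fin 2 × ℤ)

variable {p}

/-- The index `δ` of the operation `Q^s_δ`. -/
def decOdd (g : (bigOdd p).Op) : Fin 2 := Prod.fst (α := Fin 2) (β := ℤ) g

/-- The index `s` of the operation `Q^s_δ`. -/
def idxOdd (g : (bigOdd p).Op) : ℤ := Prod.snd (α := Fin 2) (β := ℤ) g

lemma opOdd_eta (g : (bigOdd p).Op) : opOdd p (decOdd g) (idxOdd g) = g := rfl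

@[simp]
lemma decOdd_opOdd (δ : Fin 2) (s : ℤ) : decOdd (opOdd p δ s) = δ := rfl

@[simp]
lemma idxOdd_opOdd (δ : Fin 2) (s : ℤ) : idxOdd (opOdd p δ s) = s := rfl

lemma opOdd_injective {δ ε : Fin 2} {s t : ℤ} (h : opOdd p δ s = opOdd p ε t) : δ = ε ∧ s = t :=
  ⟨congrArg decOdd h, congrArg idxOdd h⟩

instance : AddAction ℤ (bigOdd p).Op where
  vadd a g := opOdd p (decOdd g) (a + idxOdd g)
  zero_vadd g := congrArg (opOdd p (decOdd g)) (zero_add (idxOdd g))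
  add_vadd a b g := congrArg (opOdd p (decOdd g)) (add_assoc a b (idxOdd g))

@[simp]
lemma vadd_opOdd (a : ℤ) (δ : Fin 2) (s : ℤ) : a +ᵥ opOdd p δ s = opOdd p δ (a + s) := rfl

lemma deg_opOdd (δ : Fin 2) (s : ℤ) :
    (bigOdd p).deg (opOdd p δ s) = 2 * s * (p - 1) - (δ : ℕ) := rfl

variable (p) in
/-- The order of the operations `Q^s_δ`. -/
def orderOdd : OpOrder (bigOdd p) where
  v := {
    toFun g := 2 * idxOdd g - (decOdd g : ℕ)
    invFun m := opOdd p (if m % 2 = 0 then 0 else 1) ((m + 1) / 2)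
    left_inv g := by
      rw [← opOdd_eta g]
      generalize decOdd g = δ
      generalize idxOdd g = s
      fin_cases δ
      · change opOdd p (if (2 * s - ((0 : ℕ) : ℤ)) % 2 = 0 then 0 else 1) _ = opOdd p 0 s
        rw [if_pos (by omega)]
        congr 1
        change (2 * s - ((0 : ℕ) : ℤ) + 1) / 2 = s
        omega
      · change opOdd p (if (2 * s - ((1 : ℕ) : ℤ)) % 2 = 0 then 0 else 1) _ = opOdd p 1 s
        rw [if_neg (by omega)]
        congr 1
        change (2 * s - ((1 : ℕ) : ℤ) + 1) / 2 = s
        omega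
    right_inv m := by
      change 2 * ((m + 1) / 2) - (((if m % 2 = 0 then 0 else 1 : Fin 2) : ℕ) : ℤ) = m
      split_ifs
      · change 2 * ((m + 1) / 2) - ((0 : ℕ) : ℤ) = m
        omega
      · change 2 * ((m + 1) / 2) - ((1 : ℕ) : ℤ) = m
        omega }
  deg_lt {g h} hlt := by
    have hp : (2 : ℤ) ≤ p := by exact_mod_cast (Fact.out : p.Prime).two_le
    have hlt' : 2 * idxOdd g - (decOdd g : ℕ) < 2 * idxOdd h - (decOdd h : ℕ) := hlt
    change 2 * idxOdd g * ((p : ℤ) - 1) - (decOdd g : ℕ) < 2 * idxOdd h * (p - 1) - (decOdd h : ℕ)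
    have h1 := (decOdd g).2
    have h2 := (decOdd h).2
    rcases (show idxOdd g ≤ idxOdd h by omega).lt_or_eq with hi | hi
    · nlinarith
    · rw [hi] at hlt' ⊢
      omega
  deg_zero := by
    change 2 * (((0 : ℤ) + 1) / 2) * ((p : ℤ) - 1) - ((0 : ℕ) : ℤ) = 0
    simp

lemma v_opOdd (δ : Fin 2) (s : ℤ) : (orderOdd p).v (opOdd p δ s) = 2 * s - (δ : ℕ) := rfl

lemma inadm_opOdd {δ ε : Fin 2} {s t : ℤ} :
    (orderOdd p).Inadm (opOdd p δ s) (opOdd p ε t) ↔ p * s - (δ : ℕ) < t := by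
  rw [OpOrder.Inadm, v_opOdd, v_opOdd, deg_opOdd]
  have h1 := δ.2
  have h2 := ε.2
  have : 2 * s - ((δ : ℕ) : ℤ) + (2 * s * (p - 1) - (δ : ℕ)) = 2 * (p * s) - 2 * (δ : ℕ) := by ring
  rw [this]
  omega

variable (p) in
/-- A basis element of the space of pairs of operations. -/
def pairOdd (ε : Fin 2) (x : ℤ) (δ : Fin 2) (y : ℤ) :
    (bigOdd p).Op × (bigOdd p).Op →₀ ZMod p :=
  Finsupp.single (opOdd p ε x, opOdd p δ y) 1

lemma pairShift_pairOdd (a b : ℤ) (ε : Fin 2) (x : ℤ) (δ : Fin 2) (y : ℤ) :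
    pairShift a b (pairOdd p ε x δ y) = pairOdd p ε (a + x) δ (b + y) :=
  pairShift_single _ _ _ _

lemma ademFamily_pairOdd (ε δ : Fin 2) (x s : ℤ) (r : ℕ) :
    ademFamily p (pairOdd p ε x δ 0) s r = ∑ i ∈ Finset.range (r + 1),
      ademCoeff (ZMod p) p i (r - i) • pairOdd p ε (p * s + i + x) δ (r + s - i) := by
  rw [ademFamily_eq]
  refine Finset.sum_congr rfl fun i hi ↦ ?_
  have hi' : i ≤ r := Nat.lt_succ_iff.1 (Finset.mem_range.1 hi)
  rw [pairShift_pairOdd]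
  congr 2
  push_cast [hi']
  ring

lemma sum_relOdd (ε δ : Fin 2) (x s : ℤ) (r : ℕ) :
    pairOdd p ε (p * s + r + x) δ s - ∑ i ∈ Finset.range (r + 1),
      ((-1 : ZMod p) ^ (i + 1) * (binom ((p - 1) * (r - i) - 1) i : ZMod p)) •
        pairOdd p ε (p * s + i + x) δ (r + s - i) = ademFamily p (pairOdd p ε x δ 0) s r := by
  have := sub_sum_binom p r fun i ↦ pairOdd p ε (p * s + i + x) δ (r + s - i)
  rw [ademFamily_pairOdd, ← this]
  congr 2
  ring

lemma smul_pairOdd (c : ZMod p) (ε : Fin 2) (x : ℤ) (δ : Fin 2) (y : ℤ) :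
    c • pairOdd p ε x δ y = Finsupp.single (opOdd p ε x, opOdd p δ y) c := by
  rw [pairOdd, Finsupp.smul_single, smul_eq_mul, mul_one]

/-- The generator `Q^0 Q_1^0 - Q_1^0 Q^0` of the relations. -/
def commOdd (p : ℕ) [Fact p.Prime] : (bigOdd p).Op × (bigOdd p).Op →₀ ZMod p :=
  pairOdd p 0 0 1 0 - pairOdd p 1 0 0 0

/-- By `ademCoeff_sub`, the coefficients of the first sum are differences of Adem coefficients. The
sum is thus the family of `Q_1^0 Q^0` minus the family of `Q_1^1 Q^0` for `r - 1`. The second Adem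
relation is the family of a commutator corrected by an instance of the third relation. -/
lemma sum_commOdd (s : ℤ) (r : ℕ) :
    pairOdd p 0 (p * s + r) 1 s - (∑ i ∈ Finset.range (r + 1),
        ((-1 : ZMod p) ^ i * (binom ((p - 1) * (r - i)) i : ZMod p)) •
          pairOdd p 1 (p * s + i) 0 (r + s - i) +
      ∑ i ∈ Finset.range (r + 1),
        ((-1 : ZMod p) ^ (i + 1) * (binom ((p - 1) * (r - i) - 1) i : ZMod p)) •
          pairOdd p 0 (p * s + i) 1 (r + s - i)) =
      ademFamily p (commOdd p) s r +
        if r = 0 then 0 else ademFamily p (pairOdd p 1 1 0 0) s (r - 1) := by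
  have h1 := sum_relOdd (p := p) 0 1 0 s r
  simp only [add_zero] at h1
  rw [commOdd, ademFamily_sub, ← h1, ademFamily_pairOdd]
  have hp : 1 ≤ p := (Fact.out : p.Prime).one_lt.le
  have h2 (i j : ℕ) : (-1 : ZMod p) ^ (i + 1) *
      (binom ((p - 1) * (((i + 1 + j : ℕ) : ℤ) - (i + 1 : ℕ))) (i + 1 : ℕ) : ZMod p) =
        ademCoeff (ZMod p) p (i + 1) j - ademCoeff (ZMod p) p i j := by
    have e : ((p : ℤ) - 1) * (((i + 1 + j : ℕ) : ℤ) - (i + 1 : ℕ)) = ((p - 1) * j : ℕ) := by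
      push_cast [hp]
      ring
    rw [ademCoeff_sub, e, binom]
    split_ifs with h
    · rw [Int.toNat_natCast, Int.toNat_natCast]
    · rw [Nat.choose_eq_zero_of_lt (by omega)]
  have h3 : ∑ i ∈ Finset.range (r + 1),
        ((-1 : ZMod p) ^ i * (binom ((p - 1) * (r - i)) i : ZMod p)) •
          pairOdd p 1 (p * s + i) 0 (r + s - i) =
      (∑ i ∈ Finset.range (r + 1), ademCoeff (ZMod p) p i (r - i) •
        pairOdd p 1 (p * s + i + 0) 0 (r + s - i)) -
      if r = 0 then 0 else ademFamily p (pairOdd p 1 1 0 0) s (r - 1) := by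
    simp only [add_zero]
    rw [Finset.sum_range_succ', Finset.sum_range_succ']
    have e0 : (-1 : ZMod p) ^ 0 * (binom ((p - 1) * ((r : ℤ) - (0 : ℕ))) (0 : ℕ) : ZMod p) = 1 := by
      have h5 : (0 : ℤ) ≤ (p - 1) * ((r : ℤ) - (0 : ℕ)) := by
        push_cast
        have : (1 : ℤ) ≤ p := by exact_mod_cast hp
        have : (0 : ℤ) ≤ r := Int.natCast_nonneg r
        nlinarith
      rw [binom, if_pos ⟨le_refl _, h5⟩]
      simp
    rw [e0, ademCoeff_zero_left]
    refine Eq.trans ?_ (add_sub_right_comm _ _ _).symm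
    congr 1
    cases r with
    | zero => simp
    | succ r =>
      rw [if_neg (Nat.succ_ne_zero r), Nat.add_sub_cancel, ademFamily_pairOdd,
        ← Finset.sum_sub_distrib]
      refine Finset.sum_congr rfl fun i hi ↦ ?_
      obtain ⟨j, rfl⟩ := Nat.exists_eq_add_of_le (Nat.lt_succ_iff.1 (Finset.mem_range.1 hi))
      have e1 : i + j + 1 = i + 1 + j := by omega
      rw [e1, h2, sub_smul, Nat.add_sub_cancel_left, Nat.add_sub_cancel_left]
      congr 3
      · push_cast
        ring
      · push_cast
        ring
  rw [h3]
  abel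

lemma mem_relOdd {ρ : (bigOdd p).Op × (bigOdd p).Op →₀ ZMod p} : ρ ∈ (bigOdd p).rel ↔
    (((∃ (s : ℤ) (r : ℕ), ρ = ademFamily p (pairOdd p 0 1 0 0) s r) ∨
      ∃ (s : ℤ) (r : ℕ), ρ = ademFamily p (commOdd p) s r +
        if r = 0 then 0 else ademFamily p (pairOdd p 1 1 0 0) s (r - 1)) ∨
      ∃ (s : ℤ) (r : ℕ), ρ = ademFamily p (pairOdd p 1 1 0 0) s r) ∨
      ∃ (s : ℤ) (r : ℕ), ρ = ademFamily p (pairOdd p 1 0 1 0) s r := by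
  have e (ε δ : Fin 2) (x s : ℤ) (r : ℕ) := sum_relOdd (p := p) ε δ x s r
  have e' := sum_commOdd (p := p)
  simp only [smul_pairOdd] at e e'
  have e4 (s : ℤ) (r : ℕ) := e 1 1 0 s r
  simp only [add_zero] at e4
  refine or_congr (or_congr (or_congr ?_ ?_) ?_) ?_
  · exact exists_congr fun s ↦ exists_congr fun r ↦ Eq.congr_right (e 0 0 1 s r)
  · exact exists_congr fun s ↦ exists_congr fun r ↦ Eq.congr_right (e' s r)
  · exact exists_congr fun s ↦ exists_congr fun r ↦ Eq.congr_right (e 1 0 1 s r)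
  · exact exists_congr fun s ↦ exists_congr fun r ↦ Eq.congr_right (e4 s r)

variable (p) in
/-- Generators of the relations of the big Steenrod algebra for an odd prime. -/
def generatorsOdd : AdemGenerators p (bigOdd p) where
  gens := {u | u = pairOdd p 0 1 0 0 ∨ u = commOdd p ∨ u = pairOdd p 1 1 0 0 ∨
    u = pairOdd p 1 0 1 0}
  span_rel := by
    refine le_antisymm (Submodule.span_le.2 fun ρ hρ ↦ ?_) (Submodule.span_le.2 ?_)
    · rcases mem_relOdd.1 hρ with ((⟨s, r, rfl⟩ | ⟨s, r, rfl⟩) | ⟨s, r, rfl⟩) | ⟨s, r, rfl⟩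
      · exact Submodule.subset_span ⟨_, Or.inl rfl, s, r, rfl⟩
      · refine Submodule.add_mem _ (Submodule.subset_span ⟨_, Or.inr (Or.inl rfl), s, r, rfl⟩) ?_
        split_ifs
        · exact Submodule.zero_mem _
        · exact Submodule.subset_span ⟨_, Or.inr (Or.inr (Or.inl rfl)), s, _, rfl⟩
      · exact Submodule.subset_span ⟨_, Or.inr (Or.inr (Or.inl rfl)), s, r, rfl⟩
      · exact Submodule.subset_span ⟨_, Or.inr (Or.inr (Or.inr rfl)), s, r, rfl⟩
    · have h3 (s : ℤ) (r : ℕ) : ademFamily p (pairOdd p 1 1 0 0) s r ∈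
          Submodule.span (ZMod p) (bigOdd p).rel :=
        Submodule.subset_span (mem_relOdd.2 (Or.inl (Or.inr ⟨s, r, rfl⟩)))
      rintro _ ⟨_, rfl | rfl | rfl | rfl, s, r, rfl⟩
      · exact Submodule.subset_span (mem_relOdd.2 (Or.inl (Or.inl (Or.inl ⟨s, r, rfl⟩))))
      · have h2 : ademFamily p (commOdd p) s r + (if r = 0 then 0 else
            ademFamily p (pairOdd p 1 1 0 0) s (r - 1)) ∈ Submodule.span (ZMod p) (bigOdd p).rel :=
          Submodule.subset_span (mem_relOdd.2 (Or.inl (Or.inl (Or.inr ⟨s, r, rfl⟩))))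
        refine (Submodule.add_mem_iff_left _ ?_).1 h2
        split_ifs
        · exact Submodule.zero_mem _
        · exact h3 _ _
      · exact h3 s r
      · exact Submodule.subset_span (mem_relOdd.2 (Or.inr ⟨s, r, rfl⟩))

end odd

end DyerLashof
end

noncomputable section

namespace DyerLashof

/-! ### Odd primes: the rewriting system and the duality of the relations -/

section odd

variable {p : ℕ} [Fact p.Prime]

/-- The hypothesis `hi` is what a nonzero binomial coefficient provides, and `x = 1 - δ` is the
least offset for which the composite is inadmissible. -/
lemma step_opOdd {ε δ : Fin 2} {x s : ℤ} (hx : x = 1 - (δ : ℕ)) {r i : ℕ}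
    (hi : (i : ℤ) ≤ (p - 1) * (r - i) - 1) :
    (orderOdd p).Step (opOdd p δ s) (opOdd p ε (p * s + r + x)) (opOdd p δ (r + s - i))
      (opOdd p ε (p * s + i + x)) := by
  have hp : (2 : ℤ) ≤ p := by exact_mod_cast (Fact.out : p.Prime).two_le
  have hr : (i : ℤ) < r := by
    by_contra h
    nlinarith
  have h1 := δ.2
  have h2 := ε.2
  refine ⟨?_, ?_, ?_, ?_, ?_⟩
  · simp only [deg_opOdd]
    ring
  · rw [v_opOdd, v_opOdd]
    omega
  · rw [v_opOdd, v_opOdd]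
    omega
  · change (orderOdd p).Inadm _ _
    rw [inadm_opOdd]
    omega
  · rw [v_opOdd, v_opOdd, deg_opOdd]
    have e : 2 * s - ((δ : ℕ) : ℤ) + (2 * (r + s - i) * (p - 1) - (δ : ℕ)) =
      2 * (p * s) + 2 * ((p - 1) * (r - i)) - 2 * (δ : ℕ) := by ring
    rw [e]
    generalize ((p : ℤ) - 1) * (r - i) = y at hi ⊢
    omega

lemma step_commOdd {s : ℤ} {r i : ℕ} (hr : i ≤ r) (hi : (i : ℤ) ≤ (p - 1) * (r - i)) :
    (orderOdd p).Step (opOdd p 1 s) (opOdd p 0 (p * s + r)) (opOdd p 0 (r + s - i))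
      (opOdd p 1 (p * s + i)) := by
  have h0 : (((0 : Fin 2) : ℕ) : ℤ) = 0 := rfl
  have h1 : (((1 : Fin 2) : ℕ) : ℤ) = 1 := rfl
  refine ⟨?_, ?_, ?_, ?_, ?_⟩
  · simp only [deg_opOdd, h0, h1]
    ring
  · rw [v_opOdd, v_opOdd]
    omega
  · rw [v_opOdd, v_opOdd]
    omega
  · change (orderOdd p).Inadm _ _
    rw [inadm_opOdd]
    omega
  · rw [v_opOdd, v_opOdd, deg_opOdd, h0, h1]
    have e : 2 * s - (1 : ℤ) + (2 * (r + s - i) * (p - 1) - 0) =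
      2 * (p * s) + 2 * ((p - 1) * (r - i)) - 1 := by ring
    rw [e]
    generalize ((p : ℤ) - 1) * (r - i) = y at hi ⊢
    omega

lemma isLead_opOdd (ε δ : Fin 2) {x : ℤ} (hx : x = 1 - (δ : ℕ)) (s : ℤ) (r : ℕ) :
    (orderOdd p).IsLead (Finsupp.single (opOdd p ε (p * s + r + x), opOdd p δ s) 1 -
      ∑ i ∈ Finset.range (r + 1),
        Finsupp.single (opOdd p ε (p * s + i + x), opOdd p δ (r + s - i))
          ((-1 : ZMod p) ^ (i + 1) * (binom ((p - 1) * (r - i) - 1) i : ZMod p)))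
      (opOdd p ε (p * s + r + x)) (opOdd p δ s) := by
  refine (orderOdd p).isLead_single_sub ?_ fun q hq ↦ ?_
  · rw [inadm_opOdd]
    omega
  · obtain ⟨i, hi, hc, rfl⟩ := sum_single_ne_zero hq
    exact step_opOdd hx (le_of_binom_ne_zero (right_ne_zero_of_mul hc))

lemma isLead_commOdd (s : ℤ) (r : ℕ) :
    (orderOdd p).IsLead (Finsupp.single (opOdd p 0 (p * s + r), opOdd p 1 s) 1 -
      (∑ i ∈ Finset.range (r + 1),
        Finsupp.single (opOdd p 1 (p * s + i), opOdd p 0 (r + s - i))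
          ((-1 : ZMod p) ^ i * (binom ((p - 1) * (r - i)) i : ZMod p)) +
      ∑ i ∈ Finset.range (r + 1),
        Finsupp.single (opOdd p 0 (p * s + i), opOdd p 1 (r + s - i))
          ((-1 : ZMod p) ^ (i + 1) * (binom ((p - 1) * (r - i) - 1) i : ZMod p))))
      (opOdd p 0 (p * s + r)) (opOdd p 1 s) := by
  refine (orderOdd p).isLead_single_sub ?_ fun q hq ↦ ?_
  · rw [inadm_opOdd]
    have : (((1 : Fin 2) : ℕ) : ℤ) = 1 := rfl
    omega
  · rw [Finsupp.add_apply] at hq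
    by_cases h1 : (∑ i ∈ Finset.range (r + 1),
        Finsupp.single (opOdd p 1 (p * s + i), opOdd p 0 (r + s - i))
          ((-1 : ZMod p) ^ i * (binom ((p - 1) * (r - i)) i : ZMod p))) q = 0
    · rw [h1, zero_add] at hq
      obtain ⟨i, hi, hc, rfl⟩ := sum_single_ne_zero hq
      have := step_opOdd (ε := 0) (δ := 1) (x := 0) (s := s) rfl
        (le_of_binom_ne_zero (right_ne_zero_of_mul hc))
      simpa only [add_zero] using this
    · obtain ⟨i, hi, hc, rfl⟩ := sum_single_ne_zero h1
      exact step_commOdd (by omega) (le_of_binom_ne_zero (right_ne_zero_of_mul hc))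

variable (p) in
/-- The rewriting system of the Adem relations for an odd prime. -/
def ademOdd : AdemSystem (bigOdd p) where
  toOpOrder := orderOdd p
  rel_lead := by
    rintro _ (((⟨s, r, rfl⟩ | ⟨s, r, rfl⟩) | ⟨s, r, rfl⟩) | ⟨s, r, rfl⟩)
    · exact ⟨_, _, isLead_opOdd 0 0 rfl s r⟩
    · exact ⟨_, _, isLead_commOdd s r⟩
    · exact ⟨_, _, isLead_opOdd 1 0 rfl s r⟩
    · have := isLead_opOdd (p := p) 1 1 (x := 0) rfl s r
      simp only [add_zero] at this
      exact ⟨_, _, this⟩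
  exists_rel g h hi := by
    rw [← opOdd_eta g, ← opOdd_eta h] at hi ⊢
    generalize decOdd g = ε at hi ⊢
    generalize decOdd h = δ at hi ⊢
    generalize idxOdd g = t at hi ⊢
    generalize idxOdd h = s at hi ⊢
    rw [inadm_opOdd] at hi
    obtain ⟨r, hr⟩ := Int.eq_ofNat_of_zero_le
      (show 0 ≤ t - p * s - (1 - ((δ : ℕ) : ℤ)) by omega)
    obtain rfl : t = p * s + r + (1 - ((δ : ℕ) : ℤ)) := by omega
    have h1 := isLead_opOdd (p := p) ε δ rfl s r
    have h2 := isLead_commOdd (p := p) s r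
    fin_cases ε <;> fin_cases δ
    · exact ⟨_, Or.inl (Or.inl (Or.inl ⟨s, r, rfl⟩)), h1⟩
    · have e : (p * s + r + (1 - ((1 : ℕ) : ℤ))) = p * s + r := by simp
      refine ⟨_, Or.inl (Or.inl (Or.inr ⟨s, r, rfl⟩)), ?_⟩
      change OpOrder.IsLead _ _ (opOdd p 0 (p * s + r + (1 - ((1 : ℕ) : ℤ)))) _
      rw [e]
      exact h2
    · exact ⟨_, Or.inl (Or.inr ⟨s, r, rfl⟩), h1⟩
    · have h3 := isLead_opOdd (p := p) 1 1 (x := 0) rfl s r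
      simp only [add_zero] at h3
      have e : (p * s + r + (1 - ((1 : ℕ) : ℤ))) = p * s + r := by simp
      refine ⟨_, Or.inr ⟨s, r, rfl⟩, ?_⟩
      change OpOrder.IsLead _ _ (opOdd p 1 (p * s + r + (1 - ((1 : ℕ) : ℤ)))) _
      rw [e]
      exact h3

/-- The sign of an operation at a given place. -/
def sgnOdd (i : ℕ) (g : (bigOdd p).Op) : ZMod p := (-1) ^ (i * (decOdd g : ℕ))

/-- The involution on the operations. -/
def starOp (g : (bigOdd p).Op) : (bigOdd p).Op := opOdd p (1 - decOdd g) (-idxOdd g)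

lemma starOp_opOdd (δ : Fin 2) (s : ℤ) : starOp (opOdd p δ s) = opOdd p (1 - δ) (-s) := rfl

lemma relPairing_pairOdd (i : ℕ) (ε δ ε' δ' : Fin 2) (x y x' y' a b : ℤ) :
    relPairing (fun q ↦ sgnOdd i q.2 * sgnOdd (i + 1) q.1) starOp (pairOdd p ε x δ y)
      (pairShift a b (pairOdd p ε' x' δ' y')) =
      if (ε' = 1 - ε ∧ a + x' = -x) ∧ δ' = 1 - δ ∧ b + y' = -y then
        (-1) ^ (i * (δ : ℕ)) * (-1) ^ ((i + 1) * (ε : ℕ)) else 0 := by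
  classical
  rw [pairShift_pairOdd, pairOdd, relPairing_single, one_mul, pairOdd, starOp_opOdd, starOp_opOdd,
    Finsupp.single_apply, mul_ite, mul_one, mul_zero]
  congr 1
  refine propext ⟨fun h ↦ ?_, ?_⟩
  · exact ⟨opOdd_injective (congrArg Prod.fst h), opOdd_injective (congrArg Prod.snd h)⟩
  · rintro ⟨⟨h1, h2⟩, h3, h4⟩
    rw [h1, h2, h3, h4]

/-- Letters pair only with letters of opposite `ε`. Apart from the commutator with itself,
generators that pair do so only for `a = -1`, `b = 0`. The commutator meets itself at `a = b = 0` in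
two terms, which cancel because the sign at place `i + 1` differs from that at place `i`. -/
lemma dual_generatorsOdd (i : ℕ) {u u' : (bigOdd p).Op × (bigOdd p).Op →₀ ZMod p}
    (hu : u ∈ (generatorsOdd p).gens) (hu' : u' ∈ (generatorsOdd p).gens) (a b : ℤ)
    (h : relPairing (fun q ↦ sgnOdd i q.2 * sgnOdd (i + 1) q.1) starOp u (pairShift a b u') ≠ 0) :
    a = p * b - 1 := by
  have h01 : ¬ (0 : Fin 2) = 1 := by decide
  have h10 : ¬ (1 : Fin 2) = 0 := by decide
  by_contra hne
  have hab : ¬ (a = -1 ∧ b = 0) := by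
    rintro ⟨rfl, rfl⟩
    simp at hne
  have hab' : ¬ (a + 1 = 0 ∧ b = 0) := fun h ↦ hab ⟨by omega, h.2⟩
  refine h ?_
  rcases hu with rfl | rfl | rfl | rfl <;> rcases hu' with rfl | rfl | rfl | rfl <;>
    simp [commOdd, relPairing_pairOdd, hab, hab', h01, h10, pow_succ]
  split_ifs <;> simp

lemma ademFamily_pairOdd_mem (ε δ : Fin 2) (x s : ℤ) (r : ℕ) :
    ademFamily p (pairOdd p ε x δ 0) s r ∈
      Finsupp.supported (ZMod p) (ZMod p) {q | decOdd q.1 = ε ∧ decOdd q.2 = δ} := by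
  rw [ademFamily_pairOdd]
  refine Submodule.sum_mem _ fun i _ ↦ Submodule.smul_mem _ _ ?_
  exact Finsupp.single_mem_supported _ _ ⟨rfl, rfl⟩

/-- The sign `(-1) ^ (|g| |h|)` is negative only if both letters are of type `Q_1`. By homogeneity
in this type it is constant on each relation, as `opp_sign` requires. -/
lemma dec_of_mem_support {ρ : (bigOdd p).Op × (bigOdd p).Op →₀ ZMod p} (hρ : ρ ∈ (bigOdd p).rel) :
    (∀ q ∈ ρ.support, decOdd q.1 = 1 ∧ decOdd q.2 = 1) ∨
      ∀ q ∈ ρ.support, ¬ (decOdd q.1 = 1 ∧ decOdd q.2 = 1) := by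
  have key (ε δ : Fin 2) (h : ¬ (ε = 1 ∧ δ = 1)) (x s : ℤ) (r : ℕ) :
      ademFamily p (pairOdd p ε x δ 0) s r ∈
        Finsupp.supported (ZMod p) (ZMod p) {q | ¬ (decOdd q.1 = 1 ∧ decOdd q.2 = 1)} := by
    refine Finsupp.supported_mono ?_ (ademFamily_pairOdd_mem ε δ x s r)
    rintro q ⟨h1, h2⟩ h3
    rw [h1, h2] at h3
    exact h h3
  rcases mem_relOdd.1 hρ with ((⟨s, r, rfl⟩ | ⟨s, r, rfl⟩) | ⟨s, r, rfl⟩) | ⟨s, r, rfl⟩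
  · exact Or.inr (key 0 0 (by decide) 1 s r)
  · refine Or.inr (Submodule.add_mem (Finsupp.supported (ZMod p) (ZMod p) _) ?_ ?_)
    · rw [commOdd, ademFamily_sub]
      exact Submodule.sub_mem _ (key 0 1 (by decide) 0 s r) (key 1 0 (by decide) 0 s r)
    · split_ifs
      · exact Submodule.zero_mem _
      · exact key 1 0 (by decide) 1 s _
  · exact Or.inr (key 1 0 (by decide) 1 s r)
  · exact Or.inl (ademFamily_pairOdd_mem 1 1 0 s r)

lemma deg_even_of_dec {g : (bigOdd p).Op} (h : decOdd g = 0) : Even ((bigOdd p).deg g) := by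
  rw [← opOdd_eta g, h, deg_opOdd]
  exact ⟨idxOdd g * (p - 1), by simp; ring⟩

lemma deg_odd_of_dec {g : (bigOdd p).Op} (h : decOdd g = 1) : Odd ((bigOdd p).deg g) := by
  rw [← opOdd_eta g, h, deg_opOdd]
  exact ⟨idxOdd g * (p - 1) - 1, by simp; ring⟩

lemma opp_sign_odd {ρ : (bigOdd p).Op × (bigOdd p).Op →₀ ZMod p} (hρ : ρ ∈ (bigOdd p).rel) :
    ∃ c : ZMod p, ∀ q ∈ ρ.support,
      (((((bigOdd p).deg q.1 * (bigOdd p).deg q.2).negOnePow *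
        ((bigOdd p).deg q.1).negOnePow : ℤˣ) : ℤ) : ZMod p) =
          c * (sgnOdd 0 q.2 * sgnOdd 1 q.1) := by
  have hdec (g : (bigOdd p).Op) : decOdd g = 0 ∨ decOdd g = 1 := by
    generalize decOdd g = δ
    fin_cases δ
    · exact Or.inl rfl
    · exact Or.inr rfl
  rcases dec_of_mem_support hρ with h | h
  · refine ⟨-1, fun q hq ↦ ?_⟩
    obtain ⟨h1, h2⟩ := h q hq
    rw [Int.negOnePow_odd _ ((deg_odd_of_dec h1).mul (deg_odd_of_dec h2)),
      Int.negOnePow_odd _ (deg_odd_of_dec h1), sgnOdd, sgnOdd, h1]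
    simp
  · refine ⟨1, fun q hq ↦ ?_⟩
    have h3 : Even ((bigOdd p).deg q.1 * (bigOdd p).deg q.2) := by
      rcases hdec q.1 with h1 | h1
      · exact (deg_even_of_dec h1).mul_right _
      · rcases hdec q.2 with h2 | h2
        · exact (deg_even_of_dec h2).mul_left _
        · exact (h q hq ⟨h1, h2⟩).elim
    rw [Int.negOnePow_even _ h3, sgnOdd, sgnOdd]
    rcases hdec q.1 with h1 | h1
    · rw [Int.negOnePow_even _ (deg_even_of_dec h1), h1]
      simp
    · rw [Int.negOnePow_odd _ (deg_odd_of_dec h1), h1]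
      simp

end odd

end DyerLashof
end

noncomputable section

namespace DyerLashof

/-! ### Odd primes: exterior multiplication -/

lemma prod_update_update {n i : ℕ} (h : i + 1 < n) {X M : Type} [CommMonoid M]
    (F : Fin n → X → M) (w : Fin n → X) (x y : X) :
    ∏ j, F j (Function.update (Function.update w ⟨i, by omega⟩ y) ⟨i + 1, h⟩ x j) =
      F ⟨i, by omega⟩ y * F ⟨i + 1, h⟩ x *
        ∏ j ∈ (Finset.univ.erase ⟨i, by omega⟩).erase ⟨i + 1, h⟩, F j (w j) := by
  have hne : (⟨i, by omega⟩ : Fin n) ≠ ⟨i + 1, h⟩ := by simp [Fin.ext_iff]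
  rw [← Finset.mul_prod_erase _ _ (Finset.mem_univ (⟨i, by omega⟩ : Fin n)),
    ← Finset.mul_prod_erase _ _ (Finset.mem_erase.2 ⟨hne.symm, Finset.mem_univ _⟩),
    Function.update_of_ne hne, Function.update_self, Function.update_self, ← mul_assoc]
  congr 1
  refine Finset.prod_congr rfl fun j hj ↦ ?_
  simp only [Finset.mem_erase, Finset.mem_univ, and_true] at hj
  rw [Function.update_of_ne hj.1, Function.update_of_ne hj.2]

lemma laurentAct_laurentAct {k : Type} [Field k] {A : QuadraticPresentation k} [AddAction ℤ A.Op]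
    {n : ℕ} (f g : Laurent k) (u : (Fin n → A.Op) →₀ k) :
    laurentAct A n f (laurentAct A n g u) = laurentAct A n (f * g) u := by
  rw [map_mul]
  rfl

section odd

variable {p : ℕ} [Fact p.Prime] {n : ℕ}

/-- The operation `Q^s_1` for `Q^s_δ`. -/
def decorate (g : (bigOdd p).Op) : (bigOdd p).Op := opOdd p 1 (idxOdd g)

/-- The sign of the operations before the place `j`. -/
def decSign (j : Fin n) (w : Fin n → (bigOdd p).Op) : ZMod p :=
  ∏ i : Fin n, if i < j then (-1) ^ (decOdd (w i) : ℕ) else 1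

/-- The exterior multiplication that turns the operation `Q^s` at the place `j` into `Q^s_1`. -/
def extMul (j : Fin n) : Module.End (ZMod p) ((Fin n → (bigOdd p).Op) →₀ ZMod p) :=
  Finsupp.linearCombination (ZMod p) fun w ↦
    if decOdd (w j) = 0 then Finsupp.single (Function.update w j (decorate (w j))) (decSign j w)
    else 0

lemma extMul_single (j : Fin n) (w : Fin n → (bigOdd p).Op) (c : ZMod p) :
    extMul j (Finsupp.single w c) = if decOdd (w j) = 0 then
      Finsupp.single (Function.update w j (decorate (w j))) (c * decSign j w) else 0 := by
  rw [extMul, Finsupp.linearCombination_single]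
  split_ifs
  · rw [Finsupp.smul_single, smul_eq_mul]
  · rw [smul_zero]

lemma extMul_laurentAct (j : Fin n) (f : Laurent (ZMod p))
    (u : (Fin n → (bigOdd p).Op) →₀ ZMod p) :
    extMul j (laurentAct (bigOdd p) n f u) = laurentAct (bigOdd p) n f (extMul j u) := by
  induction f using AddMonoidAlgebra.induction_linear with
  | zero => simp
  | add f g hf hg => simp only [map_add, LinearMap.add_apply, hf, hg]
  | single a c =>
    have : (AddMonoidAlgebra.single a c : Laurent (ZMod p)) = c • mono (ZMod p) a := by
      rw [mono, AddMonoidAlgebra.smul_single, smul_eq_mul, mul_one]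
    rw [this, map_smul, LinearMap.smul_apply, LinearMap.smul_apply, map_smul]
    congr 1
    induction u using Finsupp.induction_linear with
    | zero => simp
    | add u v hu hv => simp only [map_add, hu, hv]
    | single w d =>
      rw [laurentAct_mono, extMul_single, extMul_single]
      change (if decOdd (w j) = 0 then _ else _) = _
      split_ifs with h0
      · rw [laurentAct_mono]
        congr 1
        funext l
        change _ = a l +ᵥ Function.update w j (decorate (w j)) l
        by_cases hl : l = j
        · subst hl
          rw [Function.update_self, Function.update_self]
          rfl
        · rw [Function.update_of_ne hl, Function.update_of_ne hl]
          rfl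
      · rw [map_zero]

/-- The exterior multiplication by a form with coefficients in the Laurent polynomials. -/
def omegaOp (c : ℕ → Laurent (ZMod p)) :
    Module.End (ZMod p) ((Fin n → (bigOdd p).Op) →₀ ZMod p) :=
  ∑ j : Fin n, laurentAct (bigOdd p) n (c j) * extMul j

lemma omegaOp_apply (c : ℕ → Laurent (ZMod p)) (u : (Fin n → (bigOdd p).Op) →₀ ZMod p) :
    omegaOp c u = ∑ j : Fin n, laurentAct (bigOdd p) n (c j) (extMul j u) := by
  rw [omegaOp, LinearMap.sum_apply]
  rfl

lemma omegaOp_laurentAct (c : ℕ → Laurent (ZMod p)) (f : Laurent (ZMod p))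
    (u : (Fin n → (bigOdd p).Op) →₀ ZMod p) :
    omegaOp c (laurentAct (bigOdd p) n f u) = laurentAct (bigOdd p) n f (omegaOp c u) := by
  rw [omegaOp_apply, omegaOp_apply, map_sum]
  refine Finset.sum_congr rfl fun j _ ↦ ?_
  rw [extMul_laurentAct, laurentAct_laurentAct, laurentAct_laurentAct, mul_comm]

section insPair

variable {i : ℕ} (h : i + 1 < n)

/-- The sign of the operations before the place `j`, apart from those at `i` and `i + 1`. -/
def restSign (w : Fin n → (bigOdd p).Op) (j : Fin n) : ZMod p :=
  ∏ l ∈ (Finset.univ.erase ⟨i, by omega⟩).erase ⟨i + 1, h⟩,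
    if l < j then (-1) ^ (decOdd (w l) : ℕ) else 1

lemma insPair_pairOdd (w : Fin n → (bigOdd p).Op) (ε : Fin 2) (x : ℤ) (δ : Fin 2) (y : ℤ) :
    insPair h w (pairOdd p ε x δ y) = Finsupp.single (Function.update
      (Function.update w ⟨i, by omega⟩ (opOdd p δ y)) ⟨i + 1, h⟩ (opOdd p ε x)) 1 :=
  insPair_single _ _ _ _

lemma extMul_insPair_fst (w : Fin n → (bigOdd p).Op) (ε : Fin 2) (x : ℤ) (δ : Fin 2) (y : ℤ) :
    extMul ⟨i, by omega⟩ (insPair h w (pairOdd p ε x δ y)) =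
      if δ = 0 then restSign h w ⟨i, by omega⟩ • insPair h w (pairOdd p ε x 1 y) else 0 := by
  have hne : (⟨i, by omega⟩ : Fin n) ≠ ⟨i + 1, h⟩ := by simp [Fin.ext_iff]
  rw [insPair_pairOdd, extMul_single, Function.update_of_ne hne, Function.update_self,
    decOdd_opOdd]
  split_ifs
  · rw [insPair_pairOdd, Finsupp.smul_single, smul_eq_mul, mul_one, one_mul, decSign,
      prod_update_update h (fun j g ↦ if j < ⟨i, by omega⟩ then
        (-1 : ZMod p) ^ (decOdd g : ℕ) else 1), if_neg (lt_irrefl _), if_neg (by simp), one_mul,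
      one_mul]
    congr 1
    rw [Function.update_comm hne.symm, Function.update_idem]
    rfl
  · rfl

lemma extMul_insPair_snd (w : Fin n → (bigOdd p).Op) (ε : Fin 2) (x : ℤ) (δ : Fin 2) (y : ℤ) :
    extMul ⟨i + 1, h⟩ (insPair h w (pairOdd p ε x δ y)) =
      if ε = 0 then ((-1) ^ (δ : ℕ) * restSign h w ⟨i, by omega⟩) •
        insPair h w (pairOdd p 1 x δ y) else 0 := by
  rw [insPair_pairOdd, extMul_single, Function.update_self, decOdd_opOdd]
  split_ifs
  · rw [insPair_pairOdd, Finsupp.smul_single, smul_eq_mul, mul_one, one_mul, decSign,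
      prod_update_update h (fun j g ↦ if j < ⟨i + 1, h⟩ then
        (-1 : ZMod p) ^ (decOdd g : ℕ) else 1), if_neg (lt_irrefl _), if_pos (by simp), mul_one,
      Function.update_idem]
    congr 1
    congr 1
    refine Finset.prod_congr rfl fun j hj ↦ ?_
    simp only [Finset.mem_erase, Finset.mem_univ, and_true, ne_eq, Fin.ext_iff] at hj
    have : j < ⟨i + 1, h⟩ ↔ j < ⟨i, by omega⟩ := by
      simp only [Fin.lt_def]
      omega
    simp only [this]
  · rfl

/-- Passing the two places costs at most the sign `t`, which is the same for all terms of each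
generator. So a distant exterior multiplication sends a generator to a multiple of itself in another
word. -/
lemma extMul_insPair_of_ne (w : Fin n → (bigOdd p).Op) {j : Fin n} (h1 : (j : ℕ) ≠ i)
    (h2 : (j : ℕ) ≠ i + 1) (t : ZMod p) : ∃ (e : ZMod p) (w' : Fin n → (bigOdd p).Op),
      ∀ (ε : Fin 2) (x : ℤ) (δ : Fin 2) (y : ℤ), (-1) ^ (δ : ℕ) * (-1) ^ (ε : ℕ) = t →
        extMul j (insPair h w (pairOdd p ε x δ y)) = e • insPair h w' (pairOdd p ε x δ y) := by
  have h1' : j ≠ ⟨i, by omega⟩ := fun e ↦ h1 (congrArg Fin.val e)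
  have h2' : j ≠ ⟨i + 1, h⟩ := fun e ↦ h2 (congrArg Fin.val e)
  by_cases hw : decOdd (w j) = 0
  · refine ⟨(if i < j then t else 1) * restSign h w j, Function.update w j (decorate (w j)),
      fun ε x δ y ht ↦ ?_⟩
    rw [insPair_pairOdd, extMul_single, Function.update_of_ne h2', Function.update_of_ne h1',
      if_pos hw, insPair_pairOdd, Finsupp.smul_single, smul_eq_mul, mul_one, one_mul, decSign,
      prod_update_update h (fun l g ↦ if l < j then
        (-1 : ZMod p) ^ (decOdd g : ℕ) else 1), decOdd_opOdd, decOdd_opOdd,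
      Function.update_comm h2'.symm, Function.update_comm h1'.symm]
    congr 2
    simp only [Fin.lt_def]
    by_cases hi : i < j
    · rw [if_pos hi, if_pos (by omega), if_pos hi, ht]
    · rw [if_neg hi, if_neg (by omega), if_neg hi, one_mul]
  · refine ⟨0, w, fun ε x δ y _ ↦ ?_⟩
    rw [insPair_pairOdd, extMul_single, Function.update_of_ne h2', Function.update_of_ne h1',
      if_neg hw, zero_smul]

/-- Conditions on the coefficients of a form under which the exterior multiplication by this form
preserves the relations at the places `i` and `i + 1`. -/
structure StabForm (c : ℕ → Laurent (ZMod p)) : Prop where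
  of_ne : ∀ j, j ≠ i → j ≠ i + 1 → c j ∈ stab (bigOdd p) h
  add : c i + c (i + 1) ∈ stab (bigOdd p) h
  mul : zvar (ZMod p) (i + 1) * c i ∈ stab (bigOdd p) h

lemma laurentAct_zvar_insPair (w : Fin n → (bigOdd p).Op) (ε δ : Fin 2) (x y : ℤ) :
    laurentAct (bigOdd p) n (zvar (ZMod p) (i + 1)) (insPair h w (pairOdd p ε x δ y)) =
      insPair h w (pairOdd p ε (1 + x) δ y) := by
  rw [zvar, laurentAct_insPair, Pi.single_eq_same, Pi.single_eq_of_ne (by omega),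
    pairShift_pairOdd, zero_add]
  refine LinearMap.congr_fun (insPair_congr h fun j h1 h2 ↦ ?_) _
  rw [wordShift, Pi.single_eq_of_ne (fun e ↦ h2 (Fin.ext e)), zero_vadd]

/-- It suffices to test the four generators. At the two places, `Q^1 Q^0` goes to `z_{i+1} c_i`
times the commutator plus `c_i + c_{i+1}` times `Q_1^1 Q^0`; the commutator goes to `-(c_i +
c_{i+1})` times `Q_1^0 Q_1^0`; `Q_1^1 Q^0` goes to `z_{i+1} c_i` times `Q_1^0 Q_1^0`; and `Q_1^0
Q_1^0` goes to zero, all up to a common sign. These coefficients are the ones in `StabForm`. -/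
lemma StabForm.omegaOp_mem {c : ℕ → Laurent (ZMod p)} (hc : StabForm h c)
    {x : (Fin n → (bigOdd p).Op) →₀ ZMod p} (hx : x ∈ relAt (bigOdd p) (ZMod p) n i h) :
    omegaOp c x ∈ relAt (bigOdd p) (ZMod p) n i h := by
  refine (generatorsOdd p).relAt_of_gens h (fun f u ↦ omegaOp_laurentAct c f u)
    (fun u hu w ↦ ?_) hx
  have hne : (⟨i, by omega⟩ : Fin n) ≠ ⟨i + 1, h⟩ := by simp [Fin.ext_iff]
  have hmem (w' : Fin n → (bigOdd p).Op) {u : (bigOdd p).Op × (bigOdd p).Op →₀ ZMod p}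
      (hu : u ∈ (generatorsOdd p).gens) : insPair h w' u ∈ relAt (bigOdd p) (ZMod p) n i h := by
    refine insPair_mem h w' ?_
    have := (generatorsOdd p).pairShift_mem_span hu 0
    rwa [mul_zero, pairShift_zero] at this
  have hoff (j : Fin n) (h1 : (j : ℕ) ≠ i) (h2 : (j : ℕ) ≠ i + 1) :
      laurentAct (bigOdd p) n (c j) (extMul j (insPair h w u)) ∈
        relAt (bigOdd p) (ZMod p) n i h := by
    refine hc.of_ne j h1 h2 _ ?_
    have key : ∃ (e : ZMod p) (w' : Fin n → (bigOdd p).Op),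
        extMul j (insPair h w u) = e • insPair h w' u := by
      rcases hu with rfl | rfl | rfl | rfl
      · obtain ⟨e, w', he⟩ := extMul_insPair_of_ne h w h1 h2 1
        exact ⟨e, w', he _ _ _ _ (by simp)⟩
      · obtain ⟨e, w', he⟩ := extMul_insPair_of_ne h w h1 h2 (-1)
        refine ⟨e, w', ?_⟩
        rw [commOdd, map_sub, map_sub, map_sub, he _ _ _ _ (by simp), he _ _ _ _ (by simp),
          smul_sub]
      · obtain ⟨e, w', he⟩ := extMul_insPair_of_ne h w h1 h2 (-1)
        exact ⟨e, w', he _ _ _ _ (by simp)⟩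
      · obtain ⟨e, w', he⟩ := extMul_insPair_of_ne h w h1 h2 1
        exact ⟨e, w', he _ _ _ _ (by simp)⟩
    obtain ⟨e, w', he⟩ := key
    rw [he]
    exact Submodule.smul_mem _ _ (hmem w' hu)
  rw [omegaOp_apply, ← Finset.add_sum_erase _ _ (Finset.mem_univ (⟨i, by omega⟩ : Fin n)),
    ← Finset.add_sum_erase _ _ (Finset.mem_erase.2 ⟨hne.symm, Finset.mem_univ _⟩), ← add_assoc]
  refine Submodule.add_mem _ ?_ (Submodule.sum_mem _ fun j hj ↦ ?_)
  · have g2 : commOdd p ∈ (generatorsOdd p).gens := Or.inr (Or.inl rfl)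
    have g3 : pairOdd p 1 1 0 0 ∈ (generatorsOdd p).gens := Or.inr (Or.inr (Or.inl rfl))
    have g4 : pairOdd p 1 0 1 0 ∈ (generatorsOdd p).gens := Or.inr (Or.inr (Or.inr rfl))
    have z4 : insPair h w (pairOdd p 1 1 1 0) =
        laurentAct (bigOdd p) n (zvar (ZMod p) (i + 1)) (insPair h w (pairOdd p 1 0 1 0)) := by
      rw [laurentAct_zvar_insPair, add_zero]
    -- The composite `Q^1 Q_1^0` is the shifted commutator plus `Q_1^1 Q^0`.
    have z2 : insPair h w (pairOdd p 0 1 1 0) =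
        laurentAct (bigOdd p) n (zvar (ZMod p) (i + 1)) (insPair h w (commOdd p)) +
          insPair h w (pairOdd p 1 1 0 0) := by
      rw [commOdd, map_sub, map_sub, laurentAct_zvar_insPair, laurentAct_zvar_insPair, add_zero,
        sub_add_cancel]
    rcases hu with rfl | rfl | rfl | rfl
    · rw [extMul_insPair_fst, extMul_insPair_snd, if_pos rfl, if_pos rfl, z2, map_smul, map_smul,
        map_add, laurentAct_laurentAct, mul_comm (c i)]
      simp only [Fin.val_zero, pow_zero, one_mul]
      rw [← smul_add, add_assoc, ← LinearMap.add_apply, ← map_add]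
      exact Submodule.smul_mem _ _ (Submodule.add_mem _ (hc.mul _ (hmem w g2))
        (hc.add _ (hmem w g3)))
    · rw [commOdd, map_sub, map_sub, map_sub, map_sub, extMul_insPair_fst, extMul_insPair_fst,
        extMul_insPair_snd, extMul_insPair_snd, if_pos rfl, if_pos rfl, if_neg (by decide),
        if_neg (by decide), map_zero, zero_sub, sub_zero, map_smul, map_smul]
      have : (-1 : ZMod p) ^ ((1 : Fin 2) : ℕ) = -1 := pow_one _
      rw [this, neg_one_mul, neg_smul, ← neg_add, ← smul_add, ← LinearMap.add_apply, ← map_add]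
      exact Submodule.neg_mem _ (Submodule.smul_mem _ _ (hc.add _ (hmem w g4)))
    · rw [extMul_insPair_fst, extMul_insPair_snd, if_pos rfl, if_neg (by decide), map_zero,
        add_zero, z4, map_smul, laurentAct_laurentAct, mul_comm (c i)]
      exact Submodule.smul_mem _ _ (hc.mul _ (hmem w g4))
    · rw [extMul_insPair_fst, extMul_insPair_snd, if_neg (by decide), if_neg (by decide), map_zero,
        map_zero, add_zero]
      exact Submodule.zero_mem _
  · simp only [Finset.mem_erase, Finset.mem_univ, and_true, ne_eq, Fin.ext_iff] at hj
    exact hoff j hj.2 hj.1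

end insPair

end odd

end DyerLashof
end

noncomputable section

namespace DyerLashof

/-! ### Odd primes: elements of the Koszul complex -/

lemma bdd_pow {k : Type} [Field k] {W : Type} {wt : W → ℤ} {d : ℤ}
    {φ : Module.End k (W →₀ k)} (hφ : φ ∈ bdd k wt d) (m : ℕ) : φ ^ m ∈ bdd k wt (m * d) := by
  induction m with
  | zero =>
    rw [Nat.cast_zero, zero_mul, pow_zero]
    exact IsLeadTerm.one.left_mem
  | succ m ih =>
    have := bdd_mul ih hφ
    rwa [← add_one_mul, ← Nat.cast_succ, ← pow_succ] at this

lemma monoWeight_nsmul (n : ℕ) (C : ℤ) (m : ℕ) (a : ℕ → ℤ) :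
    monoWeight n C (m • a) = m * monoWeight n C a := by
  rw [monoWeight, monoWeight, Finset.mul_sum]
  refine Finset.sum_congr rfl fun i _ ↦ ?_
  rw [Pi.smul_apply, nsmul_eq_mul]
  ring

section odd

variable {p : ℕ}

variable (p) in
/-- The exponents of the leading monomial of `formSeq`. -/
def lowExp (n i : ℕ) : ℕ → ℤ := fun x ↦ if i < x ∧ x < n then -p ^ (x - i - 1) else 0

lemma lowExp_last (n i : ℕ) (h : i + 1 = n) : lowExp p n i = 0 :=
  funext fun _ ↦ if_neg (by omega)

lemma lowExp_eq {n i : ℕ} (h : i + 1 < n) :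
    lowExp p n i = Pi.single (i + 1) (-1) + p • lowExp p n (i + 1) := by
  funext x
  rw [Pi.add_apply, Pi.smul_apply, lowExp, lowExp]
  by_cases hx : x = i + 1
  · subst hx
    rw [Pi.single_eq_same, if_pos (by omega), if_neg (by omega), smul_zero, add_zero]
    simp
  · rw [Pi.single_eq_of_ne hx, zero_add]
    by_cases h1 : i < x ∧ x < n
    · obtain ⟨d, rfl⟩ : ∃ d, x = i + 1 + 1 + d := ⟨x - (i + 1 + 1), by omega⟩
      rw [if_pos h1, if_pos (by omega), show i + 1 + 1 + d - i - 1 = d + 1 by omega,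
        show i + 1 + 1 + d - (i + 1) - 1 = d by omega, nsmul_eq_mul, pow_succ]
      ring
    · rw [if_neg h1, if_neg (by omega), smul_zero]

variable (p) in
/-- The total shift caused by the exterior multiplications. -/
def decExp (δ : ℕ → Fin 2) : ℕ → ℤ
  | 0 => 0
  | j + 1 => p * decExp δ j + (δ j : ℕ)

lemma sum_lowExp (δ : ℕ → Fin 2) {n x : ℕ} (hx : x < n) :
    ∑ i ∈ Finset.range n, ((δ i : ℕ) : ℤ) * lowExp p n i x = -decExp p δ x := by
  have h1 : decExp p δ x = ∑ i ∈ Finset.range x, ((δ i : ℕ) : ℤ) * p ^ (x - i - 1) := by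
    clear hx
    induction x with
    | zero => rfl
    | succ x ih =>
      rw [decExp, ih, Finset.sum_range_succ, show x + 1 - x - 1 = 0 by omega, pow_zero, mul_one,
        Finset.mul_sum]
      congr 1
      refine Finset.sum_congr rfl fun i hi ↦ ?_
      have := Finset.mem_range.1 hi
      rw [show x + 1 - i - 1 = (x - i - 1) + 1 by omega, pow_succ]
      ring
  rw [h1, ← Finset.sum_neg_distrib]
  symm
  refine Finset.sum_subset_zero_on_sdiff (fun i hi ↦ ?_) (fun i hi ↦ ?_) fun i hi ↦ ?_
  · have := Finset.mem_range.1 hi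
    exact Finset.mem_range.2 (by omega)
  · simp only [Finset.mem_sdiff, Finset.mem_range] at hi
    rw [lowExp, if_neg (by omega), mul_zero]
  · have := Finset.mem_range.1 hi
    rw [lowExp, if_pos (by omega), mul_neg]

variable [Fact p.Prime]

lemma v_vadd_odd (a : ℤ) (g : (bigOdd p).Op) :
    (orderOdd p).v (a +ᵥ g) = 2 * a + (orderOdd p).v g := by
  rw [← opOdd_eta g, vadd_opOdd, v_opOdd, v_opOdd]
  ring

variable (p) in
/-- The inverse of the variable `z_j`. -/
def zinv (j : ℕ) : Laurent (ZMod p) := mono (ZMod p) (Pi.single j (-1))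

lemma zvar_mul_zinv (j : ℕ) : zvar (ZMod p) j * zinv p j = 1 := by
  rw [zvar, zinv, mono_mul, ← Pi.single_add, add_neg_cancel, Pi.single_zero, mono_zero]

variable (p) in
/-- The coefficients of forms of degree one that preserve the relations. -/
def formSeq (n : ℕ) : ℕ → ℕ → Laurent (ZMod p)
  | 0, j => if j + 1 = n then 1 else 0
  | t + 1, j => zinv p j * formSeq n t j ^ p - zinv p (j + 1) * formSeq n t (j + 1) ^ p

/-- The recursion telescopes in `c_i + c_{i+1}`, and `z_i⁻¹ c_i ^ p` preserves the relations because
it is `(z_{i+1} c_i) ^ p` times the invertible monomial `z_i⁻¹ z_{i+1} ^ (-p)`. -/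
lemma stabForm_formSeq {n i : ℕ} (h : i + 1 < n) (t : ℕ) : StabForm h (formSeq p n t) := by
  induction t with
  | zero =>
    have h0 (j : ℕ) : formSeq p n 0 j ∈ stab (bigOdd p) h := by
      rw [formSeq]
      split_ifs
      · exact Subalgebra.one_mem _
      · exact Subalgebra.zero_mem _
    refine ⟨fun j _ _ ↦ h0 j, Subalgebra.add_mem _ (h0 _) (h0 _), ?_⟩
    rw [formSeq, if_neg (by omega), mul_zero]
    exact Subalgebra.zero_mem _
  | succ t ih =>
    have hz (j : ℕ) (h1 : j ≠ i) (h2 : j ≠ i + 1) : zinv p j ∈ stab (bigOdd p) h :=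
      (generatorsOdd p).mono_mem_stab h (by simp [h1.symm, h2.symm])
    have hi : zinv p i * formSeq p n t i ^ p ∈ stab (bigOdd p) h := by
      have e : zinv p i * formSeq p n t i ^ p =
          mono (ZMod p) (Pi.single i (-1) + Pi.single (i + 1) (-(p : ℤ))) *
            (zvar (ZMod p) (i + 1) * formSeq p n t i) ^ p := by
        rw [mul_pow, ← mul_assoc, zvar, mono_pow, mono_mul, add_assoc, ← Pi.single_smul,
          ← Pi.single_add, nsmul_one, neg_add_cancel, Pi.single_zero, add_zero, zinv]
      rw [e]
      exact Subalgebra.mul_mem _ ((generatorsOdd p).mono_mem_stab h (by simp))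
        (Subalgebra.pow_mem _ ih.mul _)
    have hF (j : ℕ) (h2 : j ≠ i + 1) : zinv p j * formSeq p n t j ^ p ∈ stab (bigOdd p) h := by
      by_cases h1 : j = i
      · rw [h1]
        exact hi
      · exact Subalgebra.mul_mem _ (hz j h1 h2) (Subalgebra.pow_mem _ (ih.of_ne j h1 h2) _)
    refine ⟨fun j h1 h2 ↦ ?_, ?_, ?_⟩
    · exact Subalgebra.sub_mem _ (hF j h2) (hF (j + 1) (by omega))
    · rw [formSeq, formSeq, sub_add_sub_cancel]
      exact Subalgebra.sub_mem _ (hF i (by omega)) (hF (i + 1 + 1) (by omega))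
    · have e : zvar (ZMod p) (i + 1) * formSeq p n (t + 1) i =
          (zvar (ZMod p) i + zvar (ZMod p) (i + 1)) * (zinv p i * formSeq p n t i ^ p) -
            (formSeq p n t i + formSeq p n t (i + 1)) ^ p := by
        rw [add_pow_char, formSeq]
        linear_combination (formSeq p n t i ^ p) * (-zvar_mul_zinv (p := p) i) -
          (formSeq p n t (i + 1) ^ p) * zvar_mul_zinv (p := p) (i + 1)
      rw [e]
      exact Subalgebra.sub_mem _ (Subalgebra.mul_mem _ ((generatorsOdd p).add_mem_stab h) hi)
        (Subalgebra.pow_mem _ ih.add _)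

lemma formSeq_eq_zero {n t j : ℕ} (hj : n ≤ j ∨ j + t + 1 < n) : formSeq p n t j = 0 := by
  have hp : p ≠ 0 := (Fact.out : p.Prime).ne_zero
  induction t generalizing j with
  | zero => exact if_neg (by omega)
  | succ t ih => rw [formSeq, ih (by omega), ih (by omega), zero_pow hp, mul_zero, mul_zero, sub_zero]

/-- The sequence reaches one place further down with each `t`. At its lowest place only the
subtracted term of the recursion is nonzero, so the coefficient there is a monomial. -/
lemma formSeq_lead {n t i : ℕ} (h : i + t + 1 = n) :
    ∃ e : ZMod p, e ≠ 0 ∧ formSeq p n t i = e • mono (ZMod p) (lowExp p n i) := by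
  have hp : p ≠ 0 := (Fact.out : p.Prime).ne_zero
  induction t generalizing i with
  | zero =>
    refine ⟨1, one_ne_zero, ?_⟩
    rw [formSeq, if_pos (by omega), lowExp_last n i (by omega), mono_zero, one_smul]
  | succ t ih =>
    obtain ⟨e, he, hi⟩ := ih (i := i + 1) (by omega)
    refine ⟨-e ^ p, neg_ne_zero.2 (pow_ne_zero p he), ?_⟩
    rw [formSeq, formSeq_eq_zero (by omega), zero_pow hp, mul_zero, zero_sub, hi, smul_pow,
      mono_pow, zinv, mul_smul_comm, mono_mul, neg_smul, lowExp_eq (n := n) (i := i) (by omega)]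

lemma formSeq_mem_bdd {n t i : ℕ} (h : i + t + 1 = n) (j : ℕ) :
    laurentAct (bigOdd p) n (formSeq p n t j) ∈
      bdd (ZMod p) (orderOdd p).weight (monoWeight n 2 (lowExp p n i)) := by
  have hp : p ≠ 0 := (Fact.out : p.Prime).ne_zero
  induction t generalizing i j with
  | zero =>
    rw [formSeq, lowExp_last n i (by omega)]
    have : monoWeight n 2 0 = 0 := by simp [monoWeight]
    rw [this]
    split_ifs
    · rw [map_one]
      exact IsLeadTerm.one.left_mem
    · rw [map_zero]
      exact Submodule.zero_mem _
  | succ t ih =>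
    have key (l : ℕ) : laurentAct (bigOdd p) n (zinv p l * formSeq p n t l ^ p) ∈
        bdd (ZMod p) (orderOdd p).weight (monoWeight n 2 (lowExp p n i)) := by
      by_cases hl : n ≤ l ∨ l + t + 1 < n
      · rw [formSeq_eq_zero hl, zero_pow hp, mul_zero, map_zero]
        exact Submodule.zero_mem _
      · have h1 := homog_le_bdd _ (laurentAct_mono_mem (k := ZMod p) v_vadd_odd (n := n)
          (Pi.single l (-1)))
        have h2 := bdd_mul h1 (bdd_pow (ih (i := i + 1) (by omega) l) p)
        rw [map_mul, map_pow]
        refine bdd_mono ?_ h2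
        rw [lowExp_eq (n := n) (i := i) (by omega), monoWeight_add, monoWeight_nsmul, monoWeight_single _ (by omega),
          monoWeight_single _ (by omega)]
        have : ((i + 1 : ℕ) : ℤ) ≤ l := by omega
        omega
    have e : formSeq p n (t + 1) j = zinv p j * formSeq p n t j ^ p +
        (-1 : ZMod p) • (zinv p (j + 1) * formSeq p n t (j + 1) ^ p) := by
      rw [neg_one_smul, ← sub_eq_add_neg, formSeq]
    rw [e, map_add, map_smul]
    exact Submodule.add_mem _ (key j) (Submodule.smul_mem _ _ (key (j + 1)))

lemma extMul_mem_homog {n : ℕ} (j : Fin n) :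
    extMul j ∈ homog (ZMod p) (orderOdd p).weight (-(j : ℤ)) := by
  intro w
  rw [extMul_single]
  split_ifs with h0
  · refine Finsupp.single_mem_supported _ _ ?_
    change (orderOdd p).weight _ = _
    rw [OpOrder.weight, OpOrder.weight, ← Finset.add_sum_erase _ _ (Finset.mem_univ j),
      ← Finset.add_sum_erase _ (fun i : Fin n ↦ (i : ℤ) * (orderOdd p).v (w i)) (Finset.mem_univ j),
      Function.update_self]
    have e1 : (orderOdd p).v (decorate (w j)) = (orderOdd p).v (w j) - 1 := by
      rw [← opOdd_eta (w j), h0, decorate, idxOdd_opOdd, v_opOdd, v_opOdd]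
      simp
    have e2 : ∑ i ∈ Finset.univ.erase j, (i : ℤ) *
        (orderOdd p).v (Function.update w j (decorate (w j)) i) =
          ∑ i ∈ Finset.univ.erase j, (i : ℤ) * (orderOdd p).v (w i) :=
      Finset.sum_congr rfl fun i hi ↦ by rw [Function.update_of_ne (Finset.ne_of_mem_erase hi)]
    rw [e1, e2]
    ring
  · exact Submodule.zero_mem _

/-- Turning `Q^s` into `Q^s_1` at place `j` lowers the weight by `j`, all coefficients are bounded
by the weight of the one at `i`, and those before `i` vanish. Hence the summand at place `i` leads.
-/
lemma isLeadTerm_omegaOp {n t : ℕ} {i : Fin n} (h : (i : ℕ) + t + 1 = n) {e : ZMod p}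
    (he : formSeq p n t i = e • mono (ZMod p) (lowExp p n i)) :
    IsLeadTerm (orderOdd p).weight (monoWeight n 2 (lowExp p n i) + -(i : ℤ))
      (omegaOp (formSeq p n t))
      (laurentAct (bigOdd p) n (e • mono (ZMod p) (lowExp p n i)) * extMul i) := by
  have h1 : omegaOp (formSeq p n t) =
      (∑ j ∈ Finset.univ.erase i, laurentAct (bigOdd p) n (formSeq p n t j) * extMul j) +
        laurentAct (bigOdd p) n (e • mono (ZMod p) (lowExp p n i)) * extMul i := by
    rw [← he, omegaOp, Finset.sum_erase_add _ _ (Finset.mem_univ i)]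
  refine ⟨⟨_, Submodule.sum_mem _ fun j hj ↦ ?_, h1⟩, homog_mul ?_ (extMul_mem_homog i)⟩
  · have hne : (j : ℕ) ≠ i := fun e ↦ Finset.ne_of_mem_erase hj (Fin.ext e)
    by_cases hlt : (j : ℕ) < i
    · rw [formSeq_eq_zero (by omega), map_zero, zero_mul]
      exact Submodule.zero_mem _
    · exact bdd_mono (by omega) (bdd_mul (formSeq_mem_bdd h j)
        (homog_le_bdd _ (extMul_mem_homog j)))
  · rw [map_smul]
    exact Submodule.smul_mem _ _ (laurentAct_mono_mem v_vadd_odd _)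

/-- A product of exterior multiplications. -/
def omegaProd (n : ℕ) (δ : ℕ → Fin 2) :
    ℕ → Module.End (ZMod p) ((Fin n → (bigOdd p).Op) →₀ ZMod p)
  | 0 => 1
  | r + 1 => if δ r = 1 then omegaOp (formSeq p n (n - 1 - r)) * omegaProd n δ r
    else omegaProd n δ r

lemma omegaProd_mem_kos (n : ℕ) (δ : ℕ → Fin 2) (r : ℕ) {u : (Fin n → (bigOdd p).Op) →₀ ZMod p}
    (hu : u ∈ kos (bigOdd p) (ZMod p) n) : omegaProd n δ r u ∈ kos (bigOdd p) (ZMod p) n := by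
  induction r with
  | zero => exact hu
  | succ r ih =>
    rw [omegaProd]
    split_ifs
    · rw [mem_kos] at ih ⊢
      exact fun i h ↦ (stabForm_formSeq h _).omegaOp_mem h (ih i h)
    · exact ih

/-- Places are treated in increasing order. In the leading word the letter at place `r` is therefore
still of type `Q^s` when its turn comes, and `extMul` does not kill it. -/
lemma isLeadTerm_omegaProd (n : ℕ) (δ : ℕ → Fin 2) {b : Fin n → (bigOdd p).Op}
    (hb : ∀ j, decOdd (b j) = 0) (r : ℕ) (hr : r ≤ n) : ∃ d Ψ,
      IsLeadTerm (orderOdd p).weight d (omegaProd n δ r) Ψ ∧ ∃ c : ZMod p, c ≠ 0 ∧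
        Ψ (Finsupp.single b 1) = Finsupp.single (fun j : Fin n ↦ opOdd p (if (j : ℕ) < r then δ j else 0)
          (∑ i ∈ Finset.range r, (δ i : ℕ) * lowExp p n i j + idxOdd (b j))) c := by
  induction r with
  | zero =>
    refine ⟨0, 1, IsLeadTerm.one, 1, one_ne_zero, ?_⟩
    rw [Module.End.one_apply]
    congr 1
    funext j
    rw [← opOdd_eta (b j), hb, Finset.sum_range_zero, if_neg (Nat.not_lt_zero _)]
    simp
  | succ r ih =>
    obtain ⟨d, Ψ, hΨ, c, hc, hcb⟩ := ih (by omega)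
    by_cases hδ : δ r = 1
    · obtain ⟨e, he, hf⟩ := formSeq_lead (p := p) (n := n) (t := n - 1 - r) (i := r) (by omega)
      have h1 := (isLeadTerm_omegaOp (i := ⟨r, by omega⟩) (by change r + _ + 1 = n; omega)
        hf).mul hΨ
      refine ⟨_, _, (by rw [omegaProd, if_pos hδ]; exact h1), ?_⟩
      rw [Module.End.mul_apply, hcb, Module.End.mul_apply, extMul_single, if_pos (by simp),
        map_smul, LinearMap.smul_apply, laurentAct_mono, Finsupp.smul_single]
      refine ⟨_, ?_, congrArg (fun w ↦ Finsupp.single w _) (funext fun j ↦ ?_)⟩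
      · refine smul_ne_zero he (mul_ne_zero hc (Finset.prod_ne_zero_iff.2 fun i _ ↦ ?_))
        split_ifs
        · exact pow_ne_zero _ (neg_ne_zero.2 one_ne_zero)
        · exact one_ne_zero
      · have one_val : (((1 : Fin 2) : ℕ) : ℤ) = 1 := rfl
        rw [wordShift, Finset.sum_range_succ, hδ]
        by_cases hj : j = ⟨r, by omega⟩
        · subst hj
          rw [Function.update_self, decorate, idxOdd_opOdd, vadd_opOdd, if_pos (Nat.lt_succ_self r),
            hδ, one_val]
          congr 1
          ring
        · have hj' : (j : ℕ) ≠ r := fun e ↦ hj (Fin.ext e)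
          have h2 : (if (j : ℕ) < r then δ j else 0) = if (j : ℕ) < r + 1 then δ j else 0 := by
            by_cases h3 : (j : ℕ) < r
            · rw [if_pos h3, if_pos (by omega)]
            · rw [if_neg h3, if_neg (by omega)]
          rw [Function.update_of_ne hj, vadd_opOdd, h2, one_val]
          congr 1
          ring
    · have hδ' : δ r = 0 := by
        generalize δ r = x at hδ
        fin_cases x
        · rfl
        · exact (hδ rfl).elim
      refine ⟨d, Ψ, (by rw [omegaProd, if_neg hδ]; exact hΨ), c, hc, hcb.trans ?_⟩
      congr 1
      funext j
      rw [Finset.sum_range_succ, hδ']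
      have h2 : (if (j : ℕ) < r then δ j else 0) = if (j : ℕ) < r + 1 then δ j else 0 := by
        by_cases h3 : (j : ℕ) = r
        · rw [if_neg (by omega), if_pos (by omega), h3, hδ']
        · by_cases h4 : (j : ℕ) < r
          · rw [if_pos h4, if_pos (by omega)]
          · rw [if_neg h4, if_neg (by omega)]
      rw [h2]
      simp

/-- As for `p = 2`, the construction starts from a word `b` whose consecutive composites are
translates of `Q^1 Q^0 = 0`. The forms first introduce the letters `Q_1` where `J` has them, which
lowers the indices by `decExp`; the elements `frobSym` then raise them by `frobExp`. -/
lemma koszulOdd {n : ℕ} (J : Fin n → (bigOdd p).Op) (hJ : (orderOdd p).Coadm J) :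
    ∃ κ ∈ kos (bigOdd p) (ZMod p) n, κ J ≠ 0 ∧
      ∀ J', κ J' ≠ 0 → J' ≠ J → (orderOdd p).weight J' < (orderOdd p).weight J := by
  let δ : ℕ → Fin 2 := fun j ↦ if h : j < n then decOdd (J ⟨j, h⟩) else 0
  let s : ℕ → ℤ := fun j ↦ if h : j < n then idxOdd (J ⟨j, h⟩) else 0
  -- Coadmissibility is `p * s j - δ j < s (j + 1)`, so the number under `toNat` is nonnegative. The
  -- summand `δ j` offsets the growth of `decExp`, so that the indices of `b` satisfy `x (j + 1) = p
  -- * x j + 1`.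
  let m : ℕ → ℕ := fun j ↦ match j with
    | 0 => 0
    | j + 1 => (s (j + 1) - p * s j - 1 + (δ j : ℕ)).toNat
  let x : ℕ → ℤ := fun j ↦ s j - frobExp p m j + decExp p δ j
  let b : Fin n → (bigOdd p).Op := fun j ↦ opOdd p 0 (x j)
  have hJ' (j : Fin n) : J j = opOdd p (δ j) (s j) := by
    rw [← opOdd_eta (J j)]
    simp [δ, s]
  have hx (i : ℕ) (h : i + 1 < n) : x (i + 1) = p * x i + 1 := by
    have h1 : p * s i - (δ i : ℕ) < s (i + 1) := by
      have h2 := hJ i h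
      rw [hJ', hJ', inadm_opOdd] at h2
      exact h2
    have h2 : (m (i + 1) : ℤ) = s (i + 1) - p * s i - 1 + (δ i : ℕ) :=
      Int.toNat_of_nonneg (by omega)
    simp only [x, frobExp, decExp, h2]
    ring
  have hb : Finsupp.single b 1 ∈ kos (bigOdd p) (ZMod p) n := by
    rw [mem_kos]
    intro i h
    rw [← insPair_self h b]
    refine insPair_mem h b ?_
    have := (generatorsOdd p).single_mem_span (q := (opOdd p 0 1, opOdd p 0 0)) (Or.inl rfl) (x i)
    rw [vadd_opOdd, vadd_opOdd, add_zero, ← hx i h] at this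
    exact this
  obtain ⟨d, a, hd, ha⟩ := isLeadTerm_frobProd (k := ZMod p) (O := orderOdd p) (C := 2) p
    v_vadd_odd (by norm_num) n m
  obtain ⟨d', Ψ, hΨ, c, hc, hcb⟩ := isLeadTerm_omegaProd n δ (b := b) (fun _ ↦ rfl) n le_rfl
  refine ⟨_, (generatorsOdd p).frobProd_mem_kos m (omegaProd_mem_kos n δ n hb),
    (hd.mul hΨ).apply_single hc ?_⟩
  rw [Module.End.mul_apply, hcb, laurentAct_mono]
  congr 1
  funext j
  rw [wordShift, vadd_opOdd, ha j j.2, if_pos j.2, sum_lowExp δ j.2, hJ']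
  congr 1
  simp only [b, x, idxOdd_opOdd]
  ring

variable (p) in
/-- The Koszul system of the big Steenrod algebra for an odd prime. -/
def koszulSystemOdd : KoszulSystem (bigOdd p) where
  toAdemSystem := ademOdd p
  star := starOp
  star_star g := by
    rw [← opOdd_eta g, starOp_opOdd, starOp_opOdd]
    congr 1
    · generalize decOdd g = δ
      fin_cases δ <;> rfl
    · exact neg_neg _
  inadm_star h g := by
    rw [← opOdd_eta g, ← opOdd_eta h, starOp_opOdd, starOp_opOdd]
    change (orderOdd p).Inadm _ _ ↔ ¬ (orderOdd p).Inadm _ _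
    rw [inadm_opOdd, inadm_opOdd, mul_neg]
    have : ((1 - decOdd h : Fin 2) : ℕ) + ((decOdd h : Fin 2) : ℕ) = 1 := by
      generalize decOdd h = δ
      fin_cases δ <;> rfl
    omega
  deg_star g := by
    rw [← opOdd_eta g, starOp_opOdd, deg_opOdd, deg_opOdd]
    have : (((1 - decOdd g : Fin 2) : ℕ) : ℤ) = 1 - ((decOdd g : Fin 2) : ℕ) := by
      generalize decOdd g = δ
      fin_cases δ <;> rfl
    rw [this]
    ring
  sgn := sgnOdd
  sgn_ne i g := pow_ne_zero _ (neg_ne_zero.2 one_ne_zero)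
  dual ρ hρ ρ' hρ' i := by
    refine (generatorsOdd p).pairing_eq_zero (sg := fun q ↦ sgnOdd i q.2 * sgnOdd (i + 1) q.1)
      (st := starOp) (fun a g ↦ ?_) (fun _ _ _ ↦ rfl)
      (fun u hu u' hu' a b h ↦ dual_generatorsOdd i hu hu' a b h) hρ hρ'
    rw [← opOdd_eta g, vadd_opOdd, starOp_opOdd, starOp_opOdd, vadd_opOdd, neg_add]
  wt := (orderOdd p).weight
  koszul J hJ := koszulOdd J hJ
  opp_sign _ hρ := opp_sign_odd hρ

end odd

end DyerLashof
end

noncomputable section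
namespace DyerLashof

/-! ### The sequences indexing the bases -/

section two

variable {n : ℕ} {I : Fin n → ℤ} {a b : ℤ}

lemma unstable₂_eq : unstable₂ = koszulSystem₂.unst 0 := by
  funext (g : ℤ) a
  exact congrArg (· < a) (add_zero g).symm

lemma coadm_star₂ : koszulSystem₂.Coadm (fun i ↦ star₂ (I i)) ↔ Coadmissible₂ I := by
  refine forall₂_congr fun i h ↦ ?_
  change (-I ⟨i, _⟩ - 1 + (-I ⟨i, _⟩ - 1) : ℤ) < -I ⟨i + 1, _⟩ - 1 ↔ _
  omega

lemma sum_deg_star₂ (I : Fin n → ℤ) : ∑ i, big₂.deg (star₂ (I i)) = -shift₂ I := by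
  rw [shift₂, ← Finset.sum_neg_distrib]
  refine Finset.sum_congr rfl fun i _ ↦ ?_
  change (-I i - 1 : ℤ) = _
  ring

lemma coadm_deg_star₂ : Coadmissible₂ I ∧ b = a - shift₂ I ↔
    koszulSystem₂.Coadm (fun i ↦ star₂ (I i)) ∧ a + ∑ i, big₂.deg (star₂ (I i)) = b := by
  rw [coadm_star₂, sum_deg_star₂, ← sub_eq_add_neg, eq_comm]

lemma idx_star₂ : (Coadmissible₂ I ∧ b = a - shift₂ I ∧ ∀ h : 0 < n, I ⟨0, h⟩ < -a) ↔
    koszulSystem₂.Idx 0 a b fun i ↦ star₂ (I i) := by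
  rw [← and_assoc, coadm_deg_star₂, and_assoc]
  refine and_congr_right fun _ ↦ and_congr_right fun _ ↦ forall_congr' fun h ↦ ?_
  change _ ↔ (a - 0 ≤ -I ⟨0, h⟩ - 1)
  omega

/-- The bound on `r₁` refers to the degree `b = a + |I|` of the source. Expressed in terms of the
target degree `a`, it acquires the summand `|I|`, which doubles `r₁` and adds the other entries and
`n`. -/
lemma idx_star₂' : (Coadmissible₂ I ∧ a = b - shift₂ I ∧
    ∀ h : 0 < n, 2 * I ⟨0, h⟩ + ∑ i ∈ Finset.univ.erase ⟨0, h⟩, I i + n < -a) ↔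
    koszulSystem₂.Idx 0 b a fun i ↦ star₂ (I i) := by
  rw [← idx_star₂]
  refine and_congr_right fun _ ↦ and_congr_right fun hb ↦ forall_congr' fun h ↦ ?_
  rw [shift₂, Finset.sum_add_distrib, ← Finset.add_sum_erase _ _ (Finset.mem_univ ⟨0, h⟩),
    Finset.sum_const, Finset.card_univ, Fintype.card_fin, nsmul_one] at hb
  omega

end two

section odd

variable {p : ℕ} [Fact p.Prime] {n : ℕ} {I : Fin n → Fin 2 × ℤ} {a b : ℤ}

variable (p) in
lemma unstableOdd_eq : unstableOdd p = (koszulSystemOdd p).unst 0 := by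
  funext (g : Fin 2 × ℤ) a
  exact congrArg (· < a) (add_zero (2 * g.2 - ((g.1 : ℕ) : ℤ))).symm

lemma cast_one_sub (δ : Fin 2) : (((1 - δ : Fin 2) : ℕ) : ℤ) = 1 - (δ : ℕ) := by
  fin_cases δ <;> rfl

lemma coadm_starOdd :
    (koszulSystemOdd p).Coadm (fun i ↦ starOdd p (I i)) ↔ CoadmissibleOdd p I := by
  refine forall₂_congr fun i h ↦ ?_
  refine (inadm_opOdd (p := p)).trans ?_
  rw [cast_one_sub, mul_neg]
  omega

lemma sum_deg_starOdd (I : Fin n → Fin 2 × ℤ) :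
    ∑ i, (bigOdd p).deg (starOdd p (I i)) = -shiftOdd p I := by
  rw [shiftOdd, ← Finset.sum_neg_distrib]
  refine Finset.sum_congr rfl fun i _ ↦ ?_
  refine (deg_opOdd (p := p) _ _).trans ?_
  rw [cast_one_sub]
  ring

lemma coadm_deg_starOdd : CoadmissibleOdd p I ∧ b = a - shiftOdd p I ↔
    (koszulSystemOdd p).Coadm (fun i ↦ starOdd p (I i)) ∧
      a + ∑ i, (bigOdd p).deg (starOdd p (I i)) = b := by
  rw [coadm_starOdd, sum_deg_starOdd, ← sub_eq_add_neg, eq_comm]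

lemma idx_starOdd : (CoadmissibleOdd p I ∧ b = a - shiftOdd p I ∧
    ∀ h : 0 < n, 2 * (I ⟨0, h⟩).2 - ((I ⟨0, h⟩).1 : ℕ) < -a) ↔
    (koszulSystemOdd p).Idx 0 a b fun i ↦ starOdd p (I i) := by
  rw [← and_assoc, coadm_deg_starOdd, and_assoc]
  refine and_congr_right fun _ ↦ and_congr_right fun _ ↦ forall_congr' fun h ↦ ?_
  change _ ↔ a - 0 ≤ 2 * -(I ⟨0, h⟩).2 - (((1 - (I ⟨0, h⟩).1 : Fin 2) : ℕ) : ℤ)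
  rw [cast_one_sub]
  omega

lemma idx_starOdd' : (CoadmissibleOdd p I ∧ a = b - shiftOdd p I ∧
    ∀ h : 0 < n, 2 * (p * (I ⟨0, h⟩).2 - ((I ⟨0, h⟩).1 : ℕ)) +
      ∑ i ∈ Finset.univ.erase ⟨0, h⟩, (2 * (I i).2 * (p - 1) - ((I i).1 : ℕ)) + n < -a) ↔
    (koszulSystemOdd p).Idx 0 b a fun i ↦ starOdd p (I i) := by
  rw [← idx_starOdd]
  refine and_congr_right fun _ ↦ and_congr_right fun hb ↦ forall_congr' fun h ↦ ?_
  rw [shiftOdd, Finset.sum_add_distrib, ← Finset.add_sum_erase _ _ (Finset.mem_univ ⟨0, h⟩),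
    Finset.sum_const, Finset.card_univ, Fintype.card_fin, nsmul_one] at hb
  have : 2 * (I ⟨0, h⟩).2 * ((p : ℤ) - 1) = 2 * (p * (I ⟨0, h⟩).2) - 2 * (I ⟨0, h⟩).2 := by ring
  constructor <;> intro <;> linarith

end odd

end DyerLashof
end

open DyerLashof

/-! ### The theorem for `p = 2` and for odd `p` -/

theorem mainTheorem10 :
    -- the prime 2
    ((∀ (n : ℕ) (a b : ℤ),
        Function.Injective (extToStable unstable₂ n a b) ∧
        (∀ I : Fin n → ℤ, Coadmissible₂ I → b = a - shift₂ I →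
          (∀ h : 0 < n, I ⟨0, h⟩ < -a) →
          extToStable unstable₂ n a b (lambda₂ unstable₂ I a b) = lambda₂ (stable big₂) I a b) ∧
        IsBasisOf
          (fun I : {I : Fin n → ℤ // Coadmissible₂ I ∧ b = a - shift₂ I ∧
              ∀ h : 0 < n, I ⟨0, h⟩ < -a} ↦ lambda₂ (stable big₂) I.1 a b)
          (LinearMap.range (extToStable unstable₂ n a b))) ∧
      (∀ (n : ℕ) (a b : ℤ),
        IsBasisOf
          (fun I : {I : Fin n → ℤ // Coadmissible₂ I ∧ a = b - shift₂ I ∧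
              ∀ h : 0 < n, 2 * I ⟨0, h⟩ + ∑ i ∈ Finset.univ.erase ⟨0, h⟩, I i + n < -a} ↦
            lambda₂ unstable₂ I.1 b a)
          (⊤ : Submodule (ZMod 2) (Ext (e unstable₂ b) (e unstable₂ a) n))) ∧
      OppositeRelations big₂ star₂ ∧
      (∀ (n : ℕ) (a b : ℤ),
        IsBasisOf
          (fun I : {I : Fin n → ℤ // Coadmissible₂ I ∧ b = a - shift₂ I} ↦
            lambda₂ (stable big₂) I.1 a b)
          (Submodule.span (ZMod 2)
            (Set.range fun I : Fin n → ℤ ↦ lambda₂ (stable big₂) I a b)))) ∧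
    -- the odd primes
    (∀ (p : ℕ) [Fact p.Prime], 2 < p →
      (∀ (n : ℕ) (a b : ℤ),
        Function.Injective (extToStable (unstableOdd p) n a b) ∧
        (∀ I : Fin n → Fin 2 × ℤ, CoadmissibleOdd p I → b = a - shiftOdd p I →
          (∀ h : 0 < n, 2 * (I ⟨0, h⟩).2 - ((I ⟨0, h⟩).1 : ℕ) < -a) →
          extToStable (unstableOdd p) n a b (lambdaOdd p (unstableOdd p) I a b) =
            lambdaOdd p (stable (bigOdd p)) I a b) ∧
        IsBasisOf
          (fun I : {I : Fin n → Fin 2 × ℤ // CoadmissibleOdd p I ∧ b = a - shiftOdd p I ∧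
              ∀ h : 0 < n, 2 * (I ⟨0, h⟩).2 - ((I ⟨0, h⟩).1 : ℕ) < -a} ↦
            lambdaOdd p (stable (bigOdd p)) I.1 a b)
          (LinearMap.range (extToStable (unstableOdd p) n a b))) ∧
      (∀ (n : ℕ) (a b : ℤ),
        IsBasisOf
          (fun I : {I : Fin n → Fin 2 × ℤ // CoadmissibleOdd p I ∧ a = b - shiftOdd p I ∧
              ∀ h : 0 < n,
                2 * (p * (I ⟨0, h⟩).2 - ((I ⟨0, h⟩).1 : ℕ)) +
                  ∑ i ∈ Finset.univ.erase ⟨0, h⟩, (2 * (I i).2 * (p - 1) - ((I i).1 : ℕ)) + n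
                    < -a} ↦
            lambdaOdd p (unstableOdd p) I.1 b a)
          (⊤ : Submodule (ZMod p) (Ext (e (unstableOdd p) b) (e (unstableOdd p) a) n))) ∧
      OppositeRelations (bigOdd p) (starOdd p) ∧
      (∀ (n : ℕ) (a b : ℤ),
        IsBasisOf
          (fun I : {I : Fin n → Fin 2 × ℤ // CoadmissibleOdd p I ∧ b = a - shiftOdd p I} ↦
            lambdaOdd p (stable (bigOdd p)) I.1 a b)
          (Submodule.span (ZMod p)
            (Set.range fun I : Fin n → Fin 2 × ℤ ↦ lambdaOdd p (stable (bigOdd p)) I a b)))) := by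
  refine ⟨⟨fun n a b ↦ ?_, fun n a b ↦ ?_, ?_, fun n a b ↦ ?_⟩,
    fun p _ _ ↦ ⟨fun n a b ↦ ?_, fun n a b ↦ ?_, ?_, fun n a b ↦ ?_⟩⟩
  · rw [unstable₂_eq]
    exact ⟨koszulSystem₂.extToStable_injective 0 n a b,
      fun I hI hb h ↦ koszulSystem₂.extToStable_dualProd_of_idx (idx_star₂.1 ⟨hI, hb, h⟩),
      koszulSystem₂.isBasisOf_range 0 fun _ ↦ idx_star₂⟩
  · rw [unstable₂_eq]
    exact koszulSystem₂.isBasisOf_top 0 fun _ ↦ idx_star₂'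
  · exact koszulSystem₂.oppositeRelations
  · exact koszulSystem₂.isBasisOf_span fun _ ↦ coadm_deg_star₂
  · rw [unstableOdd_eq]
    exact ⟨(koszulSystemOdd p).extToStable_injective 0 n a b,
      fun I hI hb h ↦
        (koszulSystemOdd p).extToStable_dualProd_of_idx (idx_starOdd.1 ⟨hI, hb, h⟩),
      (koszulSystemOdd p).isBasisOf_range 0 fun _ ↦ idx_starOdd⟩
  · rw [unstableOdd_eq]
    exact (koszulSystemOdd p).isBasisOf_top 0 fun _ ↦ idx_starOdd'
  · exact (koszulSystemOdd p).oppositeRelations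
  · exact (koszulSystemOdd p).isBasisOf_span fun _ ↦ coadm_deg_starOdd
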